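/- Fix an integer $r\ge 0$. A clause of size $r$ is a set of $r$ literals (propositional variables or their negations) on $r$ distinct variables. Max-$r$-Sat above the tight lower bound: an instance is a pair $(F,k)$ where $F$ is a multiset of $m$ clauses of size $r$ and $k$ is a nonnegative integer, the parameter; the question is whether some truth assignment satisfies at least $((2^r-1)m+k)/2^r$ of the clauses of $F$. Max-$r$-Lin2 above the tight lower bound: an instance is a system of linear equations over $\mathbb F_2$, each with at most $r$ variables and with a positive integral weight, together with a nonnegative integer $k$, the parameter; the question is whether some assignment satisfies equations of total weight at least $(W+k)/2$, where $W$ is the total weight of the system. A bikernelization from a parameterized problem $L$ to a parameterized problem $L'$ is a polynomial-time algorithm that maps an instance $(x,k)$ to an instance $(x',k')$ such that $(x,k)\in L$ if and only if $(x',k')\in L'$, $k'\le f(k)$ and $|x'|\le g(k)$ for some functions $f,g$, where $|x'|$ is the length in bits of a binary encoding of $x'$; it is of polynomial size if $g$ is polynomially bounded. A kernelization of $L$ is a bikernelization from $L$ to $L$. Algorithms run on a uniform-cost random access machine with addition and subtraction. All constants may depend on $r$ only. Then: 1. Max-$r$-Sat above the tight lower bound is fixed-parameter tractable (decidable in time $|F|^{O(1)}\cdot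 f(k)$ with $f$ computable), and it can be decided in time $O(m)+2^{O(k^2)}$, in the sense that for some constant $C$ the time is at most $C\,(m+2^{Ck^2})$ for all $(F,k)$. 2. There is a polynomial-size bikernelization from Max-$r$-Sat above the tight lower bound to Max-$r$-Lin2 above the tight lower bound in whose output the total weight of the equations (hence also their number) and the number of variables are at most $Ck^2$, for a constant $C$. 3. There is a polynomial-size kernelization of Max-$r$-Sat above the tight lower bound in whose output the number of clauses and the number of variables are at most $Ck^2$, for a constant $C$. 4. Let $X=\sum_{C\in F}\bigl(1-\prod_{x\in\mathrm{var}(C)}(1+\epsilon_{C,x}\,x)\bigr)$ with $\epsilon_{C,x}=-1$ if $x\in C$ and $\epsilon_{C,x}=1$ if $\overline{x}\in C$. If $X$, after algebraic simplification, has more than $4\cdot 8^{2r}k^2$ nonzero terms, then the answer to the instance $(F,k)$ of Max-$r$-Sat above the tight lower bound is Yes. -/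

import Mathlib

namespace AboveTLB

/-! ### Random access machines

A uniform-cost random access machine over the natural numbers with addition and truncated
subtraction as its only arithmetic. A machine has registers and (finitely many, since every
array is named by a constant in the program) arrays of memory cells with indirect addressing.
Programs are structured, and every instruction and every evaluation of a test costs one step. -/

/-- A configuration: the contents of the registers and of the memory arrays. -/
structure Config where
  reg : ℕ → ℕ
  arr : ℕ → ℕ → ℕ

/-- Write `v` into register `d`. -/
def Config.setReg (s : Config) (d v : ℕ) : Config :=
  { s with reg := Function.update s.reg d v }

/-- Write `v` into cell `i` of array `A`. -/
def Config.setArr (s : Config) (A i v : ℕ) : Config :=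
  { s with arr := Function.update s.arr A (Function.update (s.arr A) i v) }

/-- Programs; all the natural numbers occurring in a program are constants of the program. -/
inductive Prog : Type where
  /-- do nothing -/
  | skip : Prog
  /-- `reg d := c` -/
  | const (d c : ℕ) : Prog
  /-- `reg d := reg a + reg b` -/
  | add (d a b : ℕ) : Prog
  /-- `reg d := max (reg a - reg b) 0` -/
  | sub (d a b : ℕ) : Prog
  /-- `reg d := arr A [reg a]` -/
  | load (d A a : ℕ) : Prog
  /-- `arr A [reg a] := reg b` -/
  | store (A a b : ℕ) : Prog
  /-- `P; Q` -/
  | seq (P Q : Prog) : Prog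
  /-- `if reg a < reg b then P else Q` -/
  | ite (a b : ℕ) (P Q : Prog) : Prog
  /-- `while reg a < reg b do P` -/
  | while (a b : ℕ) (P : Prog) : Prog

/-- `Exec P s s' t`: started in configuration `s`, the program `P` halts in configuration `s'`
after exactly `t` steps. -/
inductive Exec : Prog → Config → Config → ℕ → Prop where
  | skip (s : Config) : Exec .skip s s 1
  | const (d c : ℕ) (s : Config) : Exec (.const d c) s (s.setReg d c) 1
  | add (d a b : ℕ) (s : Config) : Exec (.add d a b) s (s.setReg d (s.reg a + s.reg b)) 1
  | sub (d a b : ℕ) (s : Config) : Exec (.sub d a b) s (s.setReg d (s.reg a - s.reg b)) 1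
  | load (d A a : ℕ) (s : Config) : Exec (.load d A a) s (s.setReg d (s.arr A (s.reg a))) 1
  | store (A a b : ℕ) (s : Config) : Exec (.store A a b) s (s.setArr A (s.reg a) (s.reg b)) 1
  | seq {P Q : Prog} {s s₁ s₂ : Config} {t₁ t₂ : ℕ} (h₁ : Exec P s s₁ t₁)
      (h₂ : Exec Q s₁ s₂ t₂) : Exec (.seq P Q) s s₂ (t₁ + t₂)
  | iteTrue {a b : ℕ} {P Q : Prog} {s s₁ : Config} {t : ℕ} (h : s.reg a < s.reg b)
      (h₁ : Exec P s s₁ t) : Exec (.ite a b P Q) s s₁ (t + 1)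
  | iteFalse {a b : ℕ} {P Q : Prog} {s s₁ : Config} {t : ℕ} (h : ¬ s.reg a < s.reg b)
      (h₁ : Exec Q s s₁ t) : Exec (.ite a b P Q) s s₁ (t + 1)
  | whileFalse {a b : ℕ} {P : Prog} {s : Config} (h : ¬ s.reg a < s.reg b) :
      Exec (.while a b P) s s 1
  | whileTrue {a b : ℕ} {P : Prog} {s s₁ s₂ : Config} {t₁ t₂ : ℕ} (h : s.reg a < s.reg b)
      (h₁ : Exec P s s₁ t₁) (h₂ : Exec (.while a b P) s₁ s₂ t₂) :
      Exec (.while a b P) s s₂ (t₁ + t₂ + 1)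

/-- The initial configuration on the input `(w, k)`: the word `w` is in array `0`, the parameter
`k` is in register `0`, and everything else is `0`. -/
def initial (w : List ℕ) (k : ℕ) : Config where
  reg i := if i = 0 then k else 0
  arr A i := if A = 0 then w.getD i 0 else 0

/-! ### Parameterized problems -/

/-- The length in bits of a list of natural numbers written in binary, with one separator
after each number. -/
def bitLength (w : List ℕ) : ℕ := (w.map fun a => Nat.size a + 1).sum

/-- A parameterized problem: instances `x` with their encodings as lists of natural numbers,
and the set of pairs `(x, k)` with answer Yes. -/
structure ParamProblem where
  Inst : Type
  encode : Inst → List ℕ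
  Yes : Inst → ℕ → Prop

/-- The size `|x|` of an instance: the length of its binary encoding. -/
def ParamProblem.size (L : ParamProblem) (x : L.Inst) : ℕ := bitLength (L.encode x)

/-- `P` decides `L`, on the input `(x, k)` within `T x k` steps; the answer (`1` for Yes) is left
in register `0`. -/
def Decides (P : Prog) (L : ParamProblem) (T : L.Inst → ℕ → ℕ) : Prop :=
  ∀ (x : L.Inst) (k : ℕ), ∃ (s : Config) (t : ℕ),
    Exec P (initial (L.encode x) k) s t ∧ t ≤ T x k ∧ (s.reg 0 = 1 ↔ L.Yes x k)

/-- `P` computes the map `K` from instances of `L` to instances of `L'`, on the input `(x, k)`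
within `T x k` steps; the output `(x', k')` is left in array `1` and register `0`. -/
def Computes (P : Prog) (L L' : ParamProblem) (K : L.Inst → ℕ → L'.Inst × ℕ)
    (T : L.Inst → ℕ → ℕ) : Prop :=
  ∀ (x : L.Inst) (k : ℕ), ∃ (s : Config) (t : ℕ),
    Exec P (initial (L.encode x) k) s t ∧ t ≤ T x k ∧ s.reg 0 = (K x k).2 ∧
      ∀ i < (L'.encode (K x k).1).length, s.arr 1 i = (L'.encode (K x k).1).getD i 0

/-- `g` is bounded by a polynomial. -/
def PolyBounded (g : ℕ → ℕ) : Prop := ∃ c : ℕ, ∀ n, g n ≤ c * n ^ c + c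

/-- Fixed-parameter tractability: decidable in time `|x|^{O(1)} f(k)` with `f` computable. -/
def IsFPT (L : ParamProblem) : Prop :=
  ∃ (P : Prog) (c : ℕ) (f : ℕ → ℕ), Computable f ∧
    Decides P L (fun x k => L.size x ^ c * f k)

/-- `K` is a bikernelization from `L` to `L'` of size `g`: it is computable in time polynomial in
the length of the input `(x, k)`, it preserves the answer, and the new instance and the new
parameter are bounded in terms of the old parameter. -/
def IsBikernelization (L L' : ParamProblem) (K : L.Inst → ℕ → L'.Inst × ℕ) (f g : ℕ → ℕ) :
    Prop :=
  (∃ (P : Prog) (p : ℕ → ℕ), PolyBounded p ∧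
      Computes P L L' K (fun x k => p (L.size x + Nat.size k))) ∧
    ∀ (x : L.Inst) (k : ℕ),
      (L.Yes x k ↔ L'.Yes (K x k).1 (K x k).2) ∧ (K x k).2 ≤ f k ∧ L'.size (K x k).1 ≤ g k

/-- A kernelization of `L` is a bikernelization from `L` to itself. -/
def IsKernelization (L : ParamProblem) (K : L.Inst → ℕ → L.Inst × ℕ) (f g : ℕ → ℕ) : Prop :=
  IsBikernelization L L K f g

/-! ### Max-r-Sat above the tight lower bound -/

/-- A literal: `(x, true)` is the variable `x` and `(x, false)` is its negation. -/
abbrev Literal := ℕ × Bool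

/-- An `r`-CNF formula, a multiset of clauses, given by listing its clauses, each clause being
given by listing its literals. The underlying variables of the literals of a clause are distinct:
no literal is repeated and there is no complementary pair. -/
def RCNF (r : ℕ) : Type :=
  {F : List (List Literal) // ∀ C ∈ F, C.length = r ∧ (C.map Prod.fst).Nodup}

/-- The number of clauses, with multiplicities. -/
def RCNF.numClauses {r : ℕ} (F : RCNF r) : ℕ := F.1.length

/-- The number of variables that occur in the formula. -/
def RCNF.numVars {r : ℕ} (F : RCNF r) : ℕ := (F.1.flatten.map Prod.fst).toFinset.card

/-- The number of clauses satisfied by the truth assignment `τ`. -/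
def RCNF.sat {r : ℕ} (τ : ℕ → Bool) (F : RCNF r) : ℕ :=
  F.1.countP fun C => C.any fun l => τ l.1 == l.2

/-- The number of clauses, followed for each clause by its size and its literals; a literal takes
two numbers, the variable and the sign. -/
def RCNF.encode {r : ℕ} (F : RCNF r) : List ℕ :=
  F.1.length :: F.1.flatMap fun C => C.length :: C.flatMap fun l => [l.1, l.2.toNat]

/-- Max-r-Sat above the tight lower bound: does some truth assignment satisfy at least
`((2^r - 1) m + k) / 2^r` of the `m` clauses? -/
def maxSat (r : ℕ) : ParamProblem where
  Inst := RCNF r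
  encode := RCNF.encode
  Yes F k := ∃ τ : ℕ → Bool,
    (((2 : ℚ) ^ r - 1) * (F.numClauses : ℚ) + (k : ℚ)) / 2 ^ r ≤ (F.sat τ : ℚ)

/-- The polynomial `∑_C (1 - ∏_{x ∈ var(C)} (1 + ε_x x))`, where `ε_x = -1` if `x ∈ C` and
`ε_x = 1` if the negation of `x` is in `C`. -/
noncomputable def RCNF.poly {r : ℕ} (F : RCNF r) : MvPolynomial ℕ ℤ :=
  (F.1.map fun C => 1 - (C.map fun l =>
    1 + MvPolynomial.C (if l.2 = true then (-1 : ℤ) else 1) * MvPolynomial.X l.1).prod).sum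

/-! ### Max-r-Lin2 above the tight lower bound -/

/-- A weighted linear equation over the two-element field: the sum of the listed variables
equals `rhs`. -/
structure LinEq where
  vars : List ℕ
  rhs : ZMod 2
  weight : ℕ

/-- A system of equations with positive integral weights, in which every equation has at
most `r` (distinct) variables. -/
def LinSystem (r : ℕ) : Type :=
  {E : List LinEq // ∀ e ∈ E, e.vars.Nodup ∧ e.vars.length ≤ r ∧ 0 < e.weight}

/-- The total weight of the equations. -/
def LinSystem.totalWeight {r : ℕ} (E : LinSystem r) : ℕ := (E.1.map LinEq.weight).sum

/-- The number of variables that occur in the system. -/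
def LinSystem.numVars {r : ℕ} (E : LinSystem r) : ℕ := (E.1.flatMap LinEq.vars).toFinset.card

/-- The total weight of the equations satisfied by the assignment `z`. -/
def LinSystem.satWeight {r : ℕ} (z : ℕ → ZMod 2) (E : LinSystem r) : ℕ :=
  ((E.1.filter fun e => (e.vars.map z).sum = e.rhs).map LinEq.weight).sum

/-- The number of equations, followed for each equation by the number of its variables, its
variables, its right-hand side and its weight. -/
def LinSystem.encode {r : ℕ} (E : LinSystem r) : List ℕ :=
  E.1.length :: E.1.flatMap fun e => e.vars.length :: (e.vars ++ [e.rhs.val, e.weight])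

/-- Max-r-Lin2 above the tight lower bound: does some assignment satisfy equations of total
weight at least `(W + k) / 2`, where `W` is the weight of the system? -/
def maxLin (r : ℕ) : ParamProblem where
  Inst := LinSystem r
  encode := LinSystem.encode
  Yes E k := ∃ z : ℕ → ZMod 2, ((E.totalWeight : ℚ) + (k : ℚ)) / 2 ≤ (E.satWeight z : ℚ)

end AboveTLB

open AboveTLB

/-!
Write `y_l = ε_x x` for the literals, with `x = 1` for a true and `x = -1` for a false variable. A
satisfied clause contributes `1` to the polynomial `X = ∑_C (1 - ∏ (1 + y_l))`, and any other
clause contributes `1 - 2 ^ r`. So the question is whether `X` takes a value of at least `k` on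
the cube `{-1, 1} ^ n` (`maxSat_yes_iff`). Multiplied out, `X` is the sum, over all clauses and
all nonempty sets of their literals, of the negated products `∏ y_l`, which are signed monomials
of degree between `1` and `r`.

*Many monomials force a positive answer.* As `X` has mean zero on the cube, its maximum is at
least half of the mean of `|X|`. By the Bonami lemma (`sum_cubeEval_pow_four_le`), the fourth
moment of a polynomial of degree at most `r` is at most `9 ^ r` times the square of the second
one, so that the mean of `|X|` is not much smaller than the root of the second moment, which by
Parseval's identity is the sum of the squares of the coefficients. Hence the answer is Yes if this
sum exceeds `4 * 64 ^ r * k ^ 2` (`maxSat_yes_of_sum_sq`), and in particular if `X` has more than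
`4 * 64 ^ r * k ^ 2` terms, as the coefficients are integers (`maxSat_yes_of_card_support`).

*The kernel.* Cancel opposite signed monomials against each other. A coefficient `c` leaves `|c|`
copies of a monomial, and `|c| ≤ c ^ 2`; thus if more than `4 * 64 ^ r * k ^ 2` monomials are
left, the answer is Yes. Otherwise each of them is represented by `2 ^ (r - 1)` clauses on the
variables of the clause from which it comes: if the monomial is the product over the set `S` of
literals, negate in the clause every set of literals that meets `S` in an even number of elements.
The sum of the products `∏ (1 + y_l)` over these sign changes is `2 ^ (r - 1) (1 + ∏_{l ∈ S} y_l)`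
(`sum_flips`), so that the new formula has the polynomial `2 ^ (r - 1) X`, and the new parameter
is `2 ^ (r - 1) k` (`kernelClauses_yes_iff`). The variables are renamed to small numbers, which
makes the kernel small in bits. Replacing every signed monomial of the kernel by the linear
equation that says that the negated monomial is `1` gives the instance of Max-`r`-Lin2
(`toLin_yes_iff`).

*Linear time.* A random access machine with addition needs an array cell for each signed monomial.
The codes of the variables are distinct even powers of two, obtained by doubling, and the address
of a signed monomial is the sum of the codes of its variables, plus a bit for its sign; such sums
determine the variables (`IsCode.addr_inj`). Three passes over the formula assign the codes, count
the signed monomials, and cancel and write the clauses. The case `m < k` is treated separately, so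
that `k ^ 2` can be computed by additions in time `O(m)`. This takes time `O(m)` in total
(`runs_kernelProg`). The decision procedure then tries all assignments to the kernel
(`runs_bruteProg`).

*Verification of programs.* A program without loops acts as a function on configurations
(`Prog.denote`) in time bounded by a constant (`Prog.cost`); a loop is treated by an invariant
(`Runs.while_of_measure`, `Runs.while_of_count`). Only registers from `16` on are used as scratch
registers, and configurations are compared up to these (`Same`, `Keep`).
-/

open AboveTLB
namespace AboveTLB

/-! ### Semantics of loop-free programs -/

/-- The configuration in which a loop-free program halts; loops are skipped. -/
def Prog.denote : Prog → Config → Config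
  | .skip, s => s
  | .const d c, s => s.setReg d c
  | .add d a b, s => s.setReg d (s.reg a + s.reg b)
  | .sub d a b, s => s.setReg d (s.reg a - s.reg b)
  | .load d A a, s => s.setReg d (s.arr A (s.reg a))
  | .store A a b, s => s.setArr A (s.reg a) (s.reg b)
  | .seq P Q, s => Q.denote (P.denote s)
  | .ite a b P Q, s => if s.reg a < s.reg b then P.denote s else Q.denote s
  | .while _ _ _, s => s

/-- The program contains no loop. -/
def Prog.LoopFree : Prog → Prop
  | .seq P Q => P.LoopFree ∧ Q.LoopFree
  | .ite _ _ P Q => P.LoopFree ∧ Q.LoopFree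
  | .while _ _ _ => False
  | _ => True

/-- A bound for the running time of a loop-free program. -/
def Prog.cost : Prog → ℕ
  | .seq P Q => P.cost + Q.cost
  | .ite _ _ P Q => P.cost + Q.cost + 1
  | _ => 1

/-- Started in `s`, the program `P` halts in `s'` after at most `T` steps. -/
def Runs (P : Prog) (s s' : Config) (T : ℕ) : Prop := ∃ t ≤ T, Exec P s s' t

theorem Runs.denote : ∀ {P : Prog}, P.LoopFree → ∀ s, Runs P s (P.denote s) P.cost
  | .skip, _, s => ⟨1, le_rfl, .skip s⟩
  | .const d c, _, s => ⟨1, le_rfl, .const d c s⟩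
  | .add d a b, _, s => ⟨1, le_rfl, .add d a b s⟩
  | .sub d a b, _, s => ⟨1, le_rfl, .sub d a b s⟩
  | .load d A a, _, s => ⟨1, le_rfl, .load d A a s⟩
  | .store A a b, _, s => ⟨1, le_rfl, .store A a b s⟩
  | .seq P Q, h, s => by
    obtain ⟨t, ht, e⟩ := Runs.denote h.1 s
    obtain ⟨t', ht', e'⟩ := Runs.denote h.2 (P.denote s)
    exact ⟨t + t', Nat.add_le_add ht ht', .seq e e'⟩
  | .ite a b P Q, h, s => by
    by_cases hab : s.reg a < s.reg b
    · obtain ⟨t, ht, e⟩ := Runs.denote h.1 s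
      exact ⟨t + 1, by simp only [Prog.cost]; omega, by
        simpa only [Prog.denote, if_pos hab] using .iteTrue hab e⟩
    · obtain ⟨t, ht, e⟩ := Runs.denote h.2 s
      exact ⟨t + 1, by simp only [Prog.cost]; omega, by
        simpa only [Prog.denote, if_neg hab] using .iteFalse hab e⟩

theorem Runs.mono {P : Prog} {s s' : Config} {T T' : ℕ} (h : Runs P s s' T) (hT : T ≤ T') :
    Runs P s s' T' := let ⟨t, ht, e⟩ := h; ⟨t, ht.trans hT, e⟩

theorem Runs.seq {P Q : Prog} {s s₁ s₂ : Config} {T₁ T₂ : ℕ} (h₁ : Runs P s s₁ T₁)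
    (h₂ : Runs Q s₁ s₂ T₂) : Runs (.seq P Q) s s₂ (T₁ + T₂) :=
  let ⟨_, ht, e⟩ := h₁
  let ⟨_, ht', e'⟩ := h₂
  ⟨_, Nat.add_le_add ht ht', .seq e e'⟩

theorem Runs.ite_pos {P Q : Prog} {a b : ℕ} {s s₁ : Config} {T : ℕ} (h : s.reg a < s.reg b)
    (h₁ : Runs P s s₁ T) : Runs (.ite a b P Q) s s₁ (T + 1) :=
  let ⟨_, ht, e⟩ := h₁
  ⟨_, Nat.add_le_add_right ht 1, .iteTrue h e⟩

theorem Runs.ite_neg {P Q : Prog} {a b : ℕ} {s s₁ : Config} {T : ℕ} (h : ¬ s.reg a < s.reg b)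
    (h₁ : Runs Q s s₁ T) : Runs (.ite a b P Q) s s₁ (T + 1) :=
  let ⟨_, ht, e⟩ := h₁
  ⟨_, Nat.add_le_add_right ht 1, .iteFalse h e⟩

/-- A loop whose invariant `I` comes with a strictly decreasing measure `μ`. -/
theorem Runs.while_of_measure {a b T : ℕ} {P : Prog} (I : Config → Prop) (μ : Config → ℕ)
    (step : ∀ s, I s → s.reg a < s.reg b → ∃ s', Runs P s s' T ∧ I s' ∧ μ s' < μ s) (s : Config)
    (h : I s) :
    ∃ s', Runs (.while a b P) s s' (μ s * (T + 1) + 1) ∧ I s' ∧ ¬ s'.reg a < s'.reg b := by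
  induction hn : μ s using Nat.strong_induction_on generalizing s with
  | _ n ih =>
    by_cases hab : s.reg a < s.reg b
    · obtain ⟨s₁, ⟨t₁, ht₁, e₁⟩, h₁, hμ⟩ := step s h hab
      obtain ⟨s₂, ⟨t₂, ht₂, e₂⟩, h₂⟩ := ih _ (hn ▸ hμ) s₁ h₁ rfl
      refine ⟨s₂, ⟨_, ?_, .whileTrue hab e₁ e₂⟩, h₂⟩
      have : (μ s₁ + 1) * (T + 1) ≤ n * (T + 1) := Nat.mul_le_mul_right _ (by omega)
      rw [add_mul] at this
      omega
    · exact ⟨s, ⟨1, by omega, .whileFalse hab⟩, h, hab⟩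

/-- A loop that is run exactly `n` times, with the invariant `I j` after `j` rounds. -/
theorem Runs.while_of_count {a b T : ℕ} {P : Prog} (I : ℕ → Config → Prop) (n : ℕ)
    (step : ∀ j < n, ∀ s, I j s → s.reg a < s.reg b ∧ ∃ s', Runs P s s' T ∧ I (j + 1) s')
    (hend : ∀ s, I n s → ¬ s.reg a < s.reg b) (s : Config) (h : I 0 s) :
    ∃ s', Runs (.while a b P) s s' (n * (T + 1) + 1) ∧ I n s' := by
  have H : ∀ i j, i + j = n → ∀ s, I i s →
      ∃ s', Runs (.while a b P) s s' (j * (T + 1) + 1) ∧ I n s' := by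
    intro i j
    induction j generalizing i with
    | zero =>
      rintro rfl s hs
      exact ⟨s, ⟨1, by omega, .whileFalse (hend s hs)⟩, hs⟩
    | succ j ih =>
      intro hij s hs
      obtain ⟨hab, s₁, ⟨t₁, ht₁, e₁⟩, h₁⟩ := step i (by omega) s hs
      obtain ⟨s₂, ⟨t₂, ht₂, e₂⟩, h₂⟩ := ih (i + 1) (by omega) s₁ h₁
      refine ⟨s₂, ⟨_, ?_, .whileTrue hab e₁ e₂⟩, h₂⟩
      rw [add_mul]
      omega
  exact H 0 n (zero_add n) s h

/-- Run the programs one after another. -/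
def seqs : List Prog → Prog
  | [] => .skip
  | P :: l => .seq P (seqs l)

theorem loopFree_seqs : ∀ {l : List Prog}, (∀ P ∈ l, P.LoopFree) → (seqs l).LoopFree
  | [], _ => trivial
  | P :: _, h => ⟨h P (by simp), loopFree_seqs fun Q hQ => h Q (by simp [hQ])⟩

/-- An invariant of a sequence of loop-free programs indexed by a list. -/
theorem denote_seqs_map {α σ : Type*} {I : σ → Config → Prop} {P : α → Prog} {f : σ → α → σ}
    {l : List α} (h : ∀ a ∈ l, ∀ x s, I x s → I (f x a) ((P a).denote s)) (x : σ) (s : Config)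
    (hs : I x s) : I (l.foldl f x) ((seqs (l.map P)).denote s) := by
  induction l generalizing x s with
  | nil => exact hs
  | cons a l ih =>
    exact ih (fun b hb => h b (by simp [hb])) _ _ (h a (by simp) x s hs)

/-! ### Registers, arrays and configurations up to scratch registers -/

/-- Replace the array `A` by `f`. -/
def Config.putArr (s : Config) (A : ℕ) (f : ℕ → ℕ) : Config :=
  { s with arr := Function.update s.arr A f }

@[simp] theorem setReg_reg (s : Config) (d v x : ℕ) :
    (s.setReg d v).reg x = if x = d then v else s.reg x := by
  simp [Config.setReg, Function.update_apply]

@[simp] theorem setReg_arr (s : Config) (d v : ℕ) : (s.setReg d v).arr = s.arr := rfl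

@[simp] theorem putArr_reg (s : Config) (A : ℕ) (f : ℕ → ℕ) : (s.putArr A f).reg = s.reg := rfl

@[simp] theorem putArr_arr (s : Config) (A B : ℕ) (f : ℕ → ℕ) :
    (s.putArr A f).arr B = if B = A then f else s.arr B := by
  simp [Config.putArr, Function.update_apply]

@[simp] theorem setArr_reg (s : Config) (A i v : ℕ) : (s.setArr A i v).reg = s.reg := rfl

@[simp] theorem setArr_arr (s : Config) (A B i v : ℕ) :
    (s.setArr A i v).arr B = if B = A then Function.update (s.arr A) i v else s.arr B := by
  simp [Config.setArr, Function.update_apply]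

/-! The registers of the programs below have names. Register `0` holds the parameter, and at the
end of a decision the answer. Array `0` holds the given formula, array `2` the codes of its
variables, array `3` the counters of the signed monomials, array `4` the new names of the variables,
and array `6` a truth assignment. The kernel is written to array `1` if it is the final output, and
to array `5` if another program works on it. -/

/-- constant `0` -/
notation "Rzero" => 1
/-- constant `1` -/
notation "Rone" => 2
/-- number of clauses -/
notation "Rm" => 3
/-- number of the current clause -/
notation "Ri" => 4
/-- position of the current clause -/
notation "Rp" => 5
/-- position of the next output word -/
notation "Rq" => 6
/-- next variable code -/
notation "Rnc" => 7
/-- next variable name -/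
notation "Rnn" => 8
/-- number of uncancelled monomials, or of unsatisfied clauses -/
notation "Rw" => 9
/-- number of words per clause -/
notation "Rstride" => 10
/-- loop bound -/
notation "Rbound" => 11
/-- loop counter -/
notation "Rcount" => 12
/-- scratch -/
notation "Rt" => 16
/-- scratch -/
notation "Ru" => 17
/-- variable of the current literal -/
notation "Rv" => 18
/-- sign of the current literal -/
notation "Rsign" => 19
/-- position of the next literal -/
notation "Rlit" => 20
/-- address of a monomial -/
notation "Rkey" => 21
/-- address of the opposite monomial -/
notation "Ropp" => 22
/-- parity -/
notation "Rpar" => 23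

/-- The two configurations agree, except possibly on the scratch registers, which are those from
`16` on. -/
def Same (s s' : Config) : Prop := s'.arr = s.arr ∧ ∀ x < 16, s'.reg x = s.reg x

theorem Same.refl (s : Config) : Same s s := ⟨rfl, fun _ _ => rfl⟩

theorem Same.setReg {s s' : Config} (h : Same s s') {d : ℕ} (v : ℕ) (hd : 16 ≤ d) :
    Same s (s'.setReg d v) :=
  ⟨h.1, fun x hx => by rw [setReg_reg, if_neg (by omega), h.2 x hx]⟩

/-- The words `w` stand in the array `f` from position `i` on. -/
def Mem (f : ℕ → ℕ) : ℕ → List ℕ → Prop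
  | _, [] => True
  | i, a :: w => f i = a ∧ Mem f (i + 1) w

theorem mem_append {f : ℕ → ℕ} {i : ℕ} {w w' : List ℕ} :
    Mem f i (w ++ w') ↔ Mem f i w ∧ Mem f (i + w.length) w' := by
  induction w generalizing i with
  | nil => simp [Mem]
  | cons a w ih => simp [Mem, ih, and_assoc, add_assoc, add_comm 1]

theorem mem_iff {f : ℕ → ℕ} {i : ℕ} {w : List ℕ} :
    Mem f i w ↔ ∀ j < w.length, f (i + j) = w.getD j 0 := by
  induction w generalizing i with
  | nil => simp [Mem]
  | cons a w ih =>
    simp only [Mem, ih]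
    constructor
    · rintro ⟨h, h'⟩ (_ | j) hj
      · exact h
      · simpa [add_assoc, add_comm 1] using h' j (by simpa using hj)
    · refine fun h => ⟨h 0 (by simp), fun j hj => ?_⟩
      simpa [add_assoc, add_comm 1] using h (j + 1) (by simpa using hj)

/-- The array `f` with the words `w` written from position `i` on. -/
def putWords (f : ℕ → ℕ) : ℕ → List ℕ → ℕ → ℕ
  | _, [] => f
  | i, a :: w => putWords (Function.update f i a) (i + 1) w

theorem putWords_append (f : ℕ → ℕ) (i : ℕ) (w w' : List ℕ) :
    putWords f i (w ++ w') = putWords (putWords f i w) (i + w.length) w' := by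
  induction w generalizing f i with
  | nil => rfl
  | cons a w ih => simp [putWords, ih, add_assoc, add_comm 1]

theorem putWords_of_lt (f : ℕ → ℕ) {i x : ℕ} (w : List ℕ) (h : x < i) :
    putWords f i w x = f x := by
  induction w generalizing f i with
  | nil => rfl
  | cons a w ih =>
    rw [putWords, ih _ (by omega), Function.update_of_ne (by omega)]

theorem mem_putWords (f : ℕ → ℕ) (i : ℕ) (w : List ℕ) : Mem (putWords f i w) i w := by
  induction w generalizing f i with
  | nil => trivial
  | cons a w ih =>
    exact ⟨by rw [putWords, putWords_of_lt _ _ (by omega), Function.update_self], ih _ _⟩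

theorem mem_update_of_lt {f : ℕ → ℕ} {i x v : ℕ} {w : List ℕ} (h : x < i) :
    Mem (Function.update f x v) i w ↔ Mem f i w := by
  induction w generalizing i with
  | nil => rfl
  | cons a w ih =>
    rw [Mem, Mem, ih (by omega), Function.update_of_ne (by omega)]

/-! ### Basic blocks -/

/-- Write the words `w` at the output position of the array `o`. -/
def Config.emit (s : Config) (o : ℕ) (w : List ℕ) : Config :=
  (s.putArr o (putWords (s.arr o) (s.reg Rq) w)).setReg Rq (s.reg Rq + w.length)

/-- Write the register `a` at the output position of the array `o`. -/
def emitReg (o a : ℕ) : Prog := .seq (.store o Rq a) (.add Rq Rq Rone)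

theorem denote_emitReg {s s' : Config} {o a v : ℕ} {w : List ℕ} (h : Same (s.emit o w) s')
    (h1 : s.reg Rone = 1) (hv : s'.reg a = v) :
    Same (s.emit o (w ++ [v])) ((emitReg o a).denote s') := by
  obtain ⟨h, h'⟩ := h
  have hq := h' Rq (by omega)
  have hone := h' Rone (by omega)
  simp [Config.emit] at hq hone
  constructor
  · funext A
    have hA := congrFun h A
    have ho := congrFun h o
    by_cases hAo : A = o
    · subst hAo
      simp [Config.emit, emitReg, Prog.denote, putWords_append, hA, hq, hv, putWords] at *
    · simp [Config.emit, emitReg, Prog.denote, hA, hAo]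
  · intro x hx
    have := h' x hx
    simp only [Config.emit, emitReg, Prog.denote, setReg_reg, setArr_reg, putArr_reg, hq, hone,
      h1, List.length_append, List.length_singleton, add_assoc] at this ⊢
    split_ifs with hxq
    · rfl
    · simpa [hxq] using this

/-- Read the literal at position `Rlit` of the array `a`. -/
def readLit (a : ℕ) : Prog :=
  seqs [.load Rv a Rlit, .add Rlit Rlit Rone, .load Rsign a Rlit, .add Rlit Rlit Rone]

/-- Read as many literals as `μ` is long, running `body b` on a literal for the corresponding
entry `b` of `μ`. -/
def forLits (a : ℕ) (body : Bool → Prog) : List Bool → Prog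
  | [] => .skip
  | b :: μ => .seq (readLit a) (.seq (body b) (forLits a body μ))

theorem loopFree_forLits (a : ℕ) {body : Bool → Prog} (h : ∀ b, (body b).LoopFree) :
    ∀ μ, (forLits a body μ).LoopFree
  | [] => trivial
  | b :: μ => ⟨by simp [readLit, seqs, Prog.LoopFree], h b, loopFree_forLits a h μ⟩

/-- The words that encode a list of literals. -/
def litWords (C : List Literal) : List ℕ := C.flatMap fun l => [l.1, l.2.toNat]

/-- The invariant rule for `forLits`: `I d` holds after the literals in `d` have been treated. -/
theorem denote_forLits {a : ℕ} {body : Bool → Prog} (inp : ℕ → ℕ)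
    (I : List (Literal × Bool) → Config → Prop)
    (hI : ∀ d s, I d s → s.arr a = inp ∧ s.reg Rone = 1)
    (frame : ∀ d s x v, 18 ≤ x → x < 21 → I d s → I d (s.setReg x v))
    (step : ∀ d s l b, I d s → s.reg Rv = l.1 → s.reg Rsign = l.2.toNat →
      I (d ++ [(l, b)]) ((body b).denote s) ∧ ((body b).denote s).reg Rlit = s.reg Rlit)
    (C : List Literal) (μ : List Bool) (hμ : μ.length = C.length) (d : List (Literal × Bool))
    (s : Config) (hs : I d s) (hC : Mem inp (s.reg Rlit) (litWords C)) :
    I (d ++ C.zip μ) ((forLits a body μ).denote s) := by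
  induction μ generalizing C d s with
  | nil => simpa [forLits, Prog.denote] using hs
  | cons b μ ih =>
    obtain _ | ⟨l, C⟩ := C
    · simp at hμ
    obtain ⟨ha, h1⟩ := hI _ _ hs
    simp only [litWords, List.flatMap_cons, List.cons_append, List.nil_append, Mem] at hC
    obtain ⟨hv, hsg, hC⟩ := hC
    set s₁ := (readLit a).denote s with hs₁
    have e : s₁ = (((s.setReg Rv l.1).setReg Rlit (s.reg Rlit + 1)).setReg Rsign
        l.2.toNat).setReg Rlit (s.reg Rlit + 1 + 1) := by
      simp [hs₁, readLit, seqs, Prog.denote, h1, ha, hv, hsg]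
    have h₁ : I d s₁ := by
      rw [e]
      iterate 4 refine frame _ _ _ _ (by omega) (by omega) ?_
      exact hs
    obtain ⟨h₂, hl⟩ := step d s₁ l b h₁ (by simp [e]) (by simp [e])
    have := ih C (by simpa using hμ) _ _ h₂ (by rw [hl, e]; simpa [litWords] using hC)
    simpa [forLits, Prog.denote] using this

/-- Run `body` for each of the `Rm` clauses of an encoded formula, `Rp` being the position of the
current clause. -/
def forClauses (body : Prog) : Prog :=
  seqs [.const Ri 0, .const Rp 1,
    .while Ri Rm (seqs [body, .add Ri Ri Rone, .add Rp Rp Rstride])]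

/-- The invariant rule for `forClauses`: `I d` holds after the clauses in `d` have been treated. The
loop body may use all registers except for those of the loop. -/
theorem Runs.forClauses {α : Type*} {L : List α} {n : ℕ} {body : Prog} (hb : body.LoopFree)
    (I : List α → Config → Prop)
    (hI : ∀ d s, I d s → s.reg Rone = 1 ∧ s.reg Rm = L.length ∧ s.reg Rstride = n)
    (frame : ∀ d s x v, x = Ri ∨ x = Rp → I d s → I d (s.setReg x v))
    (step : ∀ d C d', L = d ++ C :: d' → ∀ s, I d s → s.reg Rp = 1 + n * d.length →
      I (d ++ [C]) (body.denote s) ∧ (body.denote s).reg Ri = s.reg Ri ∧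
        (body.denote s).reg Rp = s.reg Rp)
    (s : Config) (hs : I [] s) :
    ∃ s', Runs (forClauses body) s s' ((body.cost + 8) * (L.length + 1)) ∧ I L s' := by
  set P := seqs [body, .add Ri Ri Rone, .add Rp Rp Rstride] with hP
  have hPl : P.LoopFree := ⟨hb, trivial, trivial, trivial⟩
  have hPc : P.cost = body.cost + 3 := rfl
  obtain ⟨s', h, h'⟩ := Runs.while_of_count (a := Ri) (b := Rm) (P := P) (T := P.cost)
    (fun j s => I (L.take j) s ∧ s.reg Ri = j ∧ s.reg Rp = 1 + n * j) L.length
    (by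
      rintro j hj s ⟨hs, hi, hp⟩
      obtain ⟨h1, hm, hst⟩ := hI _ _ hs
      refine ⟨by omega, P.denote s, Runs.denote hPl s, ?_⟩
      have htake : L.take (j + 1) = L.take j ++ [L[j]] := List.take_succ_eq_append_getElem hj
      have hlen : (L.take j).length = j := by simp; omega
      obtain ⟨ha, hi', hp'⟩ := step (L.take j) L[j] (L.drop (j + 1)) (by simp) s hs
        (by rw [hlen]; exact hp)
      obtain ⟨h1', hm', hst'⟩ := hI _ _ ha
      rw [htake]
      refine ⟨frame _ _ _ _ (.inr rfl) (frame _ _ _ _ (.inl rfl) ha), ?_, ?_⟩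
      · simp [hP, seqs, Prog.denote, h1', hi', hi]
      · simp [hP, seqs, Prog.denote, hst', hp', hp]
        ring)
    (by
      rintro s ⟨hs, hi, -⟩
      rw [hi, (hI _ _ hs).2.1]
      exact lt_irrefl _)
    ((s.setReg Ri 0).setReg Rp 1)
    ⟨by simpa using frame _ _ _ _ (.inr rfl) (frame _ _ _ _ (.inl rfl) hs), by simp, by simp⟩
  refine ⟨s', ?_, by simpa using h'.1⟩
  refine (Runs.seq (Runs.denote (P := .const Ri 0) trivial s)
    (Runs.seq (Runs.denote (P := .const Rp 1) trivial _)
      (Runs.seq h (Runs.denote (P := .skip) trivial _)))).mono ?_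
  simp only [Prog.cost] at hPc ⊢
  rw [hPc]
  nlinarith


/-! ### Low-degree polynomials on the cube -/

/-- The sign of the variable `v` at the vertex of the cube given by the set `A` of variables
with value `-1`. -/
def cubeSign (A : Finset ℕ) (v : ℕ) : ℝ := if v ∈ A then -1 else 1

/-- The value at the vertex `A` of the multilinear polynomial in the variables `U` with
coefficients `c`. -/
def cubeEval (c : Finset ℕ → ℝ) (U A : Finset ℕ) : ℝ :=
  ∑ S ∈ U.powerset, c S * ∏ v ∈ S, cubeSign A v

theorem prod_cubeSign_insert {a : ℕ} {S : Finset ℕ} (ha : a ∉ S) (A : Finset ℕ) :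
    ∏ v ∈ S, cubeSign (insert a A) v = ∏ v ∈ S, cubeSign A v := by
  refine Finset.prod_congr rfl fun v hv => ?_
  have : v ≠ a := fun h => ha (h ▸ hv)
  simp [cubeSign, this]

theorem cubeEval_insert_of_notMem (c : Finset ℕ → ℝ) {a : ℕ} {U A : Finset ℕ} (ha : a ∉ U)
    (hA : a ∉ A) : cubeEval c (insert a U) A =
      cubeEval c U A + cubeEval (fun S => c (insert a S)) U A := by
  unfold cubeEval
  rw [Finset.sum_powerset_insert ha]
  congr 1
  refine Finset.sum_congr rfl fun S hS => ?_
  rw [Finset.prod_insert fun h => ha (Finset.mem_powerset.1 hS h)]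
  simp [cubeSign, hA]

theorem cubeEval_insert_insert (c : Finset ℕ → ℝ) {a : ℕ} {U A : Finset ℕ} (ha : a ∉ U) :
    cubeEval c (insert a U) (insert a A) =
      cubeEval c U A - cubeEval (fun S => c (insert a S)) U A := by
  unfold cubeEval
  rw [Finset.sum_powerset_insert ha, sub_eq_add_neg, ← Finset.sum_neg_distrib]
  congr 1 <;> refine Finset.sum_congr rfl fun S hS => ?_
  · rw [prod_cubeSign_insert fun h => ha (Finset.mem_powerset.1 hS h)]
  · have h : a ∉ S := fun h => ha (Finset.mem_powerset.1 hS h)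
    rw [Finset.prod_insert h, prod_cubeSign_insert h]
    simp [cubeSign]

theorem sum_cube_insert (φ : ℝ → ℝ) (c : Finset ℕ → ℝ) {a : ℕ} {U : Finset ℕ} (ha : a ∉ U) :
    ∑ A ∈ (insert a U).powerset, φ (cubeEval c (insert a U) A) =
      ∑ A ∈ U.powerset, (φ (cubeEval c U A + cubeEval (fun S => c (insert a S)) U A) +
        φ (cubeEval c U A - cubeEval (fun S => c (insert a S)) U A)) := by
  rw [Finset.sum_powerset_insert ha, ← Finset.sum_add_distrib]
  refine Finset.sum_congr rfl fun A hA => ?_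
  rw [cubeEval_insert_of_notMem c ha fun h => ha (Finset.mem_powerset.1 hA h),
    cubeEval_insert_insert c ha]

theorem sum_cubeEval (U : Finset ℕ) (c : Finset ℕ → ℝ) :
    ∑ A ∈ U.powerset, cubeEval c U A = 2 ^ U.card * c ∅ := by
  induction U using Finset.induction_on generalizing c with
  | empty => simp [cubeEval]
  | insert a U ha ih =>
    have h := sum_cube_insert id c ha
    simp only [id] at h
    rw [h, Finset.card_insert_of_notMem ha, pow_succ, mul_right_comm, ← ih, Finset.sum_mul]
    exact Finset.sum_congr rfl fun A _ => by ring

/-- Parseval's identity. -/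
theorem sum_cubeEval_sq (U : Finset ℕ) (c : Finset ℕ → ℝ) :
    ∑ A ∈ U.powerset, cubeEval c U A ^ 2 = 2 ^ U.card * ∑ S ∈ U.powerset, c S ^ 2 := by
  induction U using Finset.induction_on generalizing c with
  | empty => simp [cubeEval]
  | insert a U ha ih =>
    rw [sum_cube_insert (· ^ 2) c ha, Finset.card_insert_of_notMem ha, pow_succ,
      mul_right_comm, Finset.sum_powerset_insert ha, mul_add, ← ih, ← ih, add_mul,
      Finset.sum_mul, Finset.sum_mul, ← Finset.sum_add_distrib]
    exact Finset.sum_congr rfl fun A _ => by ring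

/-- The Bonami lemma: the fourth moment of a polynomial of degree at most `d` on the cube is at
most `9 ^ d` times the square of its second moment. Splitting off one variable writes the
polynomial as `g ± h` with `h` of smaller degree, and the mixed term is estimated by
Cauchy-Schwarz. -/
theorem sum_cubeEval_pow_four_le (U : Finset ℕ) (d : ℕ) (c : Finset ℕ → ℝ)
    (hc : ∀ S ⊆ U, d < S.card → c S = 0) :
    ∑ A ∈ U.powerset, cubeEval c U A ^ 4 ≤
      2 ^ U.card * (9 ^ d * (∑ S ∈ U.powerset, c S ^ 2) ^ 2) := by
  induction U using Finset.induction_on generalizing c d with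
  | empty =>
    simp only [cubeEval, Finset.powerset_empty, Finset.sum_singleton, Finset.prod_empty, mul_one,
      Finset.card_empty, pow_zero, one_mul]
    have h9 : (1 : ℝ) ≤ 9 ^ d := one_le_pow₀ (by norm_num)
    nlinarith [sq_nonneg (c ∅ ^ 2)]
  | insert a U ha ih =>
    have hg := ih d c fun S hS => hc S (hS.trans (Finset.subset_insert _ _))
    rw [sum_cube_insert (· ^ 4) c ha, Finset.card_insert_of_notMem ha,
      Finset.sum_powerset_insert ha]
    have hsub : ∀ S ⊆ U, insert a S ⊆ insert a U := fun S hS => Finset.insert_subset_insert _ hS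
    have hcard : ∀ S ⊆ U, (insert a S).card = S.card + 1 := fun S hS =>
      Finset.card_insert_of_notMem fun h => ha (hS h)
    set G := ∑ S ∈ U.powerset, c S ^ 2
    set H := ∑ S ∈ U.powerset, c (insert a S) ^ 2
    have hG : 0 ≤ G := Finset.sum_nonneg fun _ _ => sq_nonneg _
    have hH : 0 ≤ H := Finset.sum_nonneg fun _ _ => sq_nonneg _
    have h2 : (0 : ℝ) < 2 ^ U.card := by positivity
    set g := cubeEval c U
    set h := cubeEval (fun S => c (insert a S)) U with hh
    have e : ∑ A ∈ U.powerset, ((g A + h A) ^ 4 + (g A - h A) ^ 4) =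
        2 * (∑ A ∈ U.powerset, g A ^ 4 + 6 * ∑ A ∈ U.powerset, g A ^ 2 * h A ^ 2 +
          ∑ A ∈ U.powerset, h A ^ 4) := by
      rw [Finset.mul_sum, ← Finset.sum_add_distrib, ← Finset.sum_add_distrib, Finset.mul_sum]
      exact Finset.sum_congr rfl fun A _ => by ring
    rw [e]
    cases d with
    | zero =>
      have h0 : ∀ A, h A = 0 := fun A => Finset.sum_eq_zero fun S hS => by
        have hS := Finset.mem_powerset.1 hS
        simp only [hc _ (hsub S hS) (by rw [hcard S hS]; omega), zero_mul]
      simp only [h0]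
      have : G ^ 2 ≤ (G + H) ^ 2 := by nlinarith
      have := mul_le_mul_of_nonneg_left this h2.le
      simp only [pow_zero, one_mul, zero_pow two_ne_zero, mul_zero, Finset.sum_const_zero,
        zero_pow four_ne_zero, add_zero, pow_succ (2 : ℝ)] at hg ⊢
      linarith
    | succ d =>
      have hQ := ih d (fun S => c (insert a S)) fun S hS hd =>
        hc _ (hsub S hS) (by rw [hcard S hS]; omega)
      have hCS := Finset.sum_mul_sq_le_sq_mul_sq U.powerset (fun A => g A ^ 2) (fun A => h A ^ 2)
      simp only [← pow_mul] at hCS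
      norm_num at hCS
      have hQ0 : 0 ≤ ∑ A ∈ U.powerset, h A ^ 4 := Finset.sum_nonneg fun _ _ => by positivity
      have hR : ∑ A ∈ U.powerset, g A ^ 2 * h A ^ 2 ≤ 2 ^ U.card * (3 * 9 ^ d * (G * H)) := by
        refine abs_le_of_sq_le_sq' ?_ (by positivity) |>.2
        refine hCS.trans ((mul_le_mul hg hQ hQ0 (by positivity)).trans (le_of_eq ?_))
        ring
      have h9 : (0 : ℝ) < 9 ^ d := by positivity
      have : 2 ^ U.card * (9 ^ (d + 1) * G ^ 2) + 6 * (2 ^ U.card * (3 * 9 ^ d * (G * H))) +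
          2 ^ U.card * (9 ^ d * H ^ 2) ≤ 2 ^ U.card * (9 ^ (d + 1) * (G + H) ^ 2) := by
        rw [← sub_nonneg]
        have : 0 ≤ 2 ^ U.card * (9 ^ d * (8 * H ^ 2)) := by positivity
        refine this.trans (le_of_eq ?_)
        ring
      rw [pow_succ]
      linarith

/-- A polynomial of degree at most `d` on the cube, with zero constant coefficient and second
moment greater than `4 * 64 ^ d * k ^ 2`, exceeds `k` somewhere. Otherwise the mean of its
absolute value would be at most `2 * k`, as its mean is zero; but that mean is bounded from below
by the second and the fourth moments. -/
theorem exists_le_cubeEval (U : Finset ℕ) (d : ℕ) (c : Finset ℕ → ℝ)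
    (hc : ∀ S ⊆ U, d < S.card → c S = 0) (h0 : c ∅ = 0) {k : ℝ} (hk : 0 ≤ k)
    (h : 4 * 64 ^ d * k ^ 2 < ∑ S ∈ U.powerset, c S ^ 2) :
    ∃ A ∈ U.powerset, k ≤ cubeEval c U A := by
  by_contra! hlt
  have h1 := sum_cubeEval U c
  have h2 := sum_cubeEval_sq U c
  have h4 := sum_cubeEval_pow_four_le U d c hc
  set V := ∑ S ∈ U.powerset, c S ^ 2
  set f := cubeEval c U
  have hV : 0 < V := lt_of_le_of_lt (by positivity) h
  have hN : (0 : ℝ) < 2 ^ U.card := by positivity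
  set σ := Real.sqrt V
  have hσ : 0 < σ := Real.sqrt_pos.2 hV
  have hσ2 : σ ^ 2 = V := Real.sq_sqrt hV.le
  have h3 : (0 : ℝ) < 3 ^ d := by positivity
  -- the value of `M` for which the estimate of the absolute value below is best on average
  set M := 2 / 3 * (3 ^ d * σ) with hM
  have hM0 : 0 < M := by positivity
  have key : ∀ x : ℝ, x ^ 2 / M - 4 / 27 * (x ^ 4 / M ^ 3) ≤ |x| := by
    intro x
    have hz : 0 ≤ |x| / M := by positivity
    have e : |x| - (x ^ 2 / M - 4 / 27 * (x ^ 4 / M ^ 3)) =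
        M * (|x| / M * ((|x| / M - 3 / 2) ^ 2 * (|x| / M + 3) * (4 / 27))) := by
      have h4 : x ^ 4 = |x| ^ 4 := by
        rw [← abs_pow]
        exact (abs_of_nonneg (by positivity)).symm
      rw [← sq_abs x, h4]
      field_simp
      ring
    rw [← sub_nonneg, e]
    positivity
  have habs : ∀ A ∈ U.powerset, |f A| ≤ 2 * k - f A := fun A hA =>
    abs_le.2 ⟨by linarith, by linarith [hlt A hA]⟩
  have hsum := Finset.sum_le_sum fun A hA => (key (f A)).trans (habs A hA)
  rw [Finset.sum_sub_distrib, ← Finset.mul_sum, ← Finset.sum_div, ← Finset.sum_div,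
    Finset.sum_sub_distrib, h1, h2, h0, Finset.sum_const, Finset.card_powerset,
    nsmul_eq_mul] at hsum
  push_cast at hsum
  have h4' : 4 / 27 * ((∑ A ∈ U.powerset, f A ^ 4) / M ^ 3) ≤
      4 / 27 * ((2 ^ U.card * (9 ^ d * V ^ 2)) / M ^ 3) := by gcongr
  have hfin : 2 ^ U.card * V / M - 4 / 27 * ((2 ^ U.card * (9 ^ d * V ^ 2)) / M ^ 3) =
      2 ^ U.card * (σ / 3 ^ d) := by
    rw [show (9 : ℝ) ^ d = (3 ^ d) ^ 2 by rw [← pow_mul, mul_comm, pow_mul]; norm_num, ← hσ2, hM]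
    field_simp
    ring
  have hle : σ / 3 ^ d ≤ 2 * k := by
    refine le_of_mul_le_mul_left ?_ hN
    linarith
  rw [div_le_iff₀ h3] at hle
  have : V ≤ 4 * 9 ^ d * k ^ 2 := by
    rw [← hσ2, show (9 : ℝ) ^ d = (3 ^ d) ^ 2 by rw [← pow_mul, mul_comm, pow_mul]; norm_num]
    nlinarith
  have h964 : (9 : ℝ) ^ d ≤ 64 ^ d := by gcongr; norm_num
  nlinarith [sq_nonneg k]


/-! ### Expansion of clauses into monomials -/

/-- All `0`-`1` vectors of length `n`. -/
def masks : ℕ → List (List Bool)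
  | 0 => [[]]
  | n + 1 => (masks n).map (false :: ·) ++ (masks n).map (true :: ·)

/-- All nonzero `0`-`1` vectors of length `n`. -/
def nzMasks : ℕ → List (List Bool)
  | 0 => []
  | n + 1 => (nzMasks n).map (false :: ·) ++ (masks n).map (true :: ·)

theorem length_of_mem_masks {n : ℕ} {μ : List Bool} (h : μ ∈ masks n) : μ.length = n := by
  induction n generalizing μ with
  | zero => simp_all [masks]
  | succ n ih =>
    simp only [masks, List.mem_append, List.mem_map] at h
    obtain ⟨ν, hν, rfl⟩ | ⟨ν, hν, rfl⟩ := h <;> simp [ih hν]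

theorem length_of_mem_nzMasks {n : ℕ} {μ : List Bool} (h : μ ∈ nzMasks n) : μ.length = n := by
  induction n generalizing μ with
  | zero => simp_all [nzMasks]
  | succ n ih =>
    simp only [nzMasks, List.mem_append, List.mem_map] at h
    obtain ⟨ν, hν, rfl⟩ | ⟨ν, hν, rfl⟩ := h
    · simp [ih hν]
    · simp [length_of_mem_masks hν]

theorem true_mem_of_mem_nzMasks {n : ℕ} {μ : List Bool} (h : μ ∈ nzMasks n) : true ∈ μ := by
  induction n generalizing μ with
  | zero => simp_all [nzMasks]
  | succ n ih =>
    simp only [nzMasks, List.mem_append, List.mem_map] at h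
    obtain ⟨ν, hν, rfl⟩ | ⟨ν, hν, rfl⟩ := h
    · simp [ih hν]
    · simp

theorem length_masks (n : ℕ) : (masks n).length = 2 ^ n := by
  induction n with
  | zero => rfl
  | succ n ih => simp [masks, ih, pow_succ, mul_two]

theorem length_nzMasks (n : ℕ) : (nzMasks n).length + 1 = 2 ^ n := by
  induction n with
  | zero => rfl
  | succ n ih =>
    simp only [nzMasks, List.length_append, List.length_map, length_masks, pow_succ]
    omega

section
variable {R : Type*} [CommRing R]

/-- The product of the factors `y l` over the entries `l` of `d` selected by a mask. -/
def maskProd {α : Type*} (y : α → R) (d : List (α × Bool)) : R :=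
  (d.map fun p => if p.2 then y p.1 else 1).prod

theorem sum_masks {α : Type*} (y : α → R) (C : List α) :
    ((masks C.length).map fun μ => maskProd y (C.zip μ)).sum = (C.map fun l => 1 + y l).prod := by
  induction C with
  | nil => simp [masks, maskProd]
  | cons l C ih =>
    simp only [List.length_cons, masks, List.map_append, List.sum_append, List.map_map,
      Function.comp_def, List.zip_cons_cons, List.map_cons, List.prod_cons, ← ih, maskProd,
      List.sum_map_mul_left]
    simp
    ring

theorem sum_nzMasks {α : Type*} (y : α → R) (C : List α) :
    ((nzMasks C.length).map fun μ => maskProd y (C.zip μ)).sum =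
      (C.map fun l => 1 + y l).prod - 1 := by
  induction C with
  | nil => simp [nzMasks]
  | cons l C ih =>
    have h := sum_masks y C
    simp only [List.length_cons, nzMasks, List.map_append, List.sum_append, List.map_map,
      Function.comp_def, List.zip_cons_cons, List.map_cons, List.prod_cons, maskProd,
      List.sum_map_mul_left] at ih h ⊢
    simp [ih, h]
    ring

/-- The factor `ε_x x` of a literal at the values `χ` of the variables. -/
def litVal (χ : ℕ → R) (l : Literal) : R := (if l.2 = true then -1 else 1) * χ l.1

/-- The polynomial `∑_C (1 - ∏ (1 + ε_x x))` at the values `χ` of the variables. -/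
def polyVal (χ : ℕ → R) (F : List (List Literal)) : R :=
  (F.map fun C => 1 - (C.map fun l => 1 + litVal χ l).prod).sum

/-- A clause together with a set of its literals, given by a mask. -/
abbrev Occ := List Literal × List Bool

/-- All pairs of a clause and a nonempty set of its literals. -/
def occs (r : ℕ) (F : List (List Literal)) : List Occ :=
  F.flatMap fun C => (nzMasks r).map fun μ => (C, μ)

/-- The value of the monomial of an occurrence. -/
def occVal (χ : ℕ → R) (o : Occ) : R := maskProd (litVal χ) (o.1.zip o.2)

theorem polyVal_eq_sum_occs (χ : ℕ → R) {r : ℕ} {F : List (List Literal)}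
    (hF : ∀ C ∈ F, C.length = r) :
    polyVal χ F = -((occs r F).map (occVal χ)).sum := by
  induction F with
  | nil => simp [polyVal, occs]
  | cons C F ih =>
    have h := sum_nzMasks (litVal χ) C
    rw [hF C (by simp)] at h
    have ih := ih fun D hD => hF D (by simp [hD])
    simp only [polyVal, occs, List.map_cons, List.sum_cons, List.flatMap_cons, List.map_append,
      List.sum_append, List.map_map, Function.comp_def, occVal] at ih h ⊢
    rw [ih, h]
    ring

/-- The variables of the literals of `d` selected by a mask. -/
def dVars (d : List (Literal × Bool)) : Finset ℕ :=
  ((d.filter fun p => p.2).map fun p => p.1.1).toFinset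

/-- The parity of the number of positive literals of `d` selected by a mask. -/
def dPar (d : List (Literal × Bool)) : ℕ := (d.countP fun p => p.2 && p.1.2) % 2

/-- The value of the signed monomial with variables `κ.1` and sign `(-1) ^ κ.2`. -/
def itemVal (χ : ℕ → R) (κ : Finset ℕ × ℕ) : R := (-1) ^ κ.2 * ∏ v ∈ κ.1, χ v

theorem maskProd_litVal (χ : ℕ → R) {d : List (Literal × Bool)}
    (hd : (d.map fun p => p.1.1).Nodup) :
    maskProd (litVal χ) d = itemVal χ (dVars d, dPar d) := by
  unfold itemVal dPar
  rw [← neg_one_pow_eq_pow_mod_two]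
  induction d with
  | nil => simp [maskProd, dVars]
  | cons p d ih =>
    obtain ⟨⟨v, b⟩, m⟩ := p
    rw [List.map_cons, List.nodup_cons] at hd
    have ih := ih hd.2
    have hv : v ∉ dVars d := fun h => hd.1 <| by
      simp only [dVars, List.mem_toFinset, List.mem_map, List.mem_filter] at h ⊢
      obtain ⟨p, hp, rfl⟩ := h
      exact ⟨p, hp.1, rfl⟩
    cases m with
    | false => simpa [maskProd, dVars] using ih
    | true =>
      have e : dVars (((v, b), true) :: d) = insert v (dVars d) := by simp [dVars]
      rw [e, Finset.prod_insert hv]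
      simp only [maskProd] at ih
      rw [maskProd, List.map_cons, List.prod_cons, ih]
      simp only [litVal, if_true, Bool.true_and, List.countP_cons]
      cases b <;> simp [pow_succ] <;> ring

end

/-- The signed monomial of an occurrence. -/
def item (o : Occ) : Finset ℕ × ℕ := (dVars (o.1.zip o.2), dPar (o.1.zip o.2))

theorem item_snd_lt (o : Occ) : (item o).2 < 2 := Nat.mod_lt _ (by norm_num)

theorem map_zip_fst {α β γ : Type*} {l : List α} {l' : List β} (f : α → γ)
    (h : l'.length = l.length) : ((l.zip l').map fun p => f p.1) = l.map f := by
  have : (l.zip l').map Prod.fst = l := List.map_fst_zip h.ge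
  conv_rhs => rw [← this, List.map_map]
  rfl

theorem occVal_eq {R : Type*} [CommRing R] (χ : ℕ → R) {o : Occ} (h : o.2.length = o.1.length)
    (hn : (o.1.map Prod.fst).Nodup) : occVal χ o = itemVal χ (item o) :=
  maskProd_litVal χ (by rwa [map_zip_fst (fun l : Literal => l.1) h])

theorem item_fst_subset {o : Occ} : (item o).1 ⊆ (o.1.map Prod.fst).toFinset := by
  intro v hv
  simp only [item, dVars, List.mem_toFinset, List.mem_map, List.mem_filter] at hv ⊢
  obtain ⟨p, ⟨hp, -⟩, rfl⟩ := hv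
  exact ⟨p.1, (List.of_mem_zip hp).1, rfl⟩

theorem item_fst_nonempty {o : Occ} (h : o.2.length = o.1.length) (ht : true ∈ o.2) :
    (item o).1.Nonempty := by
  obtain ⟨C, μ⟩ := o
  simp only [item] at *
  induction μ generalizing C with
  | nil => simp at ht
  | cons b μ ih =>
    obtain _ | ⟨l, C⟩ := C
    · simp at h
    cases b with
    | true => exact ⟨l.1, by simp [dVars]⟩
    | false =>
      obtain ⟨v, hv⟩ := ih C (by simpa using h) (by simpa using ht)
      exact ⟨v, by simpa [dVars] using hv⟩

/-- The coefficient of the monomial `S` in the sum of the negated signed monomials `L`. -/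
def coef (L : List (Finset ℕ × ℕ)) (S : Finset ℕ) : ℤ := L.count (S, 1) - L.count (S, 0)

theorem sum_itemVal {R : Type*} [CommRing R] (χ : ℕ → R) (𝒮 : Finset (Finset ℕ))
    (L : List (Finset ℕ × ℕ)) (hL : ∀ κ ∈ L, κ.1 ∈ 𝒮 ∧ κ.2 < 2) :
    -(L.map (itemVal χ)).sum = ∑ S ∈ 𝒮, (coef L S : R) * ∏ v ∈ S, χ v := by
  induction L with
  | nil => simp [coef]
  | cons κ L ih =>
    obtain ⟨S, b⟩ := κ
    obtain ⟨hS, hb⟩ := hL (S, b) (by simp)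
    have hc : ∀ T, coef ((S, b) :: L) T = coef L T + if T = S then -(-1) ^ b else 0 := by
      intro T
      simp only [coef, List.count_cons, beq_iff_eq, Prod.mk.injEq, @eq_comm _ S T]
      by_cases h : T = S
      · obtain rfl | rfl : b = 0 ∨ b = 1 := by simp only at hb; omega
        · simp [h]
          ring
        · simp [h]
          ring
      · simp [h]
    simp only [hc, Int.cast_add, add_mul, Finset.sum_add_distrib,
      ← ih fun κ hκ => hL κ (by simp [hκ]), List.map_cons, List.sum_cons]
    rw [Finset.sum_eq_single S (fun T _ hT => by simp [hT]) (fun h => absurd hS h)]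
    simp only [itemVal, if_true]
    push_cast
    ring

theorem length_eq_sum_count (𝒮 : Finset (Finset ℕ))
    (L : List (Finset ℕ × ℕ)) (hL : ∀ κ ∈ L, κ.1 ∈ 𝒮 ∧ κ.2 < 2) :
    L.length = ∑ S ∈ 𝒮, (L.count (S, 1) + L.count (S, 0)) := by
  induction L with
  | nil => simp
  | cons κ L ih =>
    obtain ⟨S, b⟩ := κ
    obtain ⟨hS, hb⟩ := hL (S, b) (by simp)
    have hc : ∀ T, ((S, b) :: L).count (T, 1) + ((S, b) :: L).count (T, 0) =
        (L.count (T, 1) + L.count (T, 0)) + if T = S then 1 else 0 := by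
      intro T
      simp only [List.count_cons, beq_iff_eq, Prod.mk.injEq, @eq_comm _ S T]
      by_cases h : T = S
      · obtain rfl | rfl : b = 0 ∨ b = 1 := by simp only at hb; omega
        · simp [h]
          ring
        · simp [h]
          ring
      · simp [h]
    simp only [hc, Finset.sum_add_distrib (g := fun T => if T = S then 1 else 0),
      ← ih fun κ hκ => hL κ (by simp [hκ]), List.length_cons]
    rw [Finset.sum_ite_eq' 𝒮 S, if_pos hS]

/-! ### Truth assignments -/

/-- The value `1` or `-1` of a variable under a truth assignment. -/
def boolSign (τ : ℕ → Bool) (v : ℕ) : ℤ := if τ v then 1 else -1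

/-- The truth assignment `τ` satisfies the clause `C`. -/
abbrev satClause (τ : ℕ → Bool) (C : List Literal) : Bool := C.any fun l => τ l.1 == l.2

theorem prod_one_add_litVal (τ : ℕ → Bool) (C : List Literal) :
    (C.map fun l => 1 + litVal (boolSign τ) l).prod =
      if satClause τ C = true then 0 else 2 ^ C.length := by
  induction C with
  | nil => simp [satClause]
  | cons l C ih =>
    rw [List.map_cons, List.prod_cons, ih]
    obtain ⟨v, b⟩ := l
    simp only [satClause, List.any_cons, litVal, boolSign, List.length_cons, pow_succ']
    cases b <;> cases τ v <;> simp [-List.any_eq_true]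

theorem polyVal_boolSign {r : ℕ} (τ : ℕ → Bool) {F : List (List Literal)}
    (hF : ∀ C ∈ F, C.length = r) :
    polyVal (boolSign τ) F = F.length - 2 ^ r * (F.countP fun C => !satClause τ C) := by
  induction F with
  | nil => simp [polyVal]
  | cons C F ih =>
    have ih := ih fun D hD => hF D (by simp [hD])
    simp only [polyVal, prod_one_add_litVal, List.map_cons, List.sum_cons, List.length_cons,
      List.countP_cons] at ih ⊢
    rw [ih, hF C (by simp)]
    cases h : satClause τ C <;> simp <;> ring

/-- A clause that is not satisfied costs `2 ^ r`. In this form the condition can be tested with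
additions only. -/
theorem maxSat_yes_iff_unsat {r : ℕ} (F : RCNF r) (k : ℕ) :
    (maxSat r).Yes F k ↔
      ∃ τ, k + 2 ^ r * (F.1.countP fun C => !satClause τ C) ≤ F.1.length := by
  refine exists_congr fun τ => ?_
  have h : F.1.length = F.sat τ + F.1.countP fun C => !satClause τ C :=
    List.length_eq_countP_add_countP (satClause τ) (l := F.1) |>.trans
      (by simp [RCNF.sat, satClause])
  rw [div_le_iff₀ (by positivity), RCNF.numClauses, ← Nat.cast_le (α := ℚ)]
  have h' : (F.1.length : ℚ) = F.sat τ + (F.1.countP fun C => !satClause τ C : ℕ) := by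
    exact_mod_cast h
  push_cast
  rw [h']
  constructor <;> intro H <;> linarith

/-- A clause contributes `1` to the polynomial if it is satisfied and `1 - 2 ^ r` otherwise, so that
the question is whether the polynomial takes a value of at least `k`. -/
theorem maxSat_yes_iff {r : ℕ} (F : RCNF r) (k : ℕ) :
    (maxSat r).Yes F k ↔ ∃ τ, (k : ℤ) ≤ polyVal (boolSign τ) F.1 := by
  rw [maxSat_yes_iff_unsat]
  refine exists_congr fun τ => ?_
  rw [polyVal_boolSign τ fun C hC => (F.2 C hC).1, ← Nat.cast_le (α := ℤ)]
  push_cast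
  constructor <;> intro H <;> linarith

theorem polyVal_congr {R : Type*} [CommRing R] {χ χ' : ℕ → R} {F : List (List Literal)}
    (h : ∀ C ∈ F, ∀ l ∈ C, χ l.1 = χ' l.1) : polyVal χ F = polyVal χ' F := by
  unfold polyVal
  congr 1
  refine List.map_congr_left fun C hC => ?_
  congr 2
  exact List.map_congr_left fun l hl => by rw [litVal, litVal, h C hC l hl]

theorem polyVal_append {R : Type*} [CommRing R] (χ : ℕ → R) (F G : List (List Literal)) :
    polyVal χ (F ++ G) = polyVal χ F + polyVal χ G := by simp [polyVal]

/-! ### Many monomials force a positive answer -/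

/-- The signed monomials of a formula. -/
def items (r : ℕ) (F : List (List Literal)) : List (Finset ℕ × ℕ) := (occs r F).map item

/-- The variables of a formula. -/
def varSet (F : List (List Literal)) : Finset ℕ := (F.flatten.map Prod.fst).toFinset

theorem mem_occs {r : ℕ} {F : List (List Literal)} {o : Occ} :
    o ∈ occs r F ↔ o.1 ∈ F ∧ o.2 ∈ nzMasks r := by
  obtain ⟨C, μ⟩ := o
  simp only [occs, List.mem_flatMap, List.mem_map, Prod.mk.injEq]
  constructor
  · rintro ⟨D, hD, ν, hν, rfl, rfl⟩
    exact ⟨hD, hν⟩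
  · exact fun h => ⟨C, h.1, μ, h.2, rfl, rfl⟩

theorem length_occs (r : ℕ) (F : List (List Literal)) :
    (occs r F).length + F.length = 2 ^ r * F.length := by
  have h : (occs r F).length = F.length * (nzMasks r).length := by
    induction F with
    | nil => simp [occs]
    | cons C F ih =>
      simp only [occs, List.flatMap_cons, List.length_append, List.length_map,
        List.length_cons] at ih ⊢
      rw [ih]
      ring
  rw [h, ← length_nzMasks]
  ring

theorem length_occs_le (r : ℕ) (F : List (List Literal)) :
    (occs r F).length ≤ 2 ^ r * F.length := by
  have := length_occs r F
  omega

theorem subset_varSet {F : List (List Literal)} {C : List Literal} (hC : C ∈ F) :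
    (C.map Prod.fst).toFinset ⊆ varSet F := by
  intro v hv
  simp only [varSet, List.mem_toFinset, List.mem_map, List.mem_flatten] at hv ⊢
  obtain ⟨l, hl, rfl⟩ := hv
  exact ⟨l, ⟨C, hC, hl⟩, rfl⟩

theorem item_of_mem_occs {r : ℕ} (F : RCNF r) {o : Occ} (ho : o ∈ occs r F.1) :
    (item o).1 ⊆ varSet F.1 ∧ (item o).1.card ≤ r ∧ (item o).1.Nonempty := by
  obtain ⟨h1, h2⟩ := mem_occs.1 ho
  obtain ⟨hl, -⟩ := F.2 _ h1
  refine ⟨item_fst_subset.trans (subset_varSet h1), ?_, item_fst_nonempty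
    ((length_of_mem_nzMasks h2).trans hl.symm) (true_mem_of_mem_nzMasks h2)⟩
  refine (Finset.card_le_card item_fst_subset).trans ((List.toFinset_card_le _).trans ?_)
  simp [hl]

theorem sum_occVal {R : Type*} [CommRing R] (χ : ℕ → R) {r : ℕ} (F : RCNF r) {E : List Occ}
    (hE : ∀ o ∈ E, o ∈ occs r F.1) :
    -(E.map (occVal χ)).sum =
      ∑ S ∈ (varSet F.1).powerset, (coef (E.map item) S : R) * ∏ v ∈ S, χ v := by
  rw [← sum_itemVal χ _ _ ?_, List.map_map]
  · congr 2
    refine List.map_congr_left fun o ho => ?_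
    obtain ⟨h1, h2⟩ := mem_occs.1 (hE o ho)
    obtain ⟨hl, hn⟩ := F.2 _ h1
    exact occVal_eq χ ((length_of_mem_nzMasks h2).trans hl.symm) hn
  · intro κ hκ
    obtain ⟨o, ho, rfl⟩ := List.mem_map.1 hκ
    exact ⟨Finset.mem_powerset.2 (item_of_mem_occs F (hE o ho)).1, item_snd_lt o⟩

theorem polyVal_eq_sum_coef {R : Type*} [CommRing R] (χ : ℕ → R) {r : ℕ} (F : RCNF r) :
    polyVal χ F.1 =
      ∑ S ∈ (varSet F.1).powerset, (coef (items r F.1) S : R) * ∏ v ∈ S, χ v := by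
  rw [polyVal_eq_sum_occs χ fun C hC => (F.2 C hC).1, items, ← sum_occVal χ F fun _ h => h]

theorem coef_eq_zero {L : List (Finset ℕ × ℕ)} {S : Finset ℕ} (h : ∀ κ ∈ L, κ.1 ≠ S) :
    coef L S = 0 := by
  rw [coef, List.count_eq_zero_of_not_mem fun hm => h _ hm rfl,
    List.count_eq_zero_of_not_mem fun hm => h _ hm rfl]
  simp

theorem map_polyVal {R R' : Type*} [CommRing R] [CommRing R'] (f : R →+* R') (χ : ℕ → R)
    (F : List (List Literal)) : f (polyVal χ F) = polyVal (fun v => f (χ v)) F := by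
  simp [polyVal, map_list_sum, map_list_prod, Function.comp_def, litVal, apply_ite f]

/-- The criterion `exists_le_cubeEval` for the polynomial of a formula. -/
theorem maxSat_yes_of_sum_sq {r : ℕ} (F : RCNF r) (k : ℕ)
    (h : 4 * 64 ^ r * (k : ℤ) ^ 2 < ∑ S ∈ (varSet F.1).powerset, coef (items r F.1) S ^ 2) :
    (maxSat r).Yes F k := by
  have hitem : ∀ κ ∈ items r F.1, κ.1.card ≤ r ∧ κ.1.Nonempty := fun κ hκ => by
    obtain ⟨o, ho, rfl⟩ := List.mem_map.1 hκ
    exact (item_of_mem_occs F ho).2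
  obtain ⟨A, -, hA⟩ := exists_le_cubeEval (varSet F.1) r
    (fun S => (coef (items r F.1) S : ℝ))
    (fun S _ hS => by
      rw [coef_eq_zero fun κ hκ he => absurd (hitem κ hκ).1 (by rw [he]; omega), Int.cast_zero])
    (by
      rw [coef_eq_zero fun κ hκ he => absurd (hitem κ hκ).2 (by rw [he]; simp), Int.cast_zero])
    (Nat.cast_nonneg k) (by exact_mod_cast h)
  rw [cubeEval, ← polyVal_eq_sum_coef] at hA
  refine (maxSat_yes_iff F k).2 ⟨fun v => decide (v ∉ A), ?_⟩
  have hcast := map_polyVal (Int.castRingHom ℝ) (boolSign fun v => decide (v ∉ A)) F.1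
  rw [eq_intCast] at hcast
  rw [← Int.cast_le (R := ℝ), hcast]
  have hsign : (fun v => (Int.castRingHom ℝ) (boolSign (fun v => decide (v ∉ A)) v)) =
      cubeSign A := by
    funext v
    by_cases hv : v ∈ A <;> simp [boolSign, cubeSign, hv]
  rw [hsign]
  exact_mod_cast hA

theorem poly_eq_polyVal {r : ℕ} (F : RCNF r) : F.poly = polyVal MvPolynomial.X F.1 := by
  unfold RCNF.poly polyVal litVal
  simp only [apply_ite (MvPolynomial.C (σ := ℕ) (R := ℤ)), map_neg, map_one]

/-- The nonzero coefficients are integers, so that their squares add up to at least the number of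
terms. -/
theorem maxSat_yes_of_card_support {r : ℕ} (F : RCNF r) (k : ℕ)
    (h : 4 * 8 ^ (2 * r) * k ^ 2 < F.poly.support.card) : (maxSat r).Yes F k := by
  refine maxSat_yes_of_sum_sq F k ?_
  rw [pow_mul] at h
  norm_num at h
  refine lt_of_lt_of_le (b := (F.poly.support.card : ℤ)) (by exact_mod_cast h) ?_
  have hmon : ∀ S : Finset ℕ, (∏ v ∈ S, MvPolynomial.X v : MvPolynomial ℕ ℤ) =
      MvPolynomial.monomial (∑ v ∈ S, Finsupp.single v 1) 1 := fun S => by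
    rw [MvPolynomial.monomial_sum_one]
    rfl
  have hsub : F.poly.support ⊆ ((varSet F.1).powerset.filter fun S =>
      coef (items r F.1) S ≠ 0).image fun S => ∑ v ∈ S, Finsupp.single v 1 := by
    intro d hd
    rw [MvPolynomial.mem_support_iff, poly_eq_polyVal, polyVal_eq_sum_coef,
      MvPolynomial.coeff_sum] at hd
    obtain ⟨S, hS, hne⟩ := Finset.exists_ne_zero_of_sum_ne_zero hd
    rw [hmon, ← map_intCast (MvPolynomial.C (σ := ℕ) (R := ℤ)), MvPolynomial.C_mul_monomial,
      MvPolynomial.coeff_monomial] at hne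
    simp only [Finset.mem_image, Finset.mem_filter]
    split_ifs at hne with he
    · exact ⟨S, ⟨hS, by simpa using hne⟩, he⟩
    · exact absurd rfl hne
  have := (Finset.card_le_card hsub).trans Finset.card_image_le
  calc (F.poly.support.card : ℤ)
      ≤ ((varSet F.1).powerset.filter fun S => coef (items r F.1) S ≠ 0).card := by
        exact_mod_cast this
    _ = ∑ S ∈ (varSet F.1).powerset.filter fun S => coef (items r F.1) S ≠ 0, 1 := by simp
    _ ≤ ∑ S ∈ (varSet F.1).powerset.filter fun S => coef (items r F.1) S ≠ 0,
          coef (items r F.1) S ^ 2 := Finset.sum_le_sum fun S hS => by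
        have := (Finset.mem_filter.1 hS).2
        have := sq_pos_of_ne_zero this
        omega
    _ ≤ _ := Finset.sum_le_sum_of_subset_of_nonneg (Finset.filter_subset _ _)
        fun _ _ _ => sq_nonneg _


/-! ### Cancellation of opposite monomials -/

/-- One step of the cancellation: if the counter of the occurrences opposite to `o` is positive,
then `o` is cancelled against one of them, and otherwise `o` survives. Here `x` consists of the
counters and of the survivors so far, and `b o` is the address of the negative of the monomial of
`o`. -/
def cancelStep {α : Type*} (b : α → ℕ) (x : (ℕ → ℕ) × List α) (o : α) : (ℕ → ℕ) × List α :=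
  if 0 < x.1 (b o) then (Function.update x.1 (b o) (x.1 (b o) - 1), x.2) else (x.1, x.2 ++ [o])

/-- If the counter of the address `u'` starts with the number of occurrences of the opposite
monomial, then that many of the occurrences of the monomial with address `u` are cancelled. -/
theorem countP_foldl_cancelStep {α : Type*} {a b : α → ℕ} {u u' : ℕ} {L : List α}
    (h : ∀ o ∈ L, a o = u ↔ b o = u') (x : (ℕ → ℕ) × List α) :
    (L.foldl (cancelStep b) x).2.countP (fun o => a o = u) =
      x.2.countP (fun o => a o = u) + (L.countP (fun o => a o = u) - x.1 u') := by
  induction L generalizing x with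
  | nil => simp
  | cons o L ih =>
    have ho := h o (by simp)
    rw [List.foldl_cons, ih fun o ho => h o (by simp [ho]), List.countP_cons]
    unfold cancelStep
    by_cases hb : b o = u'
    · have ha := ho.2 hb
      subst hb
      by_cases hpos : 0 < x.1 (b o) <;> simp [hpos, ha] <;> omega
    · have ha : ¬ a o = u := fun h => hb (ho.1 h)
      by_cases hpos : 0 < x.1 (b o) <;> simp [hpos, ha, Function.update_of_ne (Ne.symm hb)]

theorem mem_of_mem_foldl_cancelStep {α : Type*} {b : α → ℕ} {L : List α}
    {x : (ℕ → ℕ) × List α} {o : α} (h : o ∈ (L.foldl (cancelStep b) x).2) : o ∈ x.2 ∨ o ∈ L := by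
  induction L generalizing x with
  | nil => exact .inl h
  | cons p L ih =>
    obtain h | h := ih h
    · unfold cancelStep at h
      split_ifs at h
      · exact .inl h
      · obtain h | h := List.mem_append.1 h
        · exact .inl h
        · exact .inr (by simp_all)
    · exact .inr (by simp [h])

theorem length_foldl_cancelStep {α : Type*} {b : α → ℕ} {L : List α} {x : (ℕ → ℕ) × List α} :
    (L.foldl (cancelStep b) x).2.length ≤ x.2.length + L.length := by
  induction L generalizing x with
  | nil => simp
  | cons p L ih =>
    refine ih.trans ?_
    unfold cancelStep
    split_ifs <;> simp only [List.length_append, List.length_cons, List.length_nil] <;> omega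

/-- The address of a signed monomial, for given codes of the variables. -/
def addr (code : ℕ → ℕ) (κ : Finset ℕ × ℕ) : ℕ := ∑ v ∈ κ.1, code v + κ.2

/-- The negative of a signed monomial. -/
def negItem (κ : Finset ℕ × ℕ) : Finset ℕ × ℕ := (κ.1, 1 - κ.2)

/-- On the variables in `V`, the codes are distinct powers of two, all of them even. -/
def IsCode (code : ℕ → ℕ) (V : Finset ℕ) : Prop :=
  ∃ e : ℕ → ℕ, Set.InjOn e V ∧ ∀ v ∈ V, code v = 2 ^ (e v + 1)

/-- Sums of distinct powers of two determine their terms, so that each signed monomial has its own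
address. -/
theorem IsCode.addr_inj {code : ℕ → ℕ} {V : Finset ℕ} (h : IsCode code V)
    {κ κ' : Finset ℕ × ℕ} (hκ : κ.1 ⊆ V) (hκ' : κ'.1 ⊆ V) (h2 : κ.2 < 2) (h2' : κ'.2 < 2)
    (he : addr code κ = addr code κ') : κ = κ' := by
  obtain ⟨e, hinj, hcode⟩ := h
  have hsum : ∀ S ⊆ V, ∑ v ∈ S, code v = 2 * ∑ i ∈ S.image e, 2 ^ i := fun S hS => by
    rw [Finset.sum_image fun x hx y hy => hinj (hS hx) (hS hy), Finset.mul_sum]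
    exact Finset.sum_congr rfl fun v hv => by rw [hcode v (hS hv), pow_succ']
  unfold addr at he
  rw [hsum _ hκ, hsum _ hκ'] at he
  have h1 : ∑ i ∈ κ.1.image e, 2 ^ i = ∑ i ∈ κ'.1.image e, 2 ^ i := by omega
  have him := Finset.geomSum_injective le_rfl h1
  refine Prod.ext ?_ (by omega)
  rw [← Finset.coe_inj]
  apply (hinj.image_eq_image_iff (Finset.coe_subset.2 hκ) (Finset.coe_subset.2 hκ')).1
  exact_mod_cast congrArg (fun s : Finset ℕ => (s : Set ℕ)) him

/-- The number of occurrences of each address. -/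
def counts (code : ℕ → ℕ) (L : List Occ) (u : ℕ) : ℕ := L.countP fun o => addr code (item o) = u

/-- The cancellation, with the counters and the surviving occurrences. -/
def cancel (code cnt : ℕ → ℕ) (L : List Occ) : (ℕ → ℕ) × List Occ :=
  L.foldl (cancelStep fun o => addr code (negItem (item o))) (cnt, [])

/-- The occurrences that survive the cancellation. -/
def survivors (code : ℕ → ℕ) (r : ℕ) (F : List (List Literal)) : List Occ :=
  (cancel code (counts code (occs r F)) (occs r F)).2

theorem mem_occs_of_mem_survivors {code : ℕ → ℕ} {r : ℕ} {F : List (List Literal)} {o : Occ}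
    (h : o ∈ survivors code r F) : o ∈ occs r F :=
  (mem_of_mem_foldl_cancelStep h).resolve_left (by simp)

theorem length_survivors_le_length_occs (code : ℕ → ℕ) (r : ℕ) (F : List (List Literal)) :
    (survivors code r F).length ≤ (occs r F).length := by
  simpa [survivors, cancel] using length_foldl_cancelStep
    (b := fun o => addr code (negItem (item o))) (L := occs r F) (x := (counts code (occs r F), []))

theorem count_map_item {L : List Occ} (κ : Finset ℕ × ℕ) :
    (L.map item).count κ = L.countP fun o => item o = κ := by
  rw [List.count, List.countP_map]
  exact List.countP_congr fun o _ => by simp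

/-- Of a signed monomial and its negative, at most one survives. -/
theorem count_survivors {code : ℕ → ℕ} {r : ℕ} {F : RCNF r} (hc : IsCode code (varSet F.1))
    {κ : Finset ℕ × ℕ} (hκ : κ.1 ⊆ varSet F.1) (h2 : κ.2 < 2) :
    ((survivors code r F.1).map item).count κ =
      (items r F.1).count κ - (items r F.1).count (negItem κ) := by
  have key : ∀ (κ : Finset ℕ × ℕ), κ.1 ⊆ varSet F.1 → κ.2 < 2 → ∀ o ∈ occs r F.1,
      (addr code (item o) = addr code κ ↔ item o = κ) := fun κ hκ h2 o ho =>
    ⟨fun h => hc.addr_inj (item_of_mem_occs F ho).1 hκ (item_snd_lt o) h2 h, fun h => by rw [h]⟩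
  have hcount : ∀ (κ : Finset ℕ × ℕ), κ.1 ⊆ varSet F.1 → κ.2 < 2 → ∀ L : List Occ,
      (∀ o ∈ L, o ∈ occs r F.1) →
      (L.map item).count κ = L.countP fun o => addr code (item o) = addr code κ :=
    fun κ hκ h2 L hL => by
      rw [count_map_item]
      exact List.countP_congr fun o ho => by simp [key κ hκ h2 o (hL o ho)]
  rw [hcount κ hκ h2 _ fun o => mem_occs_of_mem_survivors, items,
    hcount κ hκ h2 _ fun _ h => h,
    hcount (negItem κ) hκ (by simp only [negItem]; omega) _ fun _ h => h, survivors, cancel,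
    countP_foldl_cancelStep (u' := addr code (negItem κ))]
  · simp [counts]
  · intro o ho
    rw [key κ hκ h2 o ho]
    refine ⟨fun h => by rw [h], fun h => ?_⟩
    have h := hc.addr_inj (κ := negItem (item o)) (κ' := negItem κ) (item_of_mem_occs F ho).1 hκ
      (by simp only [negItem]; omega)
      (by simp only [negItem]; omega) h
    have h3 := item_snd_lt o
    simp only [negItem, Prod.mk.injEq] at h
    exact Prod.ext h.1 (by omega)

theorem coef_survivors {code : ℕ → ℕ} {r : ℕ} {F : RCNF r} (hc : IsCode code (varSet F.1))
    {S : Finset ℕ} (hS : S ⊆ varSet F.1) :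
    coef ((survivors code r F.1).map item) S = coef (items r F.1) S := by
  simp only [coef, count_survivors hc (κ := (S, _)) hS one_lt_two,
    count_survivors hc (κ := (S, _)) hS two_pos, negItem, Nat.sub_zero, Nat.sub_self]
  omega

theorem sum_occVal_survivors {R : Type*} [CommRing R] (χ : ℕ → R) {code : ℕ → ℕ} {r : ℕ}
    {F : RCNF r} (hc : IsCode code (varSet F.1)) :
    polyVal χ F.1 = -((survivors code r F.1).map (occVal χ)).sum := by
  rw [sum_occVal χ F fun o => mem_occs_of_mem_survivors, polyVal_eq_sum_coef]
  exact Finset.sum_congr rfl fun S hS => by rw [coef_survivors hc (Finset.mem_powerset.1 hS)]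

/-- After the cancellation, a monomial with coefficient `c` has `|c| ≤ c ^ 2` occurrences. -/
theorem length_survivors_le {code : ℕ → ℕ} {r : ℕ} {F : RCNF r}
    (hc : IsCode code (varSet F.1)) :
    ((survivors code r F.1).length : ℤ) ≤
      ∑ S ∈ (varSet F.1).powerset, coef (items r F.1) S ^ 2 := by
  rw [← List.length_map (f := item), length_eq_sum_count (varSet F.1).powerset]
  · push_cast
    refine Finset.sum_le_sum fun S hS => ?_
    have hS := Finset.mem_powerset.1 hS
    rw [← coef_survivors hc hS, coef, count_survivors hc (κ := (S, _)) hS one_lt_two,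
      count_survivors hc (κ := (S, _)) hS two_pos]
    simp only [negItem]
    generalize (items r F.1).count (S, 1) = p
    generalize (items r F.1).count (S, 0) = q
    obtain h | h := le_total p q
    · rw [Nat.sub_eq_zero_of_le h]
      push_cast
      nlinarith [sq_nonneg (((q - p : ℕ) : ℤ) - 1), Int.le_self_sq ((q - p : ℕ) : ℤ)]
    · rw [Nat.sub_eq_zero_of_le h]
      push_cast
      nlinarith [Int.le_self_sq ((p - q : ℕ) : ℤ)]
  · intro κ hκ
    obtain ⟨o, ho, rfl⟩ := List.mem_map.1 hκ
    exact ⟨Finset.mem_powerset.2 (item_of_mem_occs F (mem_occs_of_mem_survivors ho)).1,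
      item_snd_lt o⟩

/-! ### Clauses that represent a monomial -/

/-- The `0`-`1` vectors whose number of common ones with `μ` is even (for `b = false`) or odd
(for `b = true`). -/
def flips : List Bool → Bool → List (List Bool)
  | [], b => if b then [] else [[]]
  | m :: μ, b => (flips μ b).map (false :: ·) ++ (flips μ (xor b m)).map (true :: ·)

theorem length_of_mem_flips {μ : List Bool} {b : Bool} {δ : List Bool} (h : δ ∈ flips μ b) :
    δ.length = μ.length := by
  induction μ generalizing b δ with
  | nil => cases b <;> simp_all [flips]
  | cons m μ ih =>
    simp only [flips, List.mem_append, List.mem_map] at h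
    obtain ⟨ν, hν, rfl⟩ | ⟨ν, hν, rfl⟩ := h <;> simp [ih hν]

theorem length_flips_add (μ : List Bool) (b : Bool) :
    (flips μ b).length + (flips μ !b).length = 2 ^ μ.length := by
  induction μ generalizing b with
  | nil => cases b <;> simp [flips]
  | cons m μ ih =>
    have h1 := ih b
    have h2 := ih (xor b m)
    simp only [flips, List.length_append, List.length_map, List.length_cons, pow_succ]
    cases m <;> cases b <;> simp at * <;> omega

/-- A mask with a one has as many vectors of even as of odd overlap. -/
theorem length_flips {μ : List Bool} (h : true ∈ μ) (b : Bool) :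
    2 * (flips μ b).length = 2 ^ μ.length := by
  induction μ generalizing b with
  | nil => simp at h
  | cons m μ ih =>
    simp only [flips, List.length_append, List.length_map, List.length_cons, pow_succ]
    cases m with
    | true =>
      rw [Bool.xor_true, length_flips_add]
      ring
    | false =>
      have := ih (by simpa using h) b
      rw [Bool.xor_false]
      omega

/-- Negate the literals of `C` selected by `δ`. -/
def flipClause (C : List Literal) (δ : List Bool) : List Literal :=
  (C.zip δ).map fun p => (p.1.1, xor p.1.2 p.2)

theorem flipClause_vars {C : List Literal} {δ : List Bool} (h : δ.length = C.length) :
    (flipClause C δ).map Prod.fst = C.map Prod.fst := by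
  rw [← map_zip_fst (fun l : Literal => l.1) h, flipClause, List.map_map]
  rfl

/-- The clauses that represent the monomial of an occurrence, up to the factor `2 ^ (r - 1)`. -/
def gadget (o : Occ) : List (List Literal) := (flips o.2 false).map (flipClause o.1)

/-- In the sum over all sign changes whose overlap with `μ` has a given parity, all monomials of the
expansion cancel except for the empty one and the one selected by `μ`. -/
theorem sum_flips {R : Type*} [CommRing R] (χ : ℕ → R) (C : List Literal) (μ : List Bool)
    (h : μ.length = C.length) (b : Bool) :
    2 * ((flips μ b).map fun δ => ((flipClause C δ).map fun l => 1 + litVal χ l).prod).sum =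
      2 ^ μ.length * (1 + (if b then -1 else 1) * maskProd (litVal χ) (C.zip μ)) := by
  induction μ generalizing C b with
  | nil =>
    cases b <;> simp [flips, flipClause, maskProd]
    norm_num
  | cons m μ ih =>
    obtain _ | ⟨⟨v, s⟩, C⟩ := C
    · simp at h
    have h1 := ih C (by simpa using h) b
    have h2 := ih C (by simpa using h) (xor b m)
    have hp : maskProd (litVal χ) (((v, s), m) :: C.zip μ) =
        (if m then litVal χ (v, s) else 1) * maskProd (litVal χ) (C.zip μ) := by
      simp [maskProd]
    simp only [flips, flipClause, List.map_append, List.map_map, Function.comp_def,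
      List.zip_cons_cons, List.map_cons, List.prod_cons, List.sum_append, List.sum_map_mul_left,
      List.length_cons, pow_succ, hp] at h1 h2 ⊢
    rw [mul_add, mul_left_comm 2, mul_left_comm 2, h1, h2]
    cases m <;> cases b <;> cases s <;> simp [litVal] <;> ring

theorem polyVal_gadget {R : Type*} [CommRing R] (χ : ℕ → R) {o : Occ}
    (h : o.2.length = o.1.length) (ht : true ∈ o.2) :
    2 * polyVal χ (gadget o) = -(2 ^ o.1.length * occVal χ o) := by
  have h1 := sum_flips χ o.1 o.2 h false
  have h2 := congrArg (Nat.cast (R := R)) (length_flips ht false)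
  push_cast at h2
  have h3 : ∀ L : List (List Bool), (L.map fun δ =>
      1 - ((flipClause o.1 δ).map fun l => 1 + litVal χ l).prod).sum = L.length -
        (L.map fun δ => ((flipClause o.1 δ).map fun l => 1 + litVal χ l).prod).sum := by
    intro L
    induction L with
    | nil => simp
    | cons δ L ih =>
      simp only [List.map_cons, List.sum_cons, ih, List.length_cons]
      push_cast
      ring
  simp only [polyVal, gadget, List.map_map, Function.comp_def]
  rw [h3, mul_sub, h2, h1, h, occVal]
  simp
  ring

theorem polyVal_flatMap_gadget (χ : ℕ → ℤ) {r : ℕ} {F : RCNF r} {E : List Occ}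
    (hE : ∀ o ∈ E, o ∈ occs r F.1) :
    polyVal χ (E.flatMap gadget) = -(2 ^ (r - 1) * (E.map (occVal χ)).sum) := by
  induction E with
  | nil => simp [polyVal]
  | cons o E ih =>
    obtain ⟨h1, h2⟩ := mem_occs.1 (hE o (by simp))
    have hl := (F.2 _ h1).1
    have hg := polyVal_gadget χ ((length_of_mem_nzMasks h2).trans hl.symm)
      (true_mem_of_mem_nzMasks h2)
    have hr : r ≠ 0 := by
      rintro rfl
      simp [nzMasks] at h2
    rw [hl, ← Nat.succ_pred_eq_of_ne_zero hr, Nat.succ_eq_add_one, pow_succ] at hg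
    rw [List.flatMap_cons, polyVal_append, ih fun o ho => hE o (by simp [ho]), List.map_cons,
      List.sum_cons]
    simp only [Nat.pred_eq_sub_one] at hg
    linarith

theorem length_gadget {r : ℕ} {F : RCNF r} {o : Occ} (ho : o ∈ occs r F.1) :
    (gadget o).length = 2 ^ (r - 1) := by
  obtain ⟨h1, h2⟩ := mem_occs.1 ho
  have h := length_flips (true_mem_of_mem_nzMasks h2) false
  have hr : r ≠ 0 := by
    rintro rfl
    simp [nzMasks] at h2
  rw [length_of_mem_nzMasks h2, ← Nat.succ_pred_eq_of_ne_zero hr, Nat.succ_eq_add_one,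
    pow_succ] at h
  simp only [gadget, List.length_map, Nat.pred_eq_sub_one] at h ⊢
  omega

theorem vars_of_mem_gadget {r : ℕ} {F : RCNF r} {o : Occ} (ho : o ∈ occs r F.1)
    {D : List Literal} (hD : D ∈ gadget o) : D.map Prod.fst = o.1.map Prod.fst := by
  obtain ⟨h1, h2⟩ := mem_occs.1 ho
  obtain ⟨δ, hδ, rfl⟩ := List.mem_map.1 hD
  exact flipClause_vars ((length_of_mem_flips hδ).trans
    ((length_of_mem_nzMasks h2).trans (F.2 _ h1).1.symm))

/-! ### Renaming of variables -/

/-- Rename the variables of a clause. -/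
def renameClause (ρ : ℕ → ℕ) (C : List Literal) : List Literal := C.map fun l => (ρ l.1, l.2)

theorem polyVal_rename {R : Type*} [CommRing R] (χ : ℕ → R) (ρ : ℕ → ℕ)
    (F : List (List Literal)) :
    polyVal χ (F.map (renameClause ρ)) = polyVal (fun v => χ (ρ v)) F := by
  simp [polyVal, renameClause, Function.comp_def, litVal]

/-- An injective renaming does not change the maximum of the polynomial. -/
theorem exists_le_polyVal_rename {ρ : ℕ → ℕ} {F : List (List Literal)}
    (hρ : Set.InjOn ρ (varSet F)) (k : ℤ) :
    (∃ τ, k ≤ polyVal (boolSign τ) (F.map (renameClause ρ))) ↔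
      ∃ τ, k ≤ polyVal (boolSign τ) F := by
  simp only [polyVal_rename]
  constructor
  · rintro ⟨τ, h⟩
    exact ⟨fun v => τ (ρ v), h⟩
  · rintro ⟨τ, h⟩
    refine ⟨fun u => τ (Function.invFunOn ρ (varSet F) u), h.trans_eq (polyVal_congr ?_)⟩
    intro C hC l hl
    have hv : l.1 ∈ varSet F := subset_varSet hC
      (List.mem_toFinset.2 (List.mem_map.2 ⟨l, hl, rfl⟩))
    have := hρ.leftInvOn_invFunOn hv
    simp only [boolSign, this]

/-- The clauses representing the surviving monomials, with variables renamed by `ρ`. -/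
def kernelClauses (code ρ : ℕ → ℕ) (r : ℕ) (F : List (List Literal)) : List (List Literal) :=
  ((survivors code r F).flatMap gadget).map (renameClause ρ)

theorem varSet_survivors {code : ℕ → ℕ} {r : ℕ} {F : RCNF r} {v : ℕ}
    (hv : v ∈ varSet ((survivors code r F.1).flatMap gadget)) :
    v ∈ (survivors code r F.1).flatMap fun o => o.1.map Prod.fst := by
  simp only [varSet, List.mem_toFinset, List.mem_map, List.mem_flatten, List.mem_flatMap] at hv ⊢
  obtain ⟨l, ⟨D, ⟨o, ho, hD⟩, hl⟩, rfl⟩ := hv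
  refine ⟨o, ho, ?_⟩
  have := vars_of_mem_gadget (mem_occs_of_mem_survivors ho) hD
  rw [← List.mem_map, ← this]
  exact List.mem_map.2 ⟨l, hl, rfl⟩

theorem length_kernelClauses {code ρ : ℕ → ℕ} {r : ℕ} {F : RCNF r} :
    (kernelClauses code ρ r F.1).length = 2 ^ (r - 1) * (survivors code r F.1).length := by
  have : ∀ E : List Occ, (∀ o ∈ E, o ∈ occs r F.1) →
      (E.flatMap gadget).length = 2 ^ (r - 1) * E.length := by
    intro E hE
    induction E with
    | nil => simp
    | cons o E ih =>
      rw [List.flatMap_cons, List.length_append, length_gadget (hE o (by simp)),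
        ih fun o ho => hE o (by simp [ho]), List.length_cons]
      ring
  rw [kernelClauses, List.length_map, this _ fun o => mem_occs_of_mem_survivors]

theorem kernelClauses_valid {code ρ : ℕ → ℕ} {r : ℕ} {F : RCNF r}
    (hρ : Set.InjOn ρ {v | v ∈ (survivors code r F.1).flatMap fun o => o.1.map Prod.fst}) :
    ∀ C ∈ kernelClauses code ρ r F.1, C.length = r ∧ (C.map Prod.fst).Nodup := by
  intro C hC
  obtain ⟨D, hD, rfl⟩ := List.mem_map.1 hC
  obtain ⟨o, ho, hDo⟩ := List.mem_flatMap.1 hD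
  have hv := vars_of_mem_gadget (mem_occs_of_mem_survivors ho) hDo
  obtain ⟨hl, hn⟩ := F.2 _ (mem_occs.1 (mem_occs_of_mem_survivors ho)).1
  have hlen := congrArg List.length hv
  simp only [List.length_map] at hlen
  refine ⟨by simp [renameClause, hlen, hl], ?_⟩
  have e : (renameClause ρ D).map Prod.fst = (o.1.map Prod.fst).map ρ := by
    rw [← hv, renameClause, List.map_map, List.map_map]
    rfl
  rw [e]
  refine hn.map_on fun x hx y hy h => hρ ?_ ?_ h
  · exact List.mem_flatMap.2 ⟨o, ho, hx⟩
  · exact List.mem_flatMap.2 ⟨o, ho, hy⟩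

/-- The polynomial of the formula that represents the surviving monomials is `2 ^ (r - 1)` times the
given one, up to a renaming of the variables. -/
theorem kernelClauses_yes_iff {code ρ : ℕ → ℕ} {r : ℕ} {F G : RCNF r}
    (hc : IsCode code (varSet F.1))
    (hρ : Set.InjOn ρ {v | v ∈ (survivors code r F.1).flatMap fun o => o.1.map Prod.fst})
    (hG : G.1 = kernelClauses code ρ r F.1) (k : ℕ) :
    (maxSat r).Yes F k ↔ (maxSat r).Yes G (2 ^ (r - 1) * k) := by
  rw [maxSat_yes_iff, maxSat_yes_iff, hG, kernelClauses,
    exists_le_polyVal_rename fun x hx y hy => hρ (varSet_survivors hx) (varSet_survivors hy)]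
  refine exists_congr fun τ => ?_
  rw [polyVal_flatMap_gadget _ (F := F) fun o => mem_occs_of_mem_survivors, ← mul_neg,
    ← sum_occVal_survivors _ hc]
  push_cast
  exact (mul_le_mul_iff_right₀ (by positivity)).symm

/-- By `length_survivors_le`, the number of survivors, which a program can count, may replace the
sum of the squares of the coefficients. -/
theorem maxSat_yes_of_length_survivors {code : ℕ → ℕ} {r : ℕ} {F : RCNF r}
    (hc : IsCode code (varSet F.1)) {k : ℕ}
    (h : 4 * 64 ^ r * k ^ 2 < (survivors code r F.1).length) : (maxSat r).Yes F k :=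
  maxSat_yes_of_sum_sq F k (lt_of_lt_of_le (by exact_mod_cast h) (length_survivors_le hc))


/-! ### Naming variables -/

/-- One step of the naming of variables: the table `x.1` gives the variable `v` the next name `x.2`
unless `v` has a nonzero name already; `g` computes the name after the next one. -/
def nameStep (g : ℕ → ℕ) (x : (ℕ → ℕ) × ℕ) (v : ℕ) : (ℕ → ℕ) × ℕ :=
  if x.1 v = 0 then (Function.update x.1 v x.2, g x.2) else x

/-- The table of names after the variables `vs` have been named, starting with the name `n`. -/
def names (g : ℕ → ℕ) (n : ℕ) (vs : List ℕ) : (ℕ → ℕ) × ℕ := vs.foldl (nameStep g) (fun _ => 0, n)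

theorem names_append (g : ℕ → ℕ) (n : ℕ) (vs ws : List ℕ) :
    names g n (vs ++ ws) = ws.foldl (nameStep g) (names g n vs) := List.foldl_append

theorem foldl_nameStep_of_ne_zero {g : ℕ → ℕ} {vs : List ℕ} {x : (ℕ → ℕ) × ℕ} {v : ℕ}
    (h : x.1 v ≠ 0) : (vs.foldl (nameStep g) x).1 v = x.1 v := by
  induction vs generalizing x with
  | nil => rfl
  | cons u vs ih =>
    have hu : (nameStep g x u).1 v = x.1 v := by
      unfold nameStep
      split_ifs with hx
      · exact Function.update_of_ne (fun he => h (by rw [he]; exact hx)) _ _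
      · rfl
    rw [List.foldl_cons, ih (by rwa [hu]), hu]

/-- The names are taken from the sequence `w` of nonzero numbers, without repetition. -/
theorem names_spec {g w : ℕ → ℕ} (hw : ∀ i, w i ≠ 0 ∧ g (w i) = w (i + 1)) (vs : List ℕ) :
    ∃ (c : ℕ) (e : ℕ → ℕ), c ≤ vs.length ∧ (names g (w 0) vs).2 = w c ∧
      Set.InjOn e {v | v ∈ vs} ∧ (∀ v ∈ vs, e v < c ∧ (names g (w 0) vs).1 v = w (e v)) ∧
      ∀ v ∉ vs, (names g (w 0) vs).1 v = 0 := by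
  induction vs using List.reverseRecOn with
  | nil => exact ⟨0, id, le_rfl, rfl, by simp [Set.InjOn], by simp, fun _ _ => rfl⟩
  | append_singleton vs u ih =>
    obtain ⟨c, e, hc, h2, hinj, hmem, hnot⟩ := ih
    rw [names_append, List.foldl_cons, List.foldl_nil]
    generalize names g (w 0) vs = x at *
    by_cases hu : u ∈ vs
    · have hx : nameStep g x u = x := if_neg (by rw [(hmem u hu).2]; exact (hw _).1)
      have hiff : ∀ v, v ∈ vs ++ [u] ↔ v ∈ vs := fun v => by
        simp only [List.mem_append, List.mem_singleton, or_iff_left_iff_imp]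
        rintro rfl
        exact hu
      simp only [hx, hiff]
      exact ⟨c, e, by simp; omega, h2, hinj, hmem, hnot⟩
    · have hx : nameStep g x u = (Function.update x.1 u x.2, g x.2) := if_pos (hnot u hu)
      have hne : ∀ v ∈ vs, v ≠ u := fun v hv he => hu (he ▸ hv)
      refine ⟨c + 1, Function.update e u c, by simp; omega, by rw [hx, h2, (hw c).2], ?_, ?_, ?_⟩
      · intro v hv v' hv' h
        simp only [Set.mem_ofPred_eq, List.mem_append, List.mem_singleton] at hv hv'
        obtain hv | rfl := hv <;> obtain hv' | rfl := hv'
        · rw [Function.update_of_ne (hne v hv), Function.update_of_ne (hne v' hv')] at h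
          exact hinj hv hv' h
        · rw [Function.update_of_ne (hne v hv), Function.update_self] at h
          exact absurd (hmem v hv).1 (by omega)
        · rw [Function.update_of_ne (hne v' hv'), Function.update_self] at h
          exact absurd (hmem v' hv').1 (by omega)
        · rfl
      · intro v hv
        simp only [List.mem_append, List.mem_singleton] at hv
        obtain hv | rfl := hv
        · rw [hx, Function.update_of_ne (hne v hv)]
          dsimp only
          rw [Function.update_of_ne (hne v hv)]
          exact ⟨(hmem v hv).1.trans (by omega), (hmem v hv).2⟩
        · rw [hx, Function.update_self]
          dsimp only
          rw [Function.update_self, h2]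
          exact ⟨by omega, rfl⟩
      · intro v hv
        simp only [List.mem_append, List.mem_singleton, not_or] at hv
        rw [hx]
        dsimp only
        rw [Function.update_of_ne hv.2]
        exact hnot v hv.1

/-- Name the variable `Rv` by the table in array `A`, the next name being in the register `n`; the
register `d` is added to obtain the name after that. -/
def nameLit (A n d : ℕ) : Prog :=
  seqs [.load Ru A Rv, .ite Ru Rone (seqs [.store A Rv n, .add n n d]) .skip]

theorem loopFree_nameLit (A n d : ℕ) : (nameLit A n d).LoopFree := by
  simp [nameLit, seqs, Prog.LoopFree]

theorem denote_nameVars {A n d r : ℕ} {g : ℕ → ℕ} {C : List Literal} {s : Config}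
    (hg : ∀ s' : Config, s'.reg Rone = 1 → s'.reg n + s'.reg d = g (s'.reg n)) (hA : A ≠ 0)
    (hn : n < 16) (hn2 : n ≠ Rone) (hC : Mem (s.arr 0) (s.reg Rlit) (litWords C))
    (hr : C.length = r) (h1 : s.reg Rone = 1) :
    Same ((s.putArr A ((C.map Prod.fst).foldl (nameStep g) (s.arr A, s.reg n)).1).setReg n
        ((C.map Prod.fst).foldl (nameStep g) (s.arr A, s.reg n)).2)
      ((forLits 0 (fun _ => nameLit A n d) (List.replicate r false)).denote s) := by
  have key := denote_forLits (a := 0) (body := fun _ => nameLit A n d) (s.arr 0)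
    (fun D s' => Same ((s.putArr A ((D.map fun p : Literal × Bool => p.1.1).foldl (nameStep g)
      (s.arr A, s.reg n)).1).setReg n ((D.map fun p : Literal × Bool => p.1.1).foldl (nameStep g)
      (s.arr A, s.reg n)).2) s')
    (by
      intro D s' h
      exact ⟨by rw [h.1]; simp [hA.symm], by rw [h.2 _ (by omega)]; simp [hn2.symm, h1]⟩)
    (fun D s' x v hx _ h => h.setReg v (by omega))
    (by
      intro D s' l b h hv hs
      have h1' : s'.reg Rone = 1 := by rw [h.2 _ (by omega)]; simp [hn2.symm, h1]
      rw [List.map_append, List.foldl_append, List.map_singleton, List.foldl_cons, List.foldl_nil]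
      generalize (D.map fun p : Literal × Bool => p.1.1).foldl (nameStep g)
        (s.arr A, s.reg n) = x at *
      have hx2 : s'.reg n = x.2 := by rw [h.2 _ hn]; simp
      have hx1 : s'.arr A = x.1 := by rw [h.1]; simp
      have hgx := hg ((s'.setReg Ru (x.1 l.1)).setArr A l.1 x.2) (by simp [h1'])
      simp only [setArr_reg, setReg_reg, if_neg (show n ≠ Ru by omega), hx2] at hgx
      by_cases hz : x.1 l.1 = 0
      · have e : (nameLit A n d).denote s' = (((s'.setReg Ru (x.1 l.1)).setArr A l.1 x.2).setReg n
            (g x.2)) := by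
          simp only [nameLit, seqs, Prog.denote, hv, hx1, hx2, setReg_reg, setArr_reg,
            if_neg (show n ≠ Ru by omega), hz, h1'] at hgx ⊢
          simp [hgx]
        rw [e]
        refine ⟨⟨?_, ?_⟩, by simp; omega⟩
        · funext B
          have := congrFun h.1 B
          simp only [setReg_arr, putArr_arr, setArr_arr, hx1] at this ⊢
          by_cases hB : B = A
          · simp [hB, nameStep, hz]
          · simpa [hB] using this
        · intro y hy
          have := h.2 y hy
          simp only [setReg_reg, putArr_reg, setArr_reg] at this ⊢
          by_cases hyn : y = n
          · simp [hyn, nameStep, hz]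
          · simpa [hyn, show y ≠ Ru by omega] using this
      · have e : (nameLit A n d).denote s' = s'.setReg Ru (x.1 l.1) := by
          simp [nameLit, seqs, Prog.denote, hv, hx1, h1', hz]
        rw [e, nameStep, if_neg hz]
        exact ⟨h.setReg _ (by omega), by simp⟩)
    C (List.replicate r false) (by simp [hr]) [] s
    ⟨by
      funext B
      by_cases hB : B = A <;> simp [hB], fun y hy => by
      by_cases hyn : y = n <;> simp [hyn]⟩ hC
  rwa [List.nil_append, map_zip_fst (fun l : Literal => l.1) (by simp [hr])] at key

/-! ### Addresses of monomials -/

/-- Account for a literal that is selected for the monomial if `b` is true: add the code of its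
variable to the address, and its sign to the parity. -/
def keyStep (b : Bool) : Prog :=
  if b then seqs [.load Ru 2 Rv, .add Rkey Rkey Ru, .sub Rt Rpar Rsign, .sub Ru Rsign Rpar,
    .add Rpar Rt Ru] else .skip

/-- Compute the address of the monomial given by the mask `μ` and the current clause, and the
address of its negative. -/
def keyBlock (μ : List Bool) : Prog :=
  seqs [.add Rlit Rp Rone, .const Rkey 0, .const Rpar 0,
    forLits 0 keyStep μ,
    .sub Ropp Rone Rpar, .add Ropp Rkey Ropp, .add Rkey Rkey Rpar]

theorem loopFree_keyBlock (μ : List Bool) : (keyBlock μ).LoopFree := by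
  simp only [keyBlock, seqs, Prog.LoopFree, and_true, true_and]
  exact loopFree_forLits _ (fun b => by cases b <;> simp [keyStep, seqs, Prog.LoopFree]) _

theorem sum_dVars (code : ℕ → ℕ) {d : List (Literal × Bool)}
    (hd : (d.map fun p => p.1.1).Nodup) :
    ∑ v ∈ dVars d, code v = (d.map fun p => if p.2 then code p.1.1 else 0).sum := by
  induction d with
  | nil => simp [dVars]
  | cons p d ih =>
    obtain ⟨⟨v, b⟩, m⟩ := p
    rw [List.map_cons, List.nodup_cons] at hd
    have ih := ih hd.2
    cases m with
    | false => simpa [dVars] using ih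
    | true =>
      have hv : v ∉ dVars d := fun h => hd.1 <| by
        simp only [dVars, List.mem_toFinset, List.mem_map, List.mem_filter] at h ⊢
        obtain ⟨p, hp, rfl⟩ := h
        exact ⟨p, hp.1, rfl⟩
      have e : dVars (((v, b), true) :: d) = insert v (dVars d) := by simp [dVars]
      rw [e, Finset.sum_insert hv, ih]
      simp

theorem denote_keyBlock {C : List Literal} {μ : List Bool} {s : Config}
    (hC : Mem (s.arr 0) (s.reg Rp) (C.length :: litWords C)) (hμ : μ.length = C.length)
    (hn : (C.map Prod.fst).Nodup) (h1 : s.reg Rone = 1) :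
    Same s ((keyBlock μ).denote s) ∧
      ((keyBlock μ).denote s).reg Rkey = addr (s.arr 2) (item (C, μ)) ∧
      ((keyBlock μ).denote s).reg Ropp = addr (s.arr 2) (negItem (item (C, μ))) := by
  have key := denote_forLits (a := 0) (body := keyStep) (s.arr 0)
    (fun D s' => Same s s' ∧
      s'.reg Rkey = (D.map fun p => if p.2 then s.arr 2 p.1.1 else 0).sum ∧
      s'.reg Rpar = dPar D)
    (by
      rintro D s' ⟨h, -⟩
      exact ⟨by rw [h.1], by rw [h.2 _ (by omega), h1]⟩)
    (by
      rintro D s' x v hx hx' ⟨h, hk, hp⟩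
      refine ⟨h.setReg v (by omega), ?_, ?_⟩
      · rwa [setReg_reg, if_neg (by omega)]
      · rwa [setReg_reg, if_neg (by omega)])
    (by
      rintro D s' ⟨v, c⟩ b ⟨h, hk, hp⟩ hv hs
      cases b with
      | false => simpa [keyStep, Prog.denote, dPar, hk] using ⟨h, hp⟩
      | true =>
        refine ⟨⟨?_, ?_, ?_⟩, ?_⟩
        · simp only [keyStep, seqs, Prog.denote, if_true]
          iterate 5 refine Same.setReg ?_ _ (by omega)
          exact h
        · simp [keyStep, seqs, Prog.denote, hk, h.1, hv]
        · simp only [keyStep, seqs, Prog.denote, if_true]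
          simp [hp, hs, dPar, List.countP_append]
          cases c
          · simp
          · simp
            omega
        · simp [keyStep, seqs, Prog.denote])
    C μ hμ [] (((s.setReg Rlit (s.reg Rp + 1)).setReg Rkey 0).setReg Rpar 0)
    ⟨(((Same.refl s).setReg _ (by omega)).setReg _ (by omega)).setReg _ (by omega), by simp,
      by simp [dPar]⟩ (by simpa using hC.2)
  set s₁ := (forLits 0 keyStep μ).denote
    (((s.setReg Rlit (s.reg Rp + 1)).setReg Rkey 0).setReg Rpar 0) with hs₁
  obtain ⟨hsame, hk, hp⟩ := key
  have e : (keyBlock μ).denote s = ((s₁.setReg Ropp (1 - s₁.reg Rpar)).setReg Ropp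
      (s₁.reg Rkey + (1 - s₁.reg Rpar))).setReg Rkey (s₁.reg Rkey + s₁.reg Rpar) := by
    have h1' : s₁.reg Rone = 1 := by rw [hsame.2 _ (by omega), h1]
    simp [keyBlock, seqs, Prog.denote, h1, ← hs₁, h1']
  have hsum := sum_dVars (s.arr 2) (d := C.zip μ)
    (by rwa [map_zip_fst (fun l : Literal => l.1) hμ])
  rw [e]
  refine ⟨((hsame.setReg _ (by omega)).setReg _ (by omega)).setReg _ (by omega), ?_, ?_⟩
  · simp [addr, item, hsum, hk, hp]
  · simp [addr, item, negItem, hsum, hk, hp]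

/-! ### Writing clauses -/

/-- The words that encode a list of clauses. -/
def fWords (F : List (List Literal)) : List ℕ := F.flatMap fun C => C.length :: litWords C

theorem encode_eq {r : ℕ} (F : RCNF r) : F.encode = F.1.length :: fWords F.1 := rfl

theorem length_litWords (C : List Literal) : (litWords C).length = 2 * C.length := by
  induction C with
  | nil => rfl
  | cons l C ih =>
    simp only [litWords, List.flatMap_cons, List.length_append, List.length_cons,
      List.length_nil] at ih ⊢
    omega

theorem length_fWords {r : ℕ} {F : List (List Literal)} (hF : ∀ C ∈ F, C.length = r) :
    (fWords F).length = (2 * r + 1) * F.length := by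
  induction F with
  | nil => rfl
  | cons C F ih =>
    have ih := ih fun D hD => hF D (by simp [hD])
    simp only [fWords, List.flatMap_cons, List.length_append, List.length_cons,
      length_litWords, hF C (by simp)] at ih ⊢
    rw [ih]
    ring

theorem mem_clause {f : ℕ → ℕ} {r : ℕ} {d d' : List (List Literal)} {C : List Literal}
    (h : Mem f 1 (fWords (d ++ C :: d'))) (hd : ∀ C ∈ d, C.length = r) :
    Mem f (1 + (2 * r + 1) * d.length) (C.length :: litWords C) := by
  rw [← length_fWords hd]
  simp only [fWords, List.flatMap_append, List.flatMap_cons, mem_append] at h ⊢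
  exact h.2.1

/-- Write the current clause to the array `o`, with the variables named by array `4` and the
literals selected by `δ` negated. -/
def emitClause (o : ℕ) (δ : List Bool) : Prog :=
  seqs [.const Rt δ.length, emitReg o Rt, .add Rlit Rp Rone,
    forLits 0 (fun b => seqs [.load Ru 4 Rv, emitReg o Ru,
      if b then .sub Rsign Rone Rsign else .skip, emitReg o Rsign]) δ]

theorem loopFree_emitClause (o : ℕ) (δ : List Bool) : (emitClause o δ).LoopFree := by
  simp only [emitClause, emitReg, seqs, Prog.LoopFree, and_true, true_and]
  exact loopFree_forLits _ (fun b => by cases b <;> simp [Prog.LoopFree]) _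

theorem emit_reg_of_ne (s : Config) (o : ℕ) (w : List ℕ) {x : ℕ} (h : x ≠ Rq) :
    (s.emit o w).reg x = s.reg x := by simp [Config.emit, h]

theorem emit_arr_of_ne (s : Config) {o A : ℕ} (w : List ℕ) (h : A ≠ o) :
    (s.emit o w).arr A = s.arr A := by simp [Config.emit, h]

theorem same_emit_nil (s : Config) (o : ℕ) : Same (s.emit o []) s := by
  refine ⟨funext fun A => ?_, fun x _ => ?_⟩
  · by_cases h : A = o <;> simp [Config.emit, putWords, h]
  · by_cases h : x = Rq <;> simp [Config.emit, h]

theorem emitReg_reg {s : Config} {o a x : ℕ} (h : x ≠ Rq) :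
    ((emitReg o a).denote s).reg x = s.reg x := by simp [emitReg, Prog.denote, h]

theorem denote_emitClause {o : ℕ} (ho0 : o ≠ 0) (ho4 : o ≠ 4) {C : List Literal} {δ : List Bool}
    {s : Config} (hC : Mem (s.arr 0) (s.reg Rp) (C.length :: litWords C))
    (hδ : δ.length = C.length) (h1 : s.reg Rone = 1) {s' : Config} {w : List ℕ}
    (hs : Same (s.emit o w) s') :
    Same (s.emit o (w ++ fWords [renameClause (s.arr 4) (flipClause C δ)]))
      ((emitClause o δ).denote s') := by
  have h1s : ∀ {s' : Config} {w : List ℕ}, Same (s.emit o w) s' → s'.reg Rone = 1 := fun h => by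
    rw [h.2 _ (by omega), emit_reg_of_ne _ _ _ (by omega), h1]
  set s₁ := (emitReg o Rt).denote (s'.setReg Rt δ.length) with hs₁
  have hw₁ : Same (s.emit o (w ++ [δ.length])) s₁ :=
    denote_emitReg (hs.setReg _ (by omega)) h1 (by simp)
  have key := denote_forLits (a := 0) (body := fun b => seqs [.load Ru 4 Rv, emitReg o Ru,
      if b then .sub Rsign Rone Rsign else .skip, emitReg o Rsign]) (s.arr 0)
    (fun D s' => Same (s.emit o (w ++ δ.length :: litWords
      (D.map fun p => (s.arr 4 p.1.1, xor p.1.2 p.2)))) s')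
    (by
      intro D s' h
      exact ⟨by rw [h.1, emit_arr_of_ne _ _ ho0.symm], h1s h⟩)
    (fun D s' x v hx _ h => h.setReg v (by omega))
    (by
      rintro D s' ⟨v, c⟩ b h hv hsg
      have h4 : s'.arr 4 = s.arr 4 := by rw [h.1, emit_arr_of_ne _ _ ho4.symm]
      have h2 := denote_emitReg (a := Ru) (v := s.arr 4 v)
        (h.setReg (d := Ru) (s.arr 4 v) (by omega)) h1
        (by simp)
      set s₂ := (emitReg o Ru).denote (s'.setReg Ru (s.arr 4 v)) with hs₂
      have hsg₂ : s₂.reg Rsign = c.toNat := by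
        rw [hs₂, emitReg_reg (by omega)]
        simpa using hsg
      have h3 : Same (s.emit o ((w ++ δ.length :: litWords
            (D.map fun p => (s.arr 4 p.1.1, xor p.1.2 p.2))) ++ [s.arr 4 v]))
          ((if b then Prog.sub Rsign Rone Rsign else .skip).denote s₂) ∧
          ((if b then Prog.sub Rsign Rone Rsign else .skip).denote s₂).reg Rsign =
            (xor c b).toNat := by
        cases b
        · exact ⟨h2, by simpa [Prog.denote] using hsg₂⟩
        · refine ⟨h2.setReg _ (by omega), ?_⟩
          simp [Prog.denote, hsg₂, h1s h2]
          cases c <;> rfl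
      have h5 := denote_emitReg (a := Rsign) h3.1 h1 h3.2
      have e : (seqs [.load Ru 4 Rv, emitReg o Ru, if b then .sub Rsign Rone Rsign else .skip,
          emitReg o Rsign]).denote s' = (emitReg o Rsign).denote
          ((if b then Prog.sub Rsign Rone Rsign else .skip).denote s₂) := by
        simp [seqs, Prog.denote, hv, h4, hs₂]
      rw [e]
      refine ⟨?_, ?_⟩
      · simpa [litWords] using h5
      · rw [emitReg_reg (by omega)]
        have : s₂.reg Rlit = s'.reg Rlit := by
          rw [hs₂, emitReg_reg (by omega)]
          simp
        cases b <;> simp [Prog.denote, this])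
    C δ hδ [] (s₁.setReg Rlit (s₁.reg Rp + s₁.reg Rone))
    (by simpa [litWords] using hw₁.setReg _ (by omega))
    (by
      rw [setReg_reg, if_pos rfl, h1s hw₁, hw₁.2 _ (by omega), emit_reg_of_ne _ _ _ (by omega)]
      exact hC.2)
  have e : (emitClause o δ).denote s' = (forLits 0 (fun b => seqs [.load Ru 4 Rv, emitReg o Ru,
      if b then .sub Rsign Rone Rsign else .skip, emitReg o Rsign]) δ).denote
      (s₁.setReg Rlit (s₁.reg Rp + s₁.reg Rone)) := by
    simp [emitClause, seqs, Prog.denote, hs₁]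
  rw [e]
  simpa [fWords, renameClause, flipClause, hδ, Function.comp_def] using key


/-! ### Passes over the formula -/

/-- Among the registers below `16` and the arrays, only the registers `rs` and the arrays `As` have
changed. -/
def Keep (rs As : List ℕ) (s₀ s : Config) : Prop :=
  (∀ y < 16, y ∉ rs → s.reg y = s₀.reg y) ∧ ∀ A, A ∉ As → s.arr A = s₀.arr A

theorem Keep.refl (rs As : List ℕ) (s : Config) : Keep rs As s s :=
  ⟨fun _ _ _ => rfl, fun _ _ => rfl⟩

theorem Keep.trans {rs As : List ℕ} {s₁ s₂ s₃ : Config} (h : Keep rs As s₁ s₂)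
    (h' : Keep rs As s₂ s₃) : Keep rs As s₁ s₃ :=
  ⟨fun y hy hr => (h'.1 y hy hr).trans (h.1 y hy hr), fun A hA => (h'.2 A hA).trans (h.2 A hA)⟩

theorem Keep.mono {rs As rs' As' : List ℕ} {s₁ s₂ : Config} (h : Keep rs As s₁ s₂)
    (hr : rs ⊆ rs') (hA : As ⊆ As') : Keep rs' As' s₁ s₂ :=
  ⟨fun y hy hy' => h.1 y hy fun h => hy' (hr h), fun A hA' => h.2 A fun h => hA' (hA h)⟩

theorem Keep.setReg {rs As : List ℕ} {s₀ s : Config} (h : Keep rs As s₀ s) {d : ℕ} (v : ℕ)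
    (hd : 16 ≤ d ∨ d ∈ rs) : Keep rs As s₀ (s.setReg d v) :=
  ⟨fun y hy hr => by
    rw [setReg_reg, if_neg, h.1 y hy hr]
    rintro rfl
    exact hd.elim (by omega) hr, h.2⟩

theorem Keep.same {rs As : List ℕ} {s₀ s s' : Config} (h : Keep rs As s₀ s) (h' : Same s s') :
    Keep rs As s₀ s' :=
  ⟨fun y hy hr => (h'.2 y hy).trans (h.1 y hy hr), fun A hA => by rw [h'.1, h.2 A hA]⟩

theorem Keep.putArr {rs As : List ℕ} {s₀ s : Config} (h : Keep rs As s₀ s) {A : ℕ} (f : ℕ → ℕ)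
    (hA : A ∈ As) : Keep rs As s₀ (s.putArr A f) :=
  ⟨h.1, fun B hB => by
    rw [putArr_arr, if_neg, h.2 B hB]
    rintro rfl
    exact hB hA⟩

theorem Keep.setArr {rs As : List ℕ} {s₀ s : Config} (h : Keep rs As s₀ s) {A : ℕ} (i v : ℕ)
    (hA : A ∈ As) : Keep rs As s₀ (s.setArr A i v) := h.putArr _ hA

/-- The clauses `F` of size `r` stand in array `a`, and the constants are in their registers. -/
structure Ready (r : ℕ) (F : List (List Literal)) (a : ℕ) (s : Config) : Prop where
  zero : s.reg Rzero = 0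
  one : s.reg Rone = 1
  num : s.reg Rm = F.length
  stride : s.reg Rstride = 2 * r + 1
  inp : Mem (s.arr a) 1 (fWords F)

theorem Ready.keep {r a : ℕ} {F : List (List Literal)} {s₀ s : Config} (h : Ready r F a s₀)
    {rs As : List ℕ} (h' : Keep rs As s₀ s)
    (hrs : Rzero ∉ rs ∧ Rone ∉ rs ∧ Rm ∉ rs ∧ Rstride ∉ rs) (ha : a ∉ As) : Ready r F a s :=
  ⟨by rw [h'.1 _ (by omega) hrs.1, h.zero], by rw [h'.1 _ (by omega) hrs.2.1, h.one],
    by rw [h'.1 _ (by omega) hrs.2.2.1, h.num], by rw [h'.1 _ (by omega) hrs.2.2.2, h.stride],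
    by rw [h'.2 _ ha]; exact h.inp⟩

theorem Ready.clause {r a : ℕ} {d d' : List (List Literal)} {C : List Literal} {s : Config}
    (h : Ready r (d ++ C :: d') a s) (hF : ∀ C ∈ d, C.length = r)
    (hp : s.reg Rp = 1 + (2 * r + 1) * d.length) :
    Mem (s.arr a) (s.reg Rp) (C.length :: litWords C) := by
  rw [hp]
  exact mem_clause h.inp hF

/-- The lists of the variables of clauses. -/
def varList (F : List (List Literal)) : List ℕ := F.flatMap fun C => C.map Prod.fst

/-- The pass that assigns codes to the variables. -/
def codePass (r : ℕ) : Prog :=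
  forClauses (seqs [.add Rlit Rp Rone,
    forLits 0 (fun _ => nameLit 2 Rnc Rnc) (List.replicate r false)])

/-- The cost of the body of a pass over the clauses. -/
def codeCost (r : ℕ) : ℕ := Prog.cost (seqs [.add Rlit Rp Rone,
    forLits 0 (fun _ => nameLit 2 Rnc Rnc) (List.replicate r false)]) + 8

theorem runs_codePass {r : ℕ} {F : List (List Literal)} (hF : ∀ C ∈ F, C.length = r)
    {s₀ : Config} (hs : Ready r F 0 s₀) (h2 : s₀.arr 2 = fun _ => 0) (hc : s₀.reg Rnc = 2) :
    ∃ s, Runs (codePass r) s₀ s (codeCost r * (F.length + 1)) ∧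
      Keep [Ri, Rp, Rnc] [2] s₀ s ∧ s.arr 2 = (names (fun n => n + n) 2 (varList F)).1 := by
  obtain ⟨s, h, h1, h2, -⟩ := Runs.forClauses (L := F) (n := 2 * r + 1)
    (body := seqs [.add Rlit Rp Rone,
      forLits 0 (fun _ => nameLit 2 Rnc Rnc) (List.replicate r false)])
    ⟨trivial, loopFree_forLits _ (fun _ => loopFree_nameLit _ _ _) _, trivial⟩
    (fun d s => Keep [Ri, Rp, Rnc] [2] s₀ s ∧
      s.arr 2 = (names (fun n => n + n) 2 (varList d)).1 ∧
      s.reg Rnc = (names (fun n => n + n) 2 (varList d)).2)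
    (by
      rintro d s ⟨h, -⟩
      have := hs.keep h (by simp) (by simp)
      exact ⟨this.one, this.num, this.stride⟩)
    (by
      rintro d s x v (rfl | rfl) ⟨h, h'⟩
      · exact ⟨h.setReg _ (.inr (by simp)), by simpa using h'⟩
      · exact ⟨h.setReg _ (.inr (by simp)), by simpa using h'⟩)
    (by
      rintro d C d' rfl s ⟨h, ha, hn⟩ hp
      have hs' := hs.keep h (by simp) (by simp)
      have hC := hs'.clause (fun D hD => hF D (by simp [hD])) hp
      have key := denote_nameVars (A := 2) (n := Rnc) (d := Rnc) (g := fun n => n + n)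
        (s := s.setReg Rlit (s.reg Rp + 1)) (fun _ _ => rfl) (by omega) (by omega) (by omega)
        (by simpa using hC.2) (hF C (by simp)) (by simp [hs'.one])
      have e : (seqs [.add Rlit Rp Rone, forLits 0 (fun _ => nameLit 2 Rnc Rnc)
          (List.replicate r false)]).denote s = (forLits 0 (fun _ => nameLit 2 Rnc Rnc)
          (List.replicate r false)).denote (s.setReg Rlit (s.reg Rp + 1)) := by
        simp [seqs, Prog.denote, hs'.one]
      rw [e]
      generalize (forLits 0 (fun _ => nameLit 2 Rnc Rnc) (List.replicate r false)).denote
        (s.setReg Rlit (s.reg Rp + 1)) = s' at *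
      have hv : varList (d ++ [C]) = varList d ++ C.map Prod.fst := by simp [varList]
      rw [hv, names_append]
      simp only [setReg_arr, setReg_reg, ha, hn, if_neg (show ¬ Rnc = Rlit by omega)] at key
      refine ⟨⟨?_, ?_, ?_⟩, ?_, ?_⟩
      · exact (((h.setReg _ (.inl (by omega))).putArr _ (by simp)).setReg _
          (.inr (by simp))).same key
      · simp [key.1]
      · simp [key.2 Rnc (by omega)]
      · simp [key.2 Ri (by omega)]
      · simp [key.2 Rp (by omega)])
    s₀ ⟨Keep.refl _ _ _, h2, hc⟩
  exact ⟨s, h, h1, h2⟩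

theorem foldl_append_singleton {α β : Type*} (g : α → β) (L : List β) (l : List α) :
    l.foldl (fun L a => L ++ [g a]) L = L ++ l.map g := by
  induction l generalizing L with
  | nil => simp
  | cons a l ih => simp [ih]

theorem occs_append_singleton (r : ℕ) (d : List (List Literal)) (C : List Literal) :
    occs r (d ++ [C]) = occs r d ++ (nzMasks r).map fun μ => (C, μ) := by simp [occs]

/-- Count the occurrence of the monomial given by `μ` and the current clause. -/
def countBlock (μ : List Bool) : Prog :=
  seqs [keyBlock μ, .load Rt 3 Rkey, .add Rt Rt Rone, .store 3 Rkey Rt]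

theorem loopFree_countBlock (μ : List Bool) : (countBlock μ).LoopFree :=
  ⟨loopFree_keyBlock μ, trivial, trivial, trivial, trivial⟩

/-- The pass that counts the occurrences of the monomials. -/
def countPass (r : ℕ) : Prog := forClauses (seqs ((nzMasks r).map countBlock))

/-- The cost per clause of `countPass`. -/
def countCost (r : ℕ) : ℕ := Prog.cost (seqs ((nzMasks r).map countBlock)) + 8

theorem runs_countPass {r : ℕ} {F : List (List Literal)}
    (hF : ∀ C ∈ F, C.length = r ∧ (C.map Prod.fst).Nodup)
    {s₀ : Config} (hs : Ready r F 0 s₀) (h3 : s₀.arr 3 = fun _ => 0) :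
    ∃ s, Runs (countPass r) s₀ s (countCost r * (F.length + 1)) ∧
      Keep [Ri, Rp] [3] s₀ s ∧ s.arr 3 = counts (s₀.arr 2) (occs r F) := by
  obtain ⟨s, h, h1, h2⟩ := Runs.forClauses (L := F) (n := 2 * r + 1)
    (body := seqs ((nzMasks r).map countBlock))
    (loopFree_seqs fun P hP => by
      obtain ⟨μ, -, rfl⟩ := List.mem_map.1 hP
      exact loopFree_countBlock μ)
    (fun d s => Keep [Ri, Rp] [3] s₀ s ∧ s.arr 3 = counts (s₀.arr 2) (occs r d))
    (by
      rintro d s ⟨h, -⟩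
      have := hs.keep h (by simp) (by simp)
      exact ⟨this.one, this.num, this.stride⟩)
    (by
      rintro d s x v (rfl | rfl) ⟨h, h'⟩
      · exact ⟨h.setReg _ (.inr (by simp)), by simpa using h'⟩
      · exact ⟨h.setReg _ (.inr (by simp)), by simpa using h'⟩)
    (by
      rintro d C d' rfl s ⟨h, ha⟩ hp
      have hs' := hs.keep h (by simp) (by simp)
      have hC := hs'.clause (fun D hD => (hF D (by simp [hD])).1) hp
      have key := denote_seqs_map (P := countBlock)
        (I := fun L s' => Keep [] [3] s s' ∧ s'.arr 3 = counts (s₀.arr 2) L)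
        (f := fun L μ => L ++ [(C, μ)]) (l := nzMasks r)
        (by
          rintro μ hμ L s₁ ⟨h₁, ha₁⟩
          have hs₁ := hs'.keep h₁ (by simp) (by simp)
          obtain ⟨hk, hkey, -⟩ := denote_keyBlock (C := C) (μ := μ) (s := s₁)
            (by rw [h₁.2 0 (by simp), h₁.1 _ (by omega) (by simp)]; exact hC)
            ((length_of_mem_nzMasks hμ).trans (hF C (by simp)).1.symm) (hF C (by simp)).2 hs₁.one
          set s₂ := (keyBlock μ).denote s₁ with hs₂
          have h2 : s₁.arr 2 = s₀.arr 2 := by rw [h₁.2 2 (by simp), h.2 2 (by simp)]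
          have e : (countBlock μ).denote s₁ = ((s₂.setReg Rt (s₂.arr 3 (s₂.reg Rkey))).setReg Rt
              (s₂.arr 3 (s₂.reg Rkey) + 1)).setArr 3 (s₂.reg Rkey)
              (s₂.arr 3 (s₂.reg Rkey) + 1) := by
            have h1 : s₂.reg Rone = 1 := by rw [hk.2 _ (by omega), hs₁.one]
            simp [countBlock, seqs, Prog.denote, ← hs₂, h1]
          rw [e]
          refine ⟨(((h₁.same hk).setReg _ (.inl (by omega))).setReg _ (.inl (by omega))).setArr
            _ _ (by simp), ?_⟩
          rw [setArr_arr, if_pos rfl, setReg_arr, setReg_arr, hkey, hk.1, ha₁, h2]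
          funext u
          simp only [Function.update_apply, counts, List.countP_append, List.countP_singleton,
            eq_comm (a := u)]
          split_ifs with hu hu' hu' <;> simp_all)
        (occs r d) s ⟨Keep.refl _ _ _, ha⟩
      rw [foldl_append_singleton, ← occs_append_singleton] at key
      exact ⟨⟨h.trans (key.1.mono (by simp) (by simp)), key.2⟩, key.1.1 _ (by omega) (by simp),
        key.1.1 _ (by omega) (by simp)⟩)
    s₀ ⟨Keep.refl _ _ _, by rw [h3]; rfl⟩
  exact ⟨s, h, h1, h2⟩

/-- The variables of a list of occurrences. -/
def occVars (E : List Occ) : List ℕ := E.flatMap fun o => o.1.map Prod.fst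

/-- The names of the variables of a list of occurrences, which are `1, 2, ...` in the order of
their appearance. -/
def occNames (E : List Occ) : (ℕ → ℕ) × ℕ := names (fun n => n + 1) 1 (occVars E)

theorem occNames_spec (E : List Occ) :
    Set.InjOn (occNames E).1 {v | v ∈ occVars E} ∧
      ∀ v ∈ occVars E, (occNames E).1 v ≠ 0 ∧ (occNames E).1 v ≤ (occVars E).length := by
  obtain ⟨c, e, hc, -, hinj, hmem, -⟩ := names_spec (g := fun n => n + 1) (w := fun i => i + 1)
    (fun i => ⟨by simp, rfl⟩) (occVars E)
  refine ⟨fun v hv v' hv' h => hinj hv hv' ?_, fun v hv => ?_⟩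
  · have h1 := (hmem v hv).2
    have h2 := (hmem v' hv').2
    simp only [occNames, zero_add] at h h1 h2
    omega
  · have h1 := hmem v hv
    simp only [occNames, zero_add] at h1 ⊢
    omega

/-- The words of the clauses that represent the occurrences `E`. -/
def occWords (E : List Occ) : List ℕ :=
  fWords ((E.flatMap gadget).map (renameClause (occNames E).1))

theorem occWords_append {r : ℕ} {F : RCNF r} {E : List Occ} (hE : ∀ o ∈ E, o ∈ occs r F.1)
    (o : Occ) : occWords (E ++ [o]) =
      occWords E ++ fWords ((gadget o).map (renameClause (occNames (E ++ [o])).1)) := by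
  have h : (E.flatMap gadget).map (renameClause (occNames (E ++ [o])).1) =
      (E.flatMap gadget).map (renameClause (occNames E).1) := by
    refine List.map_congr_left fun D hD => List.map_congr_left fun l hl => ?_
    obtain ⟨o', ho', hD⟩ := List.mem_flatMap.1 hD
    have hl' : l.1 ∈ occVars E := by
      refine List.mem_flatMap.2 ⟨o', ho', ?_⟩
      rw [← vars_of_mem_gadget (hE o' ho') hD]
      exact List.mem_map.2 ⟨l, hl, rfl⟩
    have hne := ((occNames_spec E).2 _ hl').1
    rw [occNames, occVars, List.flatMap_append, names_append,
      foldl_nameStep_of_ne_zero (by exact hne)]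
    rfl
  rw [occWords, List.flatMap_append, List.map_append, h]
  simp [fWords, occWords]

/-- Cancel the occurrence given by `μ` and the current clause, or else write the clauses that
represent it. -/
def emitBlock (o r : ℕ) (μ : List Bool) : Prog :=
  seqs [keyBlock μ, .load Rt 3 Ropp,
    .ite Rzero Rt (seqs [.sub Rt Rt Rone, .store 3 Ropp Rt])
      (seqs [.add Rw Rw Rone, .add Rlit Rp Rone,
        forLits 0 (fun _ => nameLit 4 Rnn Rone) (List.replicate r false),
        seqs ((flips μ false).map (emitClause o))])]

theorem loopFree_emitBlock (o r : ℕ) (μ : List Bool) : (emitBlock o r μ).LoopFree :=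
  ⟨loopFree_keyBlock μ, trivial, ⟨⟨trivial, trivial, trivial⟩, trivial, trivial,
    loopFree_forLits _ (fun _ => loopFree_nameLit _ _ _) _, loopFree_seqs fun P hP => by
      obtain ⟨δ, -, rfl⟩ := List.mem_map.1 hP
      exact loopFree_emitClause o δ, trivial⟩, trivial⟩

/-- The state of the cancellation: `x` consists of the current counters and the survivors so
far. -/
structure EmitInv {r : ℕ} (F : RCNF r) (o : ℕ) (s₀ : Config) (x : (ℕ → ℕ) × List Occ)
    (s : Config) : Prop where
  keep : Keep [Ri, Rp, Rq, Rnn, Rw] [3, 4, o] s₀ s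
  cnt : s.arr 3 = x.1
  table : s.arr 4 = (occNames x.2).1
  next : s.reg Rnn = (occNames x.2).2
  weight : s.reg Rw = x.2.length
  out : s.arr o = putWords (s₀.arr o) 1 (occWords x.2)
  pos : s.reg Rq = 1 + (occWords x.2).length
  mem : ∀ p ∈ x.2, p ∈ occs r F.1

theorem EmitInv.setReg {r : ℕ} {F : RCNF r} {o : ℕ} {s₀ s : Config} {x : (ℕ → ℕ) × List Occ}
    (h : EmitInv F o s₀ x s) {y : ℕ} (v : ℕ) (hy : y = Ri ∨ y = Rp ∨ 16 ≤ y) :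
    EmitInv F o s₀ x (s.setReg y v) := by
  obtain ⟨h1, h2, h3, h4, h5, h6, h7, h8⟩ := h
  refine ⟨h1.setReg v ?_, h2, h3, ?_, ?_, h6, ?_, h8⟩
  · obtain rfl | rfl | hy := hy <;> simp_all
  all_goals rwa [setReg_reg, if_neg (by omega)]

theorem EmitInv.same {r : ℕ} {F : RCNF r} {o : ℕ} {s₀ s s' : Config} {x : (ℕ → ℕ) × List Occ}
    (h : EmitInv F o s₀ x s) (h' : Same s s') : EmitInv F o s₀ x s' := by
  obtain ⟨h1, h2, h3, h4, h5, h6, h7, h8⟩ := h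
  refine ⟨h1.same h', ?_, ?_, ?_, ?_, ?_, ?_, h8⟩
  all_goals first | rw [h'.1]; assumption | rw [h'.2 _ (by omega)]; assumption

theorem denote_emitBlock {r : ℕ} {F : RCNF r} {o : ℕ} (ho : o = 1 ∨ o = 5) {s₀ : Config}
    (hs : Ready r F.1 0 s₀) {C : List Literal} {μ : List Bool} (hCF : C ∈ F.1)
    (hμ : μ ∈ nzMasks r) {x : (ℕ → ℕ) × List Occ} {s : Config} (h : EmitInv F o s₀ x s)
    (hC : Mem (s.arr 0) (s.reg Rp) (C.length :: litWords C)) :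
    EmitInv F o s₀ (cancelStep (fun o => addr (s₀.arr 2) (negItem (item o))) x (C, μ))
        ((emitBlock o r μ).denote s) ∧
      ((emitBlock o r μ).denote s).reg Ri = s.reg Ri ∧
      ((emitBlock o r μ).denote s).reg Rp = s.reg Rp := by
  have ho0 : o ≠ 0 := by omega
  have ho2 : o ≠ 2 := by omega
  have ho3 : o ≠ 3 := by omega
  have ho4 : o ≠ 4 := by omega
  obtain ⟨hl, hn⟩ := F.2 C hCF
  have hμl := (length_of_mem_nzMasks hμ).trans hl.symm
  have hs' := hs.keep h.keep (by simp) (by simp [ho0.symm])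
  obtain ⟨hk, -, hopp⟩ := denote_keyBlock (C := C) (μ := μ) hC hμl hn hs'.one
  set s₁ := (keyBlock μ).denote s with hs₁
  rw [h.keep.2 2 (by simp [ho2.symm])] at hopp
  set u := addr (s₀.arr 2) (negItem (item (C, μ))) with hu
  have hsame₂ : Same s (s₁.setReg Rt (x.1 u)) := hk.setReg _ (by omega)
  set s₂ := s₁.setReg Rt (x.1 u) with hs₂
  have h₂ := h.same hsame₂
  have h1₂ : s₂.reg Rone = 1 := by rw [hsame₂.2 _ (by omega), hs'.one]
  have hopp₂ : s₂.reg Ropp = u := by simp [hs₂, hopp]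
  have ht₂ : s₂.reg Rt = x.1 u := by simp [hs₂]
  have e : (emitBlock o r μ).denote s = (if 0 < x.1 u then
      (s₂.setReg Rt (x.1 u - 1)).setArr 3 u (x.1 u - 1) else
      (seqs ((flips μ false).map (emitClause o))).denote
        ((forLits 0 (fun _ => nameLit 4 Rnn Rone) (List.replicate r false)).denote
          ((s₂.setReg Rw (x.2.length + 1)).setReg Rlit (s.reg Rp + 1)))) := by
    have hz : s₂.reg Rzero = 0 := by rw [hsame₂.2 _ (by omega), hs'.zero]
    have hp : s₂.reg Rp = s.reg Rp := hsame₂.2 _ (by omega)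
    have hload : (Prog.load Rt 3 Ropp).denote s₁ = s₂ := by
      simp [Prog.denote, hopp, hk.1, h.cnt, hs₂]
    simp only [emitBlock, seqs, Prog.denote] at hload ⊢
    simp only [← hs₁, hload, hz, ht₂]
    simp [h1₂, hopp₂, h₂.weight, hp]
  rw [e]
  by_cases hpos : 0 < x.1 u
  · rw [if_pos hpos, cancelStep, if_pos hpos]
    obtain ⟨k1, k2, k3, k4, k5, k6, k7, k8⟩ := h₂
    refine ⟨⟨(k1.setReg _ (.inl (by omega))).setArr _ _ (by simp), ?_, ?_, ?_, ?_, ?_, ?_, k8⟩,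
      ?_, ?_⟩
    · simp [k2, ← hu]
    · simp [k3]
    · simp [k4]
    · simp [k5]
    · simp [k6, ho3]
    · simp [k7]
    · simpa using hsame₂.2 Ri (by omega)
    · simpa using hsame₂.2 Rp (by omega)
  · rw [if_neg hpos, cancelStep, if_neg hpos]
    set s₃ := (s₂.setReg Rw (x.2.length + 1)).setReg Rlit (s.reg Rp + 1) with hs₃
    have harr₃ : s₃.arr = s.arr := by simp only [hs₃, setReg_arr, hsame₂.1]
    have key := denote_nameVars (A := 4) (n := Rnn) (d := Rone) (g := fun n => n + 1)
        (s := s₃) (C := C) (r := r) (fun s' h => by rw [h]) (by omega) (by omega) (by omega)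
        (by rw [harr₃]; simpa [hs₃] using hC.2) hl (by simp [hs₃, h1₂])
    set s₄ := (forLits 0 (fun _ => nameLit 4 Rnn Rone) (List.replicate r false)).denote s₃
      with hs₄
    have hnames : (C.map Prod.fst).foldl (nameStep fun n => n + 1) (s₃.arr 4, s₃.reg Rnn) =
        occNames (x.2 ++ [(C, μ)]) := by
      have h4 : s₃.reg Rnn = (occNames x.2).2 := by simpa [hs₃] using h₂.next
      rw [harr₃, h.table, h4]
      simp [occNames, occVars, names_append]
    rw [hnames] at key
    have hp₄ : s₄.reg Rp = s.reg Rp := by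
      rw [key.2 _ (by omega)]
      simpa [hs₃] using hsame₂.2 Rp (by omega)
    have hi₄ : s₄.reg Ri = s.reg Ri := by
      rw [key.2 _ (by omega)]
      simpa [hs₃] using hsame₂.2 Ri (by omega)
    have h4₄ : s₄.arr 4 = (occNames (x.2 ++ [(C, μ)])).1 := by rw [key.1]; simp
    have hne : ∀ A, A ≠ 4 → s₄.arr A = s.arr A := fun A hA => by rw [key.1]; simp [hA, harr₃]
    have key₂ := denote_seqs_map (P := emitClause o)
      (I := fun w s' => Same (s₄.emit o w) s')
      (f := fun w δ => w ++ fWords [renameClause (s₄.arr 4) (flipClause C δ)])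
      (l := flips μ false)
      (fun δ hδ w s' hw => denote_emitClause ho0 ho4
        (by rw [hne 0 (by omega), hp₄]; exact hC) ((length_of_mem_flips hδ).trans hμl)
        (by rw [key.2 _ (by omega)]; simpa [hs₃] using h1₂) hw)
      [] s₄ (same_emit_nil s₄ o)
    have hfold : ∀ (l : List (List Bool)) (w : List ℕ), l.foldl
        (fun w δ => w ++ fWords [renameClause (s₄.arr 4) (flipClause C δ)]) w =
        w ++ fWords ((l.map (flipClause C)).map (renameClause (s₄.arr 4))) := by
      intro l
      induction l with
      | nil => simp [fWords]
      | cons δ l ih =>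
        intro w
        rw [List.foldl_cons, ih]
        simp [fWords]
    rw [hfold, List.nil_append, h4₄] at key₂
    set s₅ := (seqs ((flips μ false).map (emitClause o))).denote s₄
    set w := fWords (((flips μ false).map (flipClause C)).map
      (renameClause (occNames (x.2 ++ [(C, μ)])).1)) with hw
    have hwords : occWords (x.2 ++ [(C, μ)]) = occWords x.2 ++ w := occWords_append h.mem _
    have hq₄ : s₄.reg Rq = 1 + (occWords x.2).length := by
      rw [key.2 _ (by omega)]
      simpa [hs₃] using h₂.pos
    refine ⟨⟨?_, ?_, ?_, ?_, ?_, ?_, ?_, ?_⟩, ?_, ?_⟩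
    · refine Keep.same ?_ key₂
      refine Keep.setReg (Keep.putArr (Keep.same ?_ key) _ (by simp)) _ (.inr (by simp))
      refine Keep.setReg (Keep.putArr (Keep.setReg ?_ _ (.inl (by omega))) _ (by simp)) _
        (.inr (by simp))
      exact Keep.setReg h₂.keep _ (.inr (by simp))
    · rw [key₂.1, emit_arr_of_ne _ _ ho3.symm, hne 3 (by omega), h.cnt]
    · rw [key₂.1, emit_arr_of_ne _ _ ho4.symm, h4₄]
    · rw [key₂.2 _ (by omega), emit_reg_of_ne _ _ _ (by omega), key.2 _ (by omega)]
      simp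
    · rw [key₂.2 _ (by omega), emit_reg_of_ne _ _ _ (by omega), key.2 _ (by omega)]
      simp [hs₃]
    · rw [key₂.1]
      simp only [Config.emit, setReg_arr, putArr_arr, if_true]
      rw [hne o ho4, h.out, hq₄, hwords, putWords_append]
    · rw [key₂.2 _ (by omega), hwords]
      simp [Config.emit, hq₄, add_assoc]
    · intro p hp
      obtain hp | hp := List.mem_append.1 hp
      · exact h.mem p hp
      · rw [List.mem_singleton.1 hp]
        exact mem_occs.2 ⟨hCF, hμ⟩
    · rw [key₂.2 _ (by omega), emit_reg_of_ne _ _ _ (by omega), hi₄]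
    · rw [key₂.2 _ (by omega), emit_reg_of_ne _ _ _ (by omega), hp₄]

/-- The pass that cancels opposite monomials and writes the clauses that represent the
survivors. -/
def emitPass (o r : ℕ) : Prog := forClauses (seqs ((nzMasks r).map (emitBlock o r)))

/-- The cost per clause of `emitPass`. -/
def emitCost (o r : ℕ) : ℕ := Prog.cost (seqs ((nzMasks r).map (emitBlock o r))) + 8

theorem runs_emitPass {r : ℕ} (F : RCNF r) {o : ℕ} (ho : o = 1 ∨ o = 5) {s₀ : Config}
    (hs : Ready r F.1 0 s₀) (h3 : s₀.arr 3 = counts (s₀.arr 2) (occs r F.1))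
    (h4 : s₀.arr 4 = fun _ => 0) (hnn : s₀.reg Rnn = 1) (hw : s₀.reg Rw = 0)
    (hq : s₀.reg Rq = 1) :
    ∃ s, Runs (emitPass o r) s₀ s (emitCost o r * (F.1.length + 1)) ∧
      EmitInv F o s₀ (cancel (s₀.arr 2) (counts (s₀.arr 2) (occs r F.1)) (occs r F.1)) s := by
  obtain ⟨s, h, h'⟩ := Runs.forClauses (L := F.1) (n := 2 * r + 1)
    (body := seqs ((nzMasks r).map (emitBlock o r)))
    (loopFree_seqs fun P hP => by
      obtain ⟨μ, -, rfl⟩ := List.mem_map.1 hP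
      exact loopFree_emitBlock o r μ)
    (fun d s => EmitInv F o s₀
      (cancel (s₀.arr 2) (counts (s₀.arr 2) (occs r F.1)) (occs r d)) s)
    (by
      intro d s h
      have := hs.keep h.keep (by simp) (by simp; omega)
      exact ⟨this.one, this.num, this.stride⟩)
    (fun d s x v hx h => h.setReg v (by omega))
    (by
      intro d C d' hF s h hp
      have hs' := hs.keep h.keep (by simp) (by simp; omega)
      rw [hF] at hs'
      have hC := hs'.clause (fun D hD => (F.2 D (by simp [hF, hD])).1) hp
      have key := denote_seqs_map (P := emitBlock o r)
        (I := fun x s' => EmitInv F o s₀ x s' ∧ s'.reg Ri = s.reg Ri ∧ s'.reg Rp = s.reg Rp)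
        (f := fun x μ => cancelStep (fun o => addr (s₀.arr 2) (negItem (item o))) x (C, μ))
        (l := nzMasks r)
        (by
          rintro μ hμ x s₁ ⟨h₁, hi, hp⟩
          have := denote_emitBlock ho hs (C := C) (by simp [hF]) hμ h₁ (by
            rw [hp, h₁.keep.2 0 (by simp; omega), ← h.keep.2 0 (by simp; omega)]
            exact hC)
          exact ⟨this.1, this.2.1.trans hi, this.2.2.trans hp⟩)
        _ s ⟨h, rfl, rfl⟩
      rw [← List.foldl_map (f := fun μ => (C, μ)), cancel, ← List.foldl_append,
        ← occs_append_singleton] at key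
      exact key)
    s₀ ⟨Keep.refl _ _ _, h3, h4, hnn, hw, rfl, hq, by simp [cancel, occs]⟩
  exact ⟨s, h, h'⟩


/-! ### The kernelization -/

theorem mem_of_eq_getD {f : ℕ → ℕ} {w : List ℕ} (h : ∀ i, f i = w.getD i 0) : Mem f 0 w :=
  mem_iff.2 fun j _ => by rw [zero_add, h]

/-- Double the register `a` `n` times. -/
def doubles (n a : ℕ) : Prog := seqs (List.replicate n (.add a a a))

theorem loopFree_doubles (n a : ℕ) : (doubles n a).LoopFree :=
  loopFree_seqs fun P hP => by rw [List.eq_of_mem_replicate hP]; trivial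

theorem denote_doubles (n a : ℕ) (s : Config) :
    (doubles n a).denote s = s.setReg a (2 ^ n * s.reg a) := by
  induction n generalizing s with
  | zero => simp [doubles, seqs, Prog.denote, Config.setReg]
  | succ n ih =>
    have : (doubles (n + 1) a).denote s = (doubles n a).denote (s.setReg a (s.reg a + s.reg a)) :=
      rfl
    rw [this, ih]
    simp only [Config.setReg, Function.update_self, Function.update_idem]
    congr 2
    ring

/-- Store the square of the parameter in the register `Rbound`. -/
def squareProg : Prog :=
  seqs [.const Rbound 0, .const Rcount 0,
    .while Rcount 0 (seqs [.add Rbound Rbound 0, .add Rcount Rcount Rone])]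

theorem runs_squareProg {s₀ : Config} (h1 : s₀.reg Rone = 1) :
    ∃ s, Runs squareProg s₀ s (4 * s₀.reg 0 + 4) ∧ Keep [Rbound, Rcount] [] s₀ s ∧
      s.reg Rbound = s₀.reg 0 * s₀.reg 0 := by
  obtain ⟨s, h, hk, hb, -⟩ := Runs.while_of_count (a := Rcount) (b := 0)
    (P := seqs [.add Rbound Rbound 0, .add Rcount Rcount Rone]) (T := 3)
    (fun j s => Keep [Rbound, Rcount] [] s₀ s ∧ s.reg Rbound = j * s₀.reg 0 ∧ s.reg Rcount = j)
    (s₀.reg 0)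
    (by
      rintro j hj s ⟨h, hb, hc⟩
      have h0 := h.1 0 (by omega) (by simp)
      have h1' := h.1 Rone (by omega) (by simp)
      refine ⟨by omega, _, Runs.denote (P := seqs [.add Rbound Rbound 0, .add Rcount Rcount Rone])
        ⟨trivial, trivial, trivial⟩ s, (h.setReg _ (.inr (by simp))).setReg _ (.inr (by simp)),
        ?_, ?_⟩
      · simp [seqs, Prog.denote, hb, h0]
        ring
      · simp [seqs, Prog.denote, hc, h1', h1])
    (by
      rintro s ⟨h, hb, hc⟩
      rw [hc, h.1 0 (by omega) (by simp)]
      exact lt_irrefl _)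
    ((s₀.setReg Rbound 0).setReg Rcount 0)
    ⟨((Keep.refl _ _ _).setReg _ (.inr (by simp))).setReg _ (.inr (by simp)), by simp, by simp⟩
  refine ⟨s, ?_, hk, hb⟩
  refine (Runs.seq (Runs.denote (P := .const Rbound 0) trivial s₀)
    (Runs.seq (Runs.denote (P := .const Rcount 0) trivial _)
      (Runs.seq h (Runs.denote (P := .skip) trivial _)))).mono ?_
  simp only [Prog.cost]
  omega

/-- The constants of the kernelization. -/
def setup (r : ℕ) : Prog :=
  seqs [.const Rstride (2 * r + 1), .const Rnc 2, .const Rq 1, .const Rnn 1]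

/-- If there are too many survivors, replace the output by the empty formula with parameter `0`;
otherwise complete it by the number of clauses and the new parameter. -/
def finish (o r : ℕ) : Prog :=
  seqs [doubles (6 * r + 2) Rbound,
    .ite Rbound Rw (seqs [.const 0 0, .store o Rzero Rzero])
      (seqs [doubles (r - 1) Rw, .store o Rzero Rw, doubles (r - 1) 0])]

theorem loopFree_finish (o r : ℕ) : (finish o r).LoopFree :=
  ⟨loopFree_doubles _ _, ⟨⟨trivial, trivial, trivial⟩, loopFree_doubles _ _, trivial,
    loopFree_doubles _ _, trivial⟩, trivial⟩

/-- The kernelization, with output in the array `o`. If the parameter exceeds the number of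
clauses, the output is the empty formula with parameter `1`. -/
def kernelProg (o r : ℕ) : Prog :=
  .seq (seqs [.load Rm 0 Rzero, .const Rone 1])
    (.ite Rm 0 (seqs [.const 0 1, .store o Rzero Rzero])
      (.seq (setup r) (.seq (codePass r) (.seq (countPass r) (.seq (emitPass o r)
        (.seq squareProg (finish o r)))))))

/-- `(G, k')` is a kernel of `(F, k)`, with at most `2 ^ (r - 1) * (4 * 64 ^ r * k ^ 2)` clauses
and small numbers as variables. The bound `growth` in terms of `F` instead of `k` is what keeps the
time for the further treatment of `G` polynomial in the length of the input, in which `k` has only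
`Nat.size k` digits. -/
structure IsKernel {r : ℕ} (F : RCNF r) (k : ℕ) (G : RCNF r) (k' : ℕ) : Prop where
  yes_iff : (maxSat r).Yes F k ↔ (maxSat r).Yes G k'
  param : k' ≤ 2 ^ r * k + 1
  growth : G.1.length ≤ 2 ^ (r - 1) * (2 ^ r * F.1.length)
  clauses : G.1.length ≤ 2 ^ (r - 1) * (4 * 64 ^ r * k ^ 2)
  vars : ∀ C ∈ G.1, ∀ l ∈ C, l.1 ≤ r * G.1.length

/-- The formula without clauses. -/
def emptyRCNF (r : ℕ) : RCNF r := ⟨[], by simp⟩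

theorem emptyRCNF_encode (r : ℕ) : (emptyRCNF r).encode = [0] := rfl

theorem emptyRCNF_yes_iff (r k : ℕ) : (maxSat r).Yes (emptyRCNF r) k ↔ k = 0 := by
  rw [maxSat_yes_iff_unsat]
  simp [emptyRCNF]

/-- A parameter that exceeds the number of clauses is not reached even if all clauses are
satisfied. -/
theorem isKernel_of_length_lt {r : ℕ} {F : RCNF r} {k : ℕ} (h : F.1.length < k) :
    IsKernel F k (emptyRCNF r) 1 := by
  refine ⟨?_, by omega, by simp [emptyRCNF], by simp [emptyRCNF], by simp [emptyRCNF]⟩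
  rw [emptyRCNF_yes_iff, maxSat_yes_iff_unsat]
  simp only [one_ne_zero, iff_false, not_exists]
  intro τ
  omega

theorem isKernel_of_yes {r : ℕ} {F : RCNF r} {k : ℕ} (h : (maxSat r).Yes F k) :
    IsKernel F k (emptyRCNF r) 0 :=
  ⟨by rw [emptyRCNF_yes_iff]; simpa using h, by omega, by simp [emptyRCNF], by simp [emptyRCNF],
    by simp [emptyRCNF]⟩

/-- The codes assigned by doubling are distinct powers of two. -/
theorem isCode_names (F : List (List Literal)) :
    IsCode (names (fun n => n + n) 2 (varList F)).1 (varSet F) := by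
  obtain ⟨c, e, -, -, hinj, hmem, -⟩ := names_spec (g := fun n => n + n)
    (w := fun i => 2 ^ (i + 1)) (fun i => ⟨by positivity, by ring⟩) (varList F)
  have hv : ∀ v ∈ varSet F, v ∈ varList F := fun v hv => by
    simp only [varSet, varList, List.mem_toFinset, List.mem_map, List.mem_flatten,
      List.mem_flatMap] at hv ⊢
    obtain ⟨l, ⟨C, hC, hl⟩, rfl⟩ := hv
    exact ⟨C, hC, l, hl, rfl⟩
  exact ⟨e, fun v h v' h' he => hinj (hv v h) (hv v' h') he, fun v h => (hmem v (hv v h)).2⟩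

/-- The kernelization takes linear time. It leaves its constants in place and the remaining arrays
untouched, so that another program can be run after it. -/
theorem runs_kernelProg (r : ℕ) {o : ℕ} (ho : o = 1 ∨ o = 5) :
    ∃ c, ∀ (F : RCNF r) (k : ℕ), ∃ (s : Config) (G : RCNF r),
      Runs (kernelProg o r) (initial F.encode k) s (c * (F.1.length + 1)) ∧
        Mem (s.arr o) 0 G.encode ∧ s.reg Rzero = 0 ∧ s.reg Rone = 1 ∧
        (∀ A, A ∉ [2, 3, 4, o] → s.arr A = (initial F.encode k).arr A) ∧
        IsKernel F k G (s.reg 0) := by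
  have ho0 : o ≠ 0 := by omega
  have ho2 : o ≠ 2 := by omega
  have ho3 : o ≠ 3 := by omega
  have ho4 : o ≠ 4 := by omega
  refine ⟨20 + codeCost r + countCost r + emitCost o r + (finish o r).cost, fun F k => ?_⟩
  have hin : (initial F.encode k).arr 0 0 = F.1.length ∧
      Mem ((initial F.encode k).arr 0) 1 (fWords F.1) :=
    mem_of_eq_getD (w := F.encode) fun i => rfl
  have hrun₁ := Runs.denote (P := seqs [.load Rm 0 Rzero, .const Rone 1])
    ⟨trivial, trivial, trivial⟩ (initial F.encode k)
  have he₁ : (seqs [.load Rm 0 Rzero, .const Rone 1]).denote (initial F.encode k) =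
      ((initial F.encode k).setReg Rm F.1.length).setReg Rone 1 := by
    have : (initial F.encode k).reg Rzero = 0 := rfl
    simp [seqs, Prog.denote, this, hin.1]
  rw [he₁] at hrun₁
  set s₁ := ((initial F.encode k).setReg Rm F.1.length).setReg Rone 1 with hs₁
  have h0₁ : s₁.reg 0 = k := by simp [hs₁, initial]
  have hz₁ : s₁.reg Rzero = 0 := by simp [hs₁, initial]
  have hm₁ : s₁.reg Rm = F.1.length := by simp [hs₁]
  by_cases hk : F.1.length < k
  · refine ⟨_, emptyRCNF r, (hrun₁.seq (Runs.ite_pos (by rwa [hm₁, h0₁])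
      (Runs.denote (P := seqs [.const 0 1, .store o Rzero Rzero])
        ⟨trivial, trivial, trivial⟩ s₁))).mono ?_, ?_, ?_, ?_, ?_, ?_⟩
    · simp only [Prog.cost, seqs]
      nlinarith
    · simp [seqs, Prog.denote, hz₁, emptyRCNF_encode, Mem]
    · simp [seqs, Prog.denote, hz₁]
    · simp [seqs, Prog.denote, hs₁]
    · intro A hA
      have : A ≠ o := fun h => hA (by simp [h])
      simp [seqs, Prog.denote, hs₁, this]
    · simpa [seqs, Prog.denote] using isKernel_of_length_lt hk
  have hrun₂ := Runs.denote (P := setup r) ⟨trivial, trivial, trivial, trivial, trivial⟩ s₁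
  set s₂ := (setup r).denote s₁ with hs₂
  have he₂ : s₂ = (((s₁.setReg Rstride (2 * r + 1)).setReg Rnc 2).setReg Rq 1).setReg Rnn 1 := rfl
  have ha₂ : s₂.arr = (initial F.encode k).arr := by simp [he₂, hs₁]
  have hready : Ready r F.1 0 s₂ := ⟨by simp [he₂, hz₁], by simp [he₂, hs₁], by simp [he₂, hm₁],
    by simp [he₂], by rw [ha₂]; exact hin.2⟩
  obtain ⟨s₃, hrun₃, hk₃, hcode⟩ := runs_codePass (fun C hC => (F.2 C hC).1) hready
    (by rw [ha₂]; rfl) (by simp [he₂])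
  have hready₃ := hready.keep hk₃ (by simp) (by simp)
  obtain ⟨s₄, hrun₄, hk₄, hcnt⟩ := runs_countPass F.2 hready₃
    (by rw [hk₃.2 3 (by simp), ha₂]; rfl)
  have hready₄ := hready₃.keep hk₄ (by simp) (by simp)
  have h2₄ : s₄.arr 2 = s₃.arr 2 := hk₄.2 2 (by simp)
  have hreg₄ : ∀ y < 16, y ∉ [Ri, Rp, Rnc] → s₄.reg y = s₂.reg y := fun y hy hy' => by
    rw [hk₄.1 y hy (by simp_all), hk₃.1 y hy hy']
  obtain ⟨s₅, hrun₅, hinv⟩ := runs_emitPass F ho hready₄ (by rw [hcnt, h2₄])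
    (by rw [hk₄.2 4 (by simp), hk₃.2 4 (by simp), ha₂]; rfl)
    (by rw [hreg₄ _ (by omega) (by simp)]; simp [he₂])
    (by rw [hreg₄ _ (by omega) (by simp)]; simp [he₂, hs₁, initial])
    (by rw [hreg₄ _ (by omega) (by simp)]; simp [he₂])
  have hready₅ := hready₄.keep hinv.keep (by simp) (by simp [ho0.symm])
  obtain ⟨s₆, hrun₆, hk₆, hb₆⟩ := runs_squareProg hready₅.one
  have hready₆ := hready₅.keep hk₆ (by simp) (by simp)
  have h0₅ : s₅.reg 0 = k := by
    rw [hinv.keep.1 0 (by omega) (by simp), hreg₄ _ (by omega) (by simp)]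
    simpa [he₂] using h0₁
  have h0₆ : s₆.reg 0 = k := by rw [hk₆.1 _ (by omega) (by simp), h0₅]
  rw [h0₅] at hrun₆ hb₆
  have hrun₇ := Runs.denote (loopFree_finish o r) s₆
  have hrun := hrun₁.seq (Runs.ite_neg (a := Rm) (b := 0)
    (P := seqs [.const 0 1, .store o Rzero Rzero])
    (by rwa [hm₁, h0₁]) (hrun₂.seq (hrun₃.seq (hrun₄.seq (hrun₅.seq (hrun₆.seq hrun₇))))))
  have hrun := hrun.mono (T' := (20 + codeCost r + countCost r + emitCost o r +
      (finish o r).cost) * (F.1.length + 1)) (by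
    simp only [seqs, setup, Prog.cost]
    have : (finish o r).cost ≤ (finish o r).cost * (F.1.length + 1) := Nat.le_mul_of_pos_right _
      (by omega)
    nlinarith)
  have hcode' := isCode_names F.1
  rw [← hcode] at hcode'
  rw [h2₄] at hinv
  set code := s₃.arr 2
  set E := survivors code r F.1 with hE
  have hw₆ : s₆.reg Rw = E.length := by rw [hk₆.1 _ (by omega) (by simp)]; exact hinv.weight
  have harr : ∀ A, A ∉ [2, 3, 4, o] → s₆.arr A = (initial F.encode k).arr A := fun A hA => by
    simp only [List.mem_cons, List.not_mem_nil, or_false, not_or] at hA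
    rw [hk₆.2 _ (by simp), hinv.keep.2 _ (by simp [hA]), hk₄.2 _ (by simp [hA]),
      hk₃.2 _ (by simp [hA]), ha₂]
  have hbound : 2 ^ (6 * r + 2) * (k * k) = 4 * 64 ^ r * k ^ 2 := by
    rw [pow_add, pow_mul]
    norm_num
    ring
  have he₇ : (finish o r).denote s₆ = if 4 * 64 ^ r * k ^ 2 < E.length then
      ((s₆.setReg Rbound (4 * 64 ^ r * k ^ 2)).setReg 0 0).setArr o 0 0 else
      (((s₆.setReg Rbound (4 * 64 ^ r * k ^ 2)).setReg Rw (2 ^ (r - 1) * E.length)).setArr o 0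
        (2 ^ (r - 1) * E.length)).setReg 0 (2 ^ (r - 1) * k) := by
    simp only [finish, seqs, Prog.denote, denote_doubles, hb₆, hbound]
    simp [hw₆, hready₆.zero, h0₆]
  set s₇ := (finish o r).denote s₆
  by_cases hlt : 4 * 64 ^ r * k ^ 2 < E.length
  · rw [if_pos hlt] at he₇
    refine ⟨s₇, emptyRCNF r, hrun, ?_, ?_, ?_, ?_, ?_⟩
    · simp [he₇, emptyRCNF_encode, Mem]
    · simp [he₇, hready₆.zero]
    · simp [he₇, hready₆.one]
    · intro A hA
      have : A ≠ o := fun h => hA (by simp [h])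
      simp [he₇, this, harr A hA]
    · simpa [he₇] using isKernel_of_yes (maxSat_yes_of_length_survivors hcode' hlt)
  · rw [if_neg hlt] at he₇
    set ρ := (occNames E).1 with hρdef
    have hρ : Set.InjOn ρ {v | v ∈ E.flatMap fun o => o.1.map Prod.fst} := (occNames_spec E).1
    let G : RCNF r := ⟨kernelClauses code ρ r F.1, kernelClauses_valid hρ⟩
    have hG : G.1.length = 2 ^ (r - 1) * E.length := length_kernelClauses
    have hmemE : ∀ o ∈ E, o ∈ occs r F.1 := fun o => mem_occs_of_mem_survivors
    refine ⟨s₇, G, hrun, ?_, ?_, ?_, ?_, ?_, ?_, ?_, ?_, ?_⟩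
    · have ho₆ : s₆.arr o = putWords (s₄.arr o) 1 (fWords G.1) := by
        rw [hk₆.2 _ (by simp)]
        exact hinv.out
      rw [encode_eq, he₇, Mem, hG]
      simp only [setReg_arr, setArr_arr, if_true, Function.update_self, true_and, zero_add]
      rw [mem_update_of_lt one_pos, ho₆]
      exact mem_putWords _ _ _
    · simp [he₇, hready₆.zero]
    · simp [he₇, hready₆.one]
    · intro A hA
      have : A ≠ o := fun h => hA (by simp [h])
      simp [he₇, this, harr A hA]
    · have : s₇.reg 0 = 2 ^ (r - 1) * k := by simp [he₇]
      rw [this]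
      exact kernelClauses_yes_iff hcode' hρ rfl k
    · have : s₇.reg 0 = 2 ^ (r - 1) * k := by simp [he₇]
      rw [this]
      have : 2 ^ (r - 1) * k ≤ 2 ^ r * k :=
        Nat.mul_le_mul_right _ (Nat.pow_le_pow_right (by norm_num) (by omega))
      omega
    · rw [hG]
      exact Nat.mul_le_mul_left _
        ((length_survivors_le_length_occs _ _ _).trans (length_occs_le _ _))
    · rw [hG]
      exact Nat.mul_le_mul_left _ (by omega)
    · intro C hC l hl
      obtain ⟨D, hD, rfl⟩ := List.mem_map.1 hC
      obtain ⟨l', hl', rfl⟩ := List.mem_map.1 hl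
      obtain ⟨p, hp, hDp⟩ := List.mem_flatMap.1 hD
      have hv : l'.1 ∈ occVars E := List.mem_flatMap.2 ⟨p, hp, by
        rw [← vars_of_mem_gadget (hmemE p hp) hDp]
        exact List.mem_map.2 ⟨l', hl', rfl⟩⟩
      have hlen : (occVars E).length = r * E.length := by
        rw [occVars, List.length_flatMap, List.map_congr_left (g := fun _ => r)
          fun p hp => by rw [List.length_map, (F.2 _ (mem_occs.1 (hmemE p hp)).1).1]]
        simp [mul_comm]
      refine ((occNames_spec E).2 _ hv).2.trans ?_
      rw [hlen, hG]
      exact Nat.mul_le_mul_left _ (Nat.le_mul_of_pos_left _ (by positivity))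


/-! ### Linear equations from clauses -/

/-- The linear equation which holds if and only if an odd number of the literals selected by a mask
is true. -/
def linEq (o : Occ) : LinEq where
  vars := ((o.1.zip o.2).filter fun p => p.2).map fun p => p.1.1
  rhs := ((1 + o.2.count true + (o.1.zip o.2).countP fun p => p.2 && p.1.2 : ℕ) : ZMod 2)
  weight := 1

/-- The words that encode a list of equations. -/
def eqWords (E : List LinEq) : List ℕ :=
  E.flatMap fun e => e.vars.length :: (e.vars ++ [e.rhs.val, e.weight])

theorem length_linEq_vars {o : Occ} (h : o.2.length = o.1.length) :
    (linEq o).vars.length = o.2.count true := by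
  obtain ⟨C, μ⟩ := o
  simp only [linEq, List.length_map] at *
  induction μ generalizing C with
  | nil => simp
  | cons b μ ih =>
    obtain _ | ⟨l, C⟩ := C
    · simp at h
    have := ih C (by simpa using h)
    cases b <;> simp [this]

theorem nodup_linEq_vars {o : Occ} (h : o.2.length = o.1.length)
    (hn : (o.1.map Prod.fst).Nodup) : (linEq o).vars.Nodup := by
  rw [← map_zip_fst (fun l : Literal => l.1) h] at hn
  exact hn.sublist (List.filter_sublist.map _)

/-- The sign of an element of the field with two elements. -/
def zsign (a : ZMod 2) : ℤ := if a = 0 then 1 else -1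

theorem zsign_add (a b : ZMod 2) : zsign (a + b) = zsign a * zsign b := by
  revert a b
  decide

/-- The negated monomial has the value `1` if the equation holds and `-1` otherwise. -/
theorem occVal_boolSign (z : ℕ → ZMod 2) {o : Occ} (h : o.2.length = o.1.length) :
    occVal (boolSign fun v => z v = 1) o = if ((linEq o).vars.map z).sum = (linEq o).rhs
      then -1 else 1 := by
  have key : occVal (boolSign fun v => z v = 1) o = zsign (((linEq o).vars.map z).sum +
      ((o.2.count true + (o.1.zip o.2).countP fun p => p.2 && p.1.2 : ℕ) : ZMod 2)) := by
    obtain ⟨C, μ⟩ := o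
    simp only [linEq, occVal] at *
    induction μ generalizing C with
    | nil => simp [maskProd, zsign]
    | cons b μ ih =>
      obtain _ | ⟨⟨v, c⟩, C⟩ := C
      · simp at h
      have ih := ih C (by simpa using h)
      cases b with
      | false => simpa [maskProd] using ih
      | true =>
        have hl : litVal (boolSign fun v => z v = 1) (v, c) = zsign (z v + 1 + c.toNat) := by
          simp only [litVal, boolSign, decide_eq_true_eq]
          have : ∀ (c : Bool) (a : ZMod 2), ((if c = true then -1 else 1) *
              if a = 1 then 1 else -1) = zsign (a + 1 + c.toNat) := by decide
          exact this c (z v)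
        have e : maskProd (litVal (boolSign fun v => z v = 1)) (((v, c), true) :: C.zip μ) =
            litVal (boolSign fun v => z v = 1) (v, c) *
              maskProd (litVal (boolSign fun v => z v = 1)) (C.zip μ) := by simp [maskProd]
        rw [List.zip_cons_cons, e, ih, hl, ← zsign_add]
        congr 1
        cases c <;> simp <;> ring
  have hr : (linEq o).rhs = 1 + ((o.2.count true + (o.1.zip o.2).countP fun p => p.2 && p.1.2 : ℕ)
      : ZMod 2) := by
    simp only [linEq]
    push_cast
    ring
  rw [key, hr]
  generalize ((linEq o).vars.map z).sum = a
  generalize ((o.2.count true + (o.1.zip o.2).countP fun p => p.2 && p.1.2 : ℕ) : ZMod 2) = b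
  revert a b
  decide

/-- The system that consists of an equation for each monomial of each clause. -/
def toLin {r : ℕ} (F : RCNF r) : LinSystem r :=
  ⟨(occs r F.1).map linEq, fun e he => by
    obtain ⟨o, ho, rfl⟩ := List.mem_map.1 he
    obtain ⟨h1, h2⟩ := mem_occs.1 ho
    obtain ⟨hl, hn⟩ := F.2 _ h1
    have hμ := (length_of_mem_nzMasks h2).trans hl.symm
    refine ⟨nodup_linEq_vars hμ hn, ?_, one_pos⟩
    rw [length_linEq_vars hμ]
    exact List.count_le_length.trans (length_of_mem_nzMasks h2).le⟩

theorem encode_toLin {r : ℕ} (F : RCNF r) :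
    (toLin F).encode = ((occs r F.1).map linEq).length :: eqWords ((occs r F.1).map linEq) := rfl

theorem totalWeight_toLin {r : ℕ} (F : RCNF r) : (toLin F).totalWeight = (occs r F.1).length := by
  simp [LinSystem.totalWeight, toLin, Function.comp_def, linEq]

/-- Each equation of weight `1` contributes to `2 * satWeight - totalWeight` the value of its
negated monomial, and these add up to the polynomial. -/
theorem toLin_yes_iff {r : ℕ} (F : RCNF r) (k : ℕ) :
    (maxLin r).Yes (toLin F) k ↔ (maxSat r).Yes F k := by
  have key : ∀ z : ℕ → ZMod 2, ((((toLin F).totalWeight : ℚ) + (k : ℚ)) / 2 ≤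
      ((toLin F).satWeight z : ℚ) ↔ (k : ℤ) ≤ polyVal (boolSign fun v => z v = 1) F.1) := by
    intro z
    have h : ∀ L : List Occ, (∀ o ∈ L, o ∈ occs r F.1) →
        -(L.map (occVal (boolSign fun v => z v = 1))).sum =
        2 * ((((L.map linEq).filter fun e => (e.vars.map z).sum = e.rhs).map LinEq.weight).sum : ℤ)
          - L.length := by
      intro L hL
      induction L with
      | nil => simp
      | cons o L ih =>
        have ih := ih fun p hp => hL p (by simp [hp])
        obtain ⟨h1, h2⟩ := mem_occs.1 (hL o (by simp))
        have ho := occVal_boolSign z (o := o)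
          ((length_of_mem_nzMasks h2).trans (F.2 _ h1).1.symm)
        simp only [List.map_cons, List.sum_cons, List.filter_cons, ho, List.length_cons]
        by_cases hs : ((linEq o).vars.map z).sum = (linEq o).rhs
        · simp only [hs, if_true, decide_true, List.map_cons, List.sum_cons]
          rw [show (linEq o).weight = 1 from rfl, Nat.cast_add, Nat.cast_add, Nat.cast_one]
          linarith
        · simp only [hs, if_false, decide_false, Bool.false_eq_true]
          rw [Nat.cast_add, Nat.cast_one]
          linarith
    have h' := h (occs r F.1) fun _ h => h
    rw [polyVal_eq_sum_occs _ fun C hC => (F.2 C hC).1, h', totalWeight_toLin,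
      div_le_iff₀ two_pos]
    have e : (toLin F).satWeight z = ((((occs r F.1).map linEq).filter fun e =>
        (e.vars.map z).sum = e.rhs).map LinEq.weight).sum := rfl
    rw [← e, ← Int.cast_le (R := ℚ)]
    push_cast
    constructor <;> intro H <;> linarith
  rw [maxSat_yes_iff]
  constructor
  · rintro ⟨z, hz⟩
    exact ⟨_, (key z).1 hz⟩
  · rintro ⟨τ, hτ⟩
    refine ⟨fun v => if τ v then 1 else 0, (key _).2 ?_⟩
    have : (fun v => decide ((if τ v = true then 1 else 0 : ZMod 2) = 1)) = τ := by
      funext v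
      cases τ v <;> decide
    rwa [this]

/-- Write the variable of a literal that is selected for the equation if `b` is true, and add its
sign to the parity. -/
def linStep (b : Bool) : Prog :=
  if b then seqs [emitReg 1 Rv, .sub Rt Rpar Rsign, .sub Ru Rsign Rpar, .add Rpar Rt Ru] else .skip

/-- Write the equation given by `μ` and the current clause. -/
def linBlock (μ : List Bool) : Prog :=
  seqs [.const Rt (μ.count true), emitReg 1 Rt, .const Rpar ((1 + μ.count true) % 2),
    .add Rlit Rp Rone, forLits 5 linStep μ, emitReg 1 Rpar, emitReg 1 Rone]

theorem loopFree_linBlock (μ : List Bool) : (linBlock μ).LoopFree := by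
  simp only [linBlock, emitReg, seqs, Prog.LoopFree, and_true, true_and]
  exact loopFree_forLits _
    (fun b => by cases b <;> simp [linStep, seqs, emitReg, Prog.LoopFree]) _

theorem denote_linBlock {C : List Literal} {μ : List Bool} {s : Config}
    (hC : Mem (s.arr 5) (s.reg Rp) (C.length :: litWords C)) (hμ : μ.length = C.length)
    (h1 : s.reg Rone = 1) {s' : Config} {w : List ℕ} (hs : Same (s.emit 1 w) s') :
    Same (s.emit 1 (w ++ eqWords [linEq (C, μ)])) ((linBlock μ).denote s') := by
  have h1s : ∀ {s' : Config} {w : List ℕ}, Same (s.emit 1 w) s' → s'.reg Rone = 1 := fun h => by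
    rw [h.2 _ (by omega), emit_reg_of_ne _ _ _ (by omega), h1]
  set s₁ := (emitReg 1 Rt).denote (s'.setReg Rt (μ.count true)) with hs₁
  have hw₁ : Same (s.emit 1 (w ++ [μ.count true])) s₁ :=
    denote_emitReg (hs.setReg _ (by omega)) h1 (by simp)
  set s₂ := (s₁.setReg Rpar ((1 + μ.count true) % 2)).setReg Rlit (s.reg Rp + 1) with hs₂
  have key := denote_forLits (a := 5) (body := linStep) (s.arr 5)
    (fun D s' => Same (s.emit 1 (w ++ μ.count true :: (D.filter fun p => p.2).map fun p => p.1.1))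
        s' ∧
      s'.reg Rpar = (1 + μ.count true + D.countP fun p => p.2 && p.1.2) % 2)
    (by
      rintro D s' ⟨h, -⟩
      exact ⟨by rw [h.1, emit_arr_of_ne _ _ (by omega)], h1s h⟩)
    (by
      rintro D s' x v hx hx' ⟨h, h'⟩
      refine ⟨h.setReg v (by omega), ?_⟩
      rwa [setReg_reg, if_neg (by omega)])
    (by
      rintro D s' ⟨v, c⟩ b ⟨h, hp⟩ hv hsg
      cases b with
      | false => simpa [linStep, Prog.denote, hp] using h
      | true =>
        have h2 := denote_emitReg (a := Rv) (v := v) h h1 hv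
        set s₃ := (emitReg 1 Rv).denote s' with hs₃
        have hp₃ : s₃.reg Rpar = (1 + μ.count true + D.countP fun p => p.2 && p.1.2) % 2 := by
          rw [hs₃, emitReg_reg (by omega), hp]
        have hsg₃ : s₃.reg Rsign = c.toNat := by
          rw [hs₃, emitReg_reg (by omega)]
          exact hsg
        have hl₃ : s₃.reg Rlit = s'.reg Rlit := by rw [hs₃, emitReg_reg (by omega)]
        have e : (linStep true).denote s' = ((s₃.setReg Rt (s₃.reg Rpar - s₃.reg Rsign)).setReg Ru
            (s₃.reg Rsign - s₃.reg Rpar)).setReg Rpar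
            (s₃.reg Rpar - s₃.reg Rsign + (s₃.reg Rsign - s₃.reg Rpar)) := by
          simp [linStep, seqs, Prog.denote, ← hs₃]
        rw [e]
        refine ⟨⟨?_, ?_⟩, by simp [hl₃]⟩
        · refine ((Same.setReg ?_ _ (by omega)).setReg _ (by omega)).setReg _ (by omega)
          simpa using h2
        · simp [hp₃, hsg₃, List.countP_append]
          cases c
          · simp
          · simp
            omega)
    C μ hμ [] s₂
    ⟨by simpa using (hw₁.setReg _ (by omega)).setReg _ (by omega), by simp [hs₂]⟩
    (by simpa [hs₂] using hC.2)
  obtain ⟨k1, k2⟩ := key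
  set s₃ := (forLits 5 linStep μ).denote s₂ with hs₃
  have h4 := denote_emitReg (a := Rpar) k1 h1 k2
  have h5 := denote_emitReg (a := Rone) h4 h1 (h1s h4)
  have e : (linBlock μ).denote s' =
      (emitReg 1 Rone).denote ((emitReg 1 Rpar).denote s₃) := by
    have hp : s₁.reg Rp = s.reg Rp := by
      rw [hw₁.2 _ (by omega), emit_reg_of_ne _ _ _ (by omega)]
    simp [linBlock, seqs, Prog.denote, hs₃, hs₂, h1s hw₁, ← hs₁, hp]
  rw [e]
  have hl := length_linEq_vars (o := (C, μ)) hμ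
  simp only [eqWords, List.flatMap_cons, List.flatMap_nil, List.append_nil, hl]
  simp only [linEq, ZMod.val_natCast]
  simpa using h5

/-- Transform the formula in array `5` to a system of equations in array `1`. -/
def linProg (r : ℕ) : Prog :=
  .seq (seqs [.load Rm 5 Rzero, .const Rstride (2 * r + 1), .const Rq 1])
    (.seq (forClauses (seqs ((nzMasks r).map linBlock)))
      (seqs [.add Rw Rm Rzero, doubles r Rw, .sub Rw Rw Rm, .store 1 Rzero Rw]))

theorem runs_linProg (r : ℕ) :
    ∃ c, ∀ (F : RCNF r) (s₀ : Config), Mem (s₀.arr 5) 0 F.encode → s₀.reg Rzero = 0 →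
      s₀.reg Rone = 1 → ∃ s, Runs (linProg r) s₀ s (c * (F.1.length + 1)) ∧
        Mem (s.arr 1) 0 (toLin F).encode ∧ s.reg 0 = s₀.reg 0 := by
  set P := seqs [.add Rw Rm Rzero, doubles r Rw, .sub Rw Rw Rm, .store 1 Rzero Rw] with hP
  refine ⟨4 + (Prog.cost (seqs ((nzMasks r).map linBlock)) + 8) + P.cost, fun F s₀ hin hz h1 => ?_⟩
  rw [encode_eq] at hin
  have hrun₁ := Runs.denote (P := seqs [.load Rm 5 Rzero, .const Rstride (2 * r + 1),
    .const Rq 1]) ⟨trivial, trivial, trivial, trivial⟩ s₀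
  have he₁ : (seqs [.load Rm 5 Rzero, .const Rstride (2 * r + 1),
      .const Rq 1]).denote s₀ =
      ((s₀.setReg Rm F.1.length).setReg Rstride (2 * r + 1)).setReg Rq 1 := by
    simp [seqs, Prog.denote, hz, hin.1]
  rw [he₁] at hrun₁
  set s₁ := ((s₀.setReg Rm F.1.length).setReg Rstride (2 * r + 1)).setReg Rq 1 with hs₁
  have hready : Ready r F.1 5 s₁ := ⟨by simp [hs₁, hz], by simp [hs₁, h1], by simp [hs₁],
    by simp [hs₁], by simpa [hs₁] using hin.2⟩
  obtain ⟨s₂, hrun₂, hk, ha, -⟩ := Runs.forClauses (L := F.1) (n := 2 * r + 1)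
    (body := seqs ((nzMasks r).map linBlock))
    (loopFree_seqs fun P hP => by
      obtain ⟨μ, -, rfl⟩ := List.mem_map.1 hP
      exact loopFree_linBlock μ)
    (fun d s => Keep [Ri, Rp, Rq] [1] s₁ s ∧
      s.arr 1 = putWords (s₁.arr 1) 1 (eqWords ((occs r d).map linEq)) ∧
      s.reg Rq = 1 + (eqWords ((occs r d).map linEq)).length)
    (by
      rintro d s ⟨h, -⟩
      have := hready.keep h (by simp) (by simp)
      exact ⟨this.one, this.num, this.stride⟩)
    (by
      rintro d s x v (rfl | rfl) ⟨h, h'⟩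
      · exact ⟨h.setReg _ (.inr (by simp)), by simpa using h'⟩
      · exact ⟨h.setReg _ (.inr (by simp)), by simpa using h'⟩)
    (by
      rintro d C d' hF s ⟨h, ha, hq⟩ hp
      have hs' := hready.keep h (by simp) (by simp)
      rw [hF] at hs'
      have hC := hs'.clause (fun D hD => (F.2 D (by simp [hF, hD])).1) hp
      have hl := (F.2 C (by simp [hF])).1
      have key := denote_seqs_map (P := linBlock)
        (I := fun (L : List Occ) s' => Same (s.emit 1 (eqWords (L.map linEq))) s')
        (f := fun L μ => L ++ [(C, μ)]) (l := nzMasks r)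
        (by
          intro μ hμ L s₁ h₁
          have := denote_linBlock hC ((length_of_mem_nzMasks hμ).trans hl.symm) hs'.one h₁
          simpa [eqWords] using this)
        [] s (same_emit_nil s 1)
      rw [foldl_append_singleton, List.nil_append] at key
      have hi : ∀ y, y < 16 → y ≠ Rq → ((seqs ((nzMasks r).map linBlock)).denote s).reg y =
          s.reg y := fun y hy hy' => by rw [key.2 y hy, emit_reg_of_ne _ _ _ hy']
      refine ⟨⟨Keep.same ?_ key, ?_, ?_⟩, hi _ (by omega) (by omega), hi _ (by omega) (by omega)⟩
      · exact (h.putArr _ (by simp)).setReg _ (.inr (by simp))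
      · rw [key.1, occs_append_singleton, List.map_append]
        simp only [Config.emit, setReg_arr, putArr_arr, if_true, ha, hq]
        rw [← putWords_append]
        simp [eqWords]
      · rw [key.2 _ (by omega), occs_append_singleton, List.map_append]
        simp only [Config.emit, setReg_reg, if_true, hq]
        simp [eqWords, add_assoc])
    s₁ ⟨Keep.refl _ _ _, by simp [occs, eqWords, putWords], by simp [hs₁, occs, eqWords]⟩
  have hready₂ := hready.keep hk (by simp) (by simp)
  have hrun₃ := Runs.denote (P := P)
    ⟨trivial, loopFree_doubles _ _, trivial, trivial, trivial⟩ s₂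
  refine ⟨_, (hrun₁.seq (hrun₂.seq hrun₃)).mono ?_, ?_, ?_⟩
  · simp only [seqs, Prog.cost]
    have : P.cost ≤ P.cost * (F.1.length + 1) := Nat.le_mul_of_pos_right _ (by omega)
    nlinarith
  · have hlen : 2 ^ r * F.1.length - F.1.length = (occs r F.1).length := by
      have := length_occs r F.1
      omega
    have he : (P.denote s₂).arr 1 = Function.update (s₂.arr 1) 0 (occs r F.1).length := by
      simp [hP, seqs, Prog.denote, denote_doubles, hready₂.zero, hready₂.num, hlen]
    rw [encode_toLin, Mem, List.length_map, he, Function.update_self, mem_update_of_lt (by omega),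
      ha]
    exact ⟨rfl, mem_putWords _ _ _⟩
  · have : s₂.reg 0 = s₀.reg 0 := by
      rw [hk.1 _ (by omega) (by simp)]
      simp [hs₁]
    simp [hP, seqs, Prog.denote, denote_doubles, this]


/-! ### Exhaustive search -/

/-- register of the answer -/
notation "Rans" => 13

/-- The number with the binary digits `Z 0, ..., Z (M - 1)`. -/
def binVal (M : ℕ) (Z : ℕ → ℕ) : ℕ := ∑ i ∈ Finset.range M, Z i * 2 ^ i

theorem binVal_lt {Z : ℕ → ℕ} (hZ : ∀ v, Z v < 2) (M : ℕ) : binVal M Z < 2 ^ M := by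
  induction M with
  | zero => simp [binVal]
  | succ M ih =>
    rw [binVal, Finset.sum_range_succ, pow_succ]
    have : Z M * 2 ^ M ≤ 1 * 2 ^ M := Nat.mul_le_mul_right _ (by have := hZ M; omega)
    rw [binVal] at ih
    omega

theorem binVal_inj {Z Z' : ℕ → ℕ} (hZ : ∀ v, Z v < 2) (hZ' : ∀ v, Z' v < 2) {M : ℕ}
    (h : binVal M Z = binVal M Z') : ∀ v < M, Z v = Z' v := by
  induction M with
  | zero => simp
  | succ M ih =>
    have h1 := binVal_lt hZ M
    have h2 := binVal_lt hZ' M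
    have h3 : binVal M Z + Z M * 2 ^ M = binVal M Z' + Z' M * 2 ^ M := by
      simpa [binVal, Finset.sum_range_succ] using h
    have hM : Z M = Z' M := by
      have := hZ M
      have := hZ' M
      obtain e | e : Z M = 0 ∨ Z M = 1 := by omega
      all_goals
        obtain e' | e' : Z' M = 0 ∨ Z' M = 1 := by omega
        all_goals
          rw [e, e'] at h3 ⊢
          try omega
    intro v hv
    obtain hv | rfl : v < M ∨ v = M := by omega
    · exact ih (by rw [hM] at h3; omega) v hv
    · exact hM

theorem binVal_update {M q : ℕ} (Z : ℕ → ℕ) (x : ℕ) (hq : q < M) :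
    binVal M (Function.update Z q x) + Z q * 2 ^ q = binVal M Z + x * 2 ^ q := by
  have hm : q ∈ Finset.range M := Finset.mem_range.2 hq
  have h : ∑ i ∈ (Finset.range M).erase q, Function.update Z q x i * 2 ^ i =
      ∑ i ∈ (Finset.range M).erase q, Z i * 2 ^ i :=
    Finset.sum_congr rfl fun i hi => by rw [Function.update_of_ne (Finset.ne_of_mem_erase hi)]
  rw [binVal, binVal, ← Finset.add_sum_erase _ _ hm, ← Finset.add_sum_erase _ (fun i => Z i * 2 ^ i)
    hm, h, Function.update_self]
  ring

/-- Increase the binary number in array `6` by one. -/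
def incrProg : Prog :=
  seqs [.const Rq 0, .load Rt 6 Rq,
    .while Rzero Rt (seqs [.store 6 Rq Rzero, .add Rq Rq Rone, .load Rt 6 Rq]), .store 6 Rq Rone]

theorem runs_incrProg {N n : ℕ} {s₀ : Config} (hz : s₀.reg Rzero = 0) (h1 : s₀.reg Rone = 1)
    (hZ : ∀ v, s₀.arr 6 v < 2) (hn : binVal (N + 1) (s₀.arr 6) = n) (hnN : n < 2 ^ N) :
    ∃ s, Runs incrProg s₀ s (5 * N + 10) ∧ Keep [Rq] [6] s₀ s ∧ (∀ v, s.arr 6 v < 2) ∧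
      binVal (N + 1) (s.arr 6) = n + 1 := by
  have hpow : ∀ {q m : ℕ}, m + 2 ^ q = n + 1 → q < N + 1 := fun {q m} h => by
    have : 2 ^ q ≤ 2 ^ N := by omega
    have := (Nat.pow_le_pow_iff_right (a := 2) (by norm_num)).1 this
    omega
  obtain ⟨s, h, ⟨hk, hb, hv, ht⟩, hend⟩ := Runs.while_of_measure (a := Rzero) (b := Rt)
    (P := seqs [.store 6 Rq Rzero, .add Rq Rq Rone, .load Rt 6 Rq]) (T := 4)
    (fun s => Keep [Rq] [6] s₀ s ∧ (∀ v, s.arr 6 v < 2) ∧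
      binVal (N + 1) (s.arr 6) + 2 ^ s.reg Rq = n + 1 ∧ s.reg Rt = s.arr 6 (s.reg Rq))
    (fun s => N + 1 - s.reg Rq)
    (by
      rintro s ⟨hk, hb, hv, ht⟩ hlt
      have hzs : s.reg Rzero = 0 := by rw [hk.1 _ (by omega) (by simp), hz]
      have h1s : s.reg Rone = 1 := by rw [hk.1 _ (by omega) (by simp), h1]
      have hq := hpow hv
      have hone : s.arr 6 (s.reg Rq) = 1 := by
        have := hb (s.reg Rq)
        omega
      have hup := binVal_update (s.arr 6) 0 hq
      refine ⟨_, Runs.denote (P := seqs [.store 6 Rq Rzero, .add Rq Rq Rone, .load Rt 6 Rq])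
        ⟨trivial, trivial, trivial, trivial⟩ s, ⟨?_, ?_, ?_, ?_⟩, ?_⟩
      · exact ((hk.setArr _ _ (by simp)).setReg _ (.inr (by simp))).setReg _ (.inl (by omega))
      · intro v
        have := hb v
        simp only [seqs, Prog.denote, setReg_arr, setArr_arr, if_true, Function.update_apply, hzs]
        split_ifs <;> omega
      · have e : ∀ x y : ℕ, (((s.setArr 6 (s.reg Rq) 0).setReg Rq x).setReg Rt y).reg Rq = x :=
          fun x y => by simp
        simp only [seqs, Prog.denote, setReg_arr, setArr_arr, if_true, hzs, e, setArr_reg, h1s,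
          pow_succ]
        rw [hone] at hup
        omega
      · simp [seqs, Prog.denote]
      · simp only [seqs, Prog.denote, setReg_reg, setArr_reg, h1s]
        simp
        omega)
    ((s₀.setReg Rq 0).setReg Rt (s₀.arr 6 0))
    ⟨((Keep.refl _ _ _).setReg _ (.inr (by simp))).setReg _ (.inl (by omega)), by simpa using hZ,
      by simp [hn], by simp⟩
  have hzs : s.reg Rzero = 0 := by rw [hk.1 _ (by omega) (by simp), hz]
  have h1s : s.reg Rone = 1 := by rw [hk.1 _ (by omega) (by simp), h1]
  refine ⟨s.setArr 6 (s.reg Rq) 1, ?_, hk.setArr _ _ (by simp), ?_, ?_⟩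
  · have hr := (Runs.denote (P := .const Rq 0) trivial s₀).seq
      ((Runs.denote (P := .load Rt 6 Rq) trivial _).seq
        (Runs.seq h ((Runs.denote (P := .store 6 Rq Rone) trivial s).seq
          (Runs.denote (P := .skip) trivial _))))
    have e : (Prog.store 6 Rq Rone).denote s = s.setArr 6 (s.reg Rq) 1 := by
      simp [Prog.denote, h1s]
    rw [e] at hr
    refine hr.mono ?_
    simp only [Prog.cost, setReg_reg]
    simp
    omega
  · intro v
    have := hb v
    simp only [setArr_arr, if_true, Function.update_apply]
    split_ifs <;> omega
  · have hup := binVal_update (s.arr 6) 1 (hpow hv)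
    have : s.arr 6 (s.reg Rq) = 0 := by omega
    simp only [setArr_arr, if_true]
    rw [this] at hup
    omega

/-- Set the flag `Rkey` if the literal is true under the assignment in array `6`. -/
def testLit : Prog :=
  seqs [.load Ru 6 Rv, .sub Rt Ru Rsign, .sub Ru Rsign Ru, .add Rt Rt Ru,
    .ite Rt Rone (.const Rkey 1) .skip]

/-- Count the current clause if it is not satisfied by the assignment in array `6`. -/
def evalBlock (r : ℕ) : Prog :=
  seqs [.add Rlit Rp Rone, .const Rkey 0, forLits 5 (fun _ => testLit) (List.replicate r false),
    .ite Rzero Rkey .skip (.add Rw Rw Rone)]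

theorem loopFree_evalBlock (r : ℕ) : (evalBlock r).LoopFree := by
  simp only [evalBlock, seqs, Prog.LoopFree, and_true, true_and]
  exact loopFree_forLits _ (fun _ => by simp [testLit, seqs, Prog.LoopFree]) _

/-- The truth assignment given by an array. -/
def ofArray (Z : ℕ → ℕ) (v : ℕ) : Bool := Z v = 1

theorem satClause_congr {τ τ' : ℕ → Bool} {C : List Literal} (h : ∀ l ∈ C, τ l.1 = τ' l.1) :
    satClause τ C = satClause τ' C := by
  induction C with
  | nil => rfl
  | cons l C ih =>
    rw [satClause, satClause, List.any_cons, List.any_cons, h l (by simp)]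
    congr 1
    exact ih fun l' hl' => h l' (by simp [hl'])

theorem denote_evalBlock {r : ℕ} {C : List Literal} {s : Config} (hz : s.reg Rzero = 0)
    (h1 : s.reg Rone = 1) (hZ : ∀ v, s.arr 6 v < 2)
    (hC : Mem (s.arr 5) (s.reg Rp) (C.length :: litWords C)) (hl : C.length = r) :
    Same (s.setReg Rw (s.reg Rw + if satClause (ofArray (s.arr 6)) C then 0 else 1))
      ((evalBlock r).denote s) := by
  have key := denote_forLits (a := 5) (body := fun _ => testLit) (s.arr 5)
    (fun D s' => Same s s' ∧
      s'.reg Rkey = if D.any fun p => ofArray (s.arr 6) p.1.1 == p.1.2 then 1 else 0)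
    (by
      rintro D s' ⟨h, -⟩
      exact ⟨by rw [h.1], by rw [h.2 _ (by omega), h1]⟩)
    (by
      rintro D s' x v hx hx' ⟨h, h'⟩
      refine ⟨h.setReg v (by omega), ?_⟩
      rwa [setReg_reg, if_neg (by omega)])
    (by
      rintro D s' ⟨v, c⟩ b ⟨h, hk⟩ hv hsg
      have h1' : s'.reg Rone = 1 := by rw [h.2 _ (by omega), h1]
      set t := s.arr 6 v - c.toNat + (c.toNat - s.arr 6 v) with ht
      set s₂ := (((s'.setReg Ru (s.arr 6 v)).setReg Rt (s.arr 6 v - c.toNat)).setReg Ru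
        (c.toNat - s.arr 6 v)).setReg Rt t with hs₂
      have h₂ : Same s s₂ := by
        rw [hs₂]
        iterate 4 refine Same.setReg ?_ _ (by omega)
        exact h
      have e : testLit.denote s' = if t < 1 then s₂.setReg Rkey 1 else s₂ := by
        simp [testLit, seqs, Prog.denote, hv, hsg, h.1, h1', hs₂, ht]
      have htrue : t < 1 ↔ (ofArray (s.arr 6) v == c) = true := by
        have := hZ v
        simp only [ht, ofArray]
        generalize s.arr 6 v = z at *
        obtain rfl | rfl : z = 0 ∨ z = 1 := by omega
        all_goals cases c <;> simp
      rw [e, List.any_append]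
      by_cases hlt : t < 1
      · rw [if_pos hlt]
        refine ⟨⟨h₂.setReg _ (by omega), ?_⟩, by simp [hs₂]⟩
        simp [htrue.1 hlt]
      · rw [if_neg hlt]
        refine ⟨⟨h₂, ?_⟩, by simp [hs₂]⟩
        have : (ofArray (s.arr 6) v == c) = false := by simpa using fun h => hlt (htrue.2 h)
        rw [List.any_cons, List.any_nil, this, Bool.or_false, Bool.or_false]
        simp [hs₂, hk])
    C (List.replicate r false) (by simp [hl]) []
    ((s.setReg Rlit (s.reg Rp + 1)).setReg Rkey 0)
    ⟨((Same.refl s).setReg _ (by omega)).setReg _ (by omega), by simp⟩ (by simpa using hC.2)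
  obtain ⟨h, hk⟩ := key
  have hany : ((C.zip (List.replicate r false)).any fun p => ofArray (s.arr 6) p.1.1 == p.1.2) =
      satClause (ofArray (s.arr 6)) C := by
    have := map_zip_fst (l := C) (l' := List.replicate r false)
      (fun l : Literal => ofArray (s.arr 6) l.1 == l.2) (by simp [hl])
    calc ((C.zip (List.replicate r false)).any fun p => ofArray (s.arr 6) p.1.1 == p.1.2)
        = ((C.zip (List.replicate r false)).map fun p => ofArray (s.arr 6) p.1.1 == p.1.2).any
            id := by rw [List.any_map]; rfl
      _ = (C.map fun l => ofArray (s.arr 6) l.1 == l.2).any id := by rw [this]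
      _ = satClause (ofArray (s.arr 6)) C := by rw [List.any_map]; rfl
  rw [List.nil_append, hany] at hk
  set s₂ := (forLits 5 (fun _ => testLit) (List.replicate r false)).denote
    ((s.setReg Rlit (s.reg Rp + 1)).setReg Rkey 0) with hs₂
  have e : (evalBlock r).denote s = if 0 < s₂.reg Rkey then s₂ else
      s₂.setReg Rw (s.reg Rw + 1) := by
    have hz' : s₂.reg Rzero = 0 := by rw [h.2 _ (by omega), hz]
    have h1' : s₂.reg Rone = 1 := by rw [h.2 _ (by omega), h1]
    have hw' : s₂.reg Rw = s.reg Rw := h.2 _ (by omega)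
    simp [evalBlock, seqs, Prog.denote, h1, ← hs₂, hz', h1', hw']
  rw [e, hk]
  cases hsat : satClause (ofArray (s.arr 6)) C
  · refine ⟨h.1, fun x hx => ?_⟩
    have := h.2 x hx
    by_cases hxw : x = Rw <;> simp [hxw, this]
  · refine ⟨h.1, fun x hx => ?_⟩
    have := h.2 x hx
    by_cases hxw : x = Rw
    · subst hxw
      simpa using this
    · simpa [hxw] using this

/-- Evaluate the assignment in array `6`, and set the answer if it satisfies enough clauses. -/
def evalProg (r : ℕ) : Prog :=
  .seq (.const Rw 0) (.seq (forClauses (evalBlock r))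
    (seqs [doubles r Rw, .add Rw Rw 0, .ite Rm Rw .skip (.const Rans 1)]))

theorem runs_evalProg (r : ℕ) : ∃ c, ∀ (F : RCNF r) (s₀ : Config), Ready r F.1 5 s₀ →
    (∀ v, s₀.arr 6 v < 2) → ∃ s, Runs (evalProg r) s₀ s (c * (F.1.length + 1)) ∧
      Keep [Ri, Rp, Rw, Rans] [] s₀ s ∧
      s.reg Rans = if s₀.reg 0 + 2 ^ r * (F.1.countP fun C => !satClause (ofArray (s₀.arr 6)) C) ≤
        F.1.length then 1 else s₀.reg Rans := by
  set P := seqs [doubles r Rw, .add Rw Rw 0, .ite Rm Rw .skip (.const Rans 1)] with hP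
  refine ⟨1 + ((evalBlock r).cost + 8) + P.cost, fun F s₀ hs hZ => ?_⟩
  have hs₁ : Ready r F.1 5 (s₀.setReg Rw 0) :=
    hs.keep ((Keep.refl [Rw] [] _).setReg _ (.inr (by simp))) (by simp) (by simp)
  obtain ⟨s, h, hk, hw⟩ := Runs.forClauses (L := F.1) (n := 2 * r + 1)
    (body := evalBlock r) (loopFree_evalBlock r)
    (fun d s => Keep [Ri, Rp, Rw] [] s₀ s ∧
      s.reg Rw = d.countP fun C => !satClause (ofArray (s₀.arr 6)) C)
    (by
      rintro d s ⟨h, -⟩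
      have := hs.keep h (by simp) (by simp)
      exact ⟨this.one, this.num, this.stride⟩)
    (by
      rintro d s x v (rfl | rfl) ⟨h, h'⟩
      · exact ⟨h.setReg _ (.inr (by simp)), by simpa using h'⟩
      · exact ⟨h.setReg _ (.inr (by simp)), by simpa using h'⟩)
    (by
      rintro d C d' hF s ⟨h, hw⟩ hp
      have hs' := hs.keep h (by simp) (by simp)
      rw [hF] at hs'
      have hC := hs'.clause (fun D hD => (F.2 D (by simp [hF, hD])).1) hp
      have h6 : s.arr 6 = s₀.arr 6 := h.2 6 (by simp)
      have key := denote_evalBlock hs'.zero hs'.one (by rw [h6]; exact hZ) hC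
        (F.2 C (by simp [hF])).1
      refine ⟨⟨Keep.same (h.setReg _ (.inr (by simp))) key, ?_⟩, ?_, ?_⟩
      · rw [key.2 _ (by omega), setReg_reg, if_pos rfl, List.countP_append, hw, h6]
        rw [List.countP_singleton]
        generalize satClause (ofArray (s₀.arr 6)) C = b
        cases b <;> simp
      · rw [key.2 _ (by omega)]
        simp
      · rw [key.2 _ (by omega)]
        simp)
    (s₀.setReg Rw 0) ⟨(Keep.refl _ _ _).setReg _ (.inr (by simp)), by simp⟩
  have hr := (Runs.denote (P := .const Rw 0) trivial s₀).seq (h.seq (Runs.denote (P := P)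
    ⟨loopFree_doubles _ _, trivial, ⟨trivial, trivial⟩, trivial⟩ s))
  have h0 : s.reg 0 = s₀.reg 0 := hk.1 0 (by omega) (by simp)
  have hm : s.reg Rm = F.1.length := by rw [hk.1 _ (by omega) (by simp), hs.num]
  have ha : s.reg Rans = s₀.reg Rans := hk.1 _ (by omega) (by simp)
  set W := 2 ^ r * (F.1.countP fun C => !satClause (ofArray (s₀.arr 6)) C) with hW
  have e : P.denote s = if F.1.length < W + s₀.reg 0 then
      (s.setReg Rw W).setReg Rw (W + s₀.reg 0) else
      ((s.setReg Rw W).setReg Rw (W + s₀.reg 0)).setReg Rans 1 := by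
    simp only [hP, seqs, Prog.denote, denote_doubles, hw, ← hW]
    simp [h0, hm]
  have hk' : Keep [Ri, Rp, Rw, Rans] [] s₀ ((s.setReg Rw W).setReg Rw (W + s₀.reg 0)) :=
    ((hk.mono (by simp) (by simp)).setReg _ (.inr (by simp))).setReg _ (.inr (by simp))
  refine ⟨P.denote s, hr.mono ?_, ?_, ?_⟩
  · simp only [Prog.cost]
    have : P.cost ≤ P.cost * (F.1.length + 1) := Nat.le_mul_of_pos_right _ (by omega)
    nlinarith
  · rw [e]
    split_ifs
    · exact hk'
    · exact hk'.setReg _ (.inr (by simp))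
  · rw [e]
    by_cases hle : s₀.reg 0 + W ≤ F.1.length
    · rw [if_neg (by omega), if_pos hle]
      simp
    · rw [if_pos (by omega), if_neg hle]
      simp [ha]

/-- Decide the instance in array `5` and register `0` by trying all assignments to the variables
`0, ..., r * m`, where `m` is the number of clauses. -/
def bruteProg (r : ℕ) : Prog :=
  .seq (seqs [.load Rm 5 Rzero, .const Rstride (2 * r + 1), .const Rans 0, .const Rbound 2,
      .const Rcount 0])
    (.seq (.while Rcount Rm (.seq (doubles r Rbound) (.add Rcount Rcount Rone)))
      (.seq (.const Rcount 0)
        (.seq (.while Rcount Rbound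
            (.seq (evalProg r) (.seq incrProg (.add Rcount Rcount Rone))))
          (.add 0 Rans Rzero))))

/-- There are `2 ^ (r * m + 1)` assignments, and each of them is tested in time `O(m)`. -/
theorem runs_bruteProg (r : ℕ) :
    ∃ c, ∀ (F : RCNF r) (s₀ : Config), Mem (s₀.arr 5) 0 F.encode → s₀.reg Rzero = 0 →
      s₀.reg Rone = 1 → (s₀.arr 6 = fun _ => 0) → (∀ C ∈ F.1, ∀ l ∈ C, l.1 ≤ r * F.1.length) →
      ∃ s, Runs (bruteProg r) s₀ s (c * (2 ^ (r * F.1.length) * (F.1.length + 1))) ∧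
        (s.reg 0 = 1 ↔ (maxSat r).Yes F (s₀.reg 0)) := by
  obtain ⟨c, hc⟩ := runs_evalProg r
  refine ⟨100 + 2 * c + (doubles r Rbound).cost + 10 * r, fun F s₀ hin hz h1 h6 hvars => ?_⟩
  rw [encode_eq] at hin
  set k := s₀.reg 0 with hk
  set m := F.1.length with hm
  set N := r * m + 1 with hN
  have hrun₁ := Runs.denote (P := seqs [.load Rm 5 Rzero, .const Rstride (2 * r + 1),
    .const Rans 0, .const Rbound 2, .const Rcount 0])
    ⟨trivial, trivial, trivial, trivial, trivial, trivial⟩ s₀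
  have he₁ : (seqs [.load Rm 5 Rzero, .const Rstride (2 * r + 1), .const Rans 0, .const Rbound 2,
      .const Rcount 0]).denote s₀ =
      ((((s₀.setReg Rm m).setReg Rstride (2 * r + 1)).setReg Rans 0).setReg Rbound 2).setReg
        Rcount 0 := by
    simp [seqs, Prog.denote, hz, hin.1]
  rw [he₁] at hrun₁
  set s₁ := ((((s₀.setReg Rm m).setReg Rstride (2 * r + 1)).setReg Rans 0).setReg Rbound 2).setReg
    Rcount 0 with hs₁
  have hready₁ : Ready r F.1 5 s₁ := ⟨by simp [hs₁, hz], by simp [hs₁, h1], by simp [hs₁, hm],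
    by simp [hs₁], by simpa [hs₁] using hin.2⟩
  obtain ⟨s₂, hrun₂, hk₂, hb₂, -⟩ := Runs.while_of_count (a := Rcount) (b := Rm)
    (P := .seq (doubles r Rbound) (.add Rcount Rcount Rone)) (T := (doubles r Rbound).cost + 1)
    (fun j s => Keep [Rbound, Rcount] [] s₁ s ∧ s.reg Rbound = 2 ^ (r * j + 1) ∧
      s.reg Rcount = j) m
    (by
      rintro j hj s ⟨hks, hb, hcnt⟩
      have hs := hready₁.keep hks (by simp) (by simp)
      refine ⟨by rw [hcnt, hs.num]; exact hj, _, Runs.denote (P := .seq (doubles r Rbound)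
        (.add Rcount Rcount Rone)) ⟨loopFree_doubles _ _, trivial⟩ s, ?_, ?_, ?_⟩
      · simp only [Prog.denote, denote_doubles]
        exact (hks.setReg _ (.inr (by simp))).setReg _ (.inr (by simp))
      · simp [Prog.denote, denote_doubles, hb]
        ring
      · simp [Prog.denote, denote_doubles, hcnt, hs.one])
    (by
      rintro s ⟨hks, hb, hcnt⟩
      rw [hcnt, (hready₁.keep hks (by simp) (by simp)).num]
      exact lt_irrefl _)
    s₁ ⟨Keep.refl _ _ _, by simp [hs₁], by simp [hs₁]⟩
  set s₃ := s₂.setReg Rcount 0 with hs₃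
  have hk₃ : Keep [Rbound, Rcount] [] s₁ s₃ := hk₂.setReg _ (.inr (by simp))
  have hready₃ := hready₁.keep hk₃ (by simp) (by simp)
  have h0₃ : s₃.reg 0 = k := by
    rw [hk₃.1 _ (by omega) (by simp)]
    simp [hs₁, hk]
  have hb₃ : s₃.reg Rbound = 2 ^ N := by simp [hs₃, hb₂, hN]
  have ha₃ : s₃.reg Rans = 0 := by
    rw [hk₃.1 _ (by omega) (by simp)]
    simp [hs₁]
  have h6₃ : s₃.arr 6 = fun _ => 0 := by
    rw [hk₃.2 _ (by simp)]
    simp [hs₁, h6]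
  obtain ⟨s₄, hrun₄, hk₄, -, -, -, hsound, hcomplete⟩ := Runs.while_of_count (a := Rcount)
    (b := Rbound) (P := .seq (evalProg r) (.seq incrProg (.add Rcount Rcount Rone)))
    (T := c * (m + 1) + (5 * N + 10 + 1))
    (fun n s => Keep [Ri, Rp, Rw, Rans, Rq, Rcount] [6] s₃ s ∧ s.reg Rcount = n ∧
      (∀ v, s.arr 6 v < 2) ∧ binVal (N + 1) (s.arr 6) = n ∧
      (s.reg Rans = 1 → (maxSat r).Yes F k) ∧
      ∀ Z : ℕ → ℕ, (∀ v, Z v < 2) → binVal (N + 1) Z < n →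
        k + 2 ^ r * (F.1.countP fun C => !satClause (ofArray Z) C) ≤ m → s.reg Rans = 1)
    (2 ^ N)
    (by
      rintro n hn s ⟨hks, hcnt, hZ, hval, hso, hco⟩
      have hs := hready₃.keep hks (by simp) (by simp)
      have h0 : s.reg 0 = k := by rw [hks.1 _ (by omega) (by simp), h0₃]
      refine ⟨by rw [hcnt, hks.1 _ (by omega) (by simp), hb₃]; exact hn, ?_⟩
      obtain ⟨s₅, hrun₅, hk₅, hans⟩ := hc F s hs hZ
      have hs₅ := hs.keep hk₅ (by simp) (by simp)
      have h6₅ : s₅.arr 6 = s.arr 6 := hk₅.2 6 (by simp)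
      obtain ⟨s₆, hrun₆, hk₆, hZ₆, hval₆⟩ := runs_incrProg (N := N) (n := n) hs₅.zero hs₅.one
        (by rw [h6₅]; exact hZ) (by rw [h6₅]; exact hval) hn
      have hs₆ := hs₅.keep hk₆ (by simp) (by simp)
      have hcnt₆ : s₆.reg Rcount = n := by
        rw [hk₆.1 _ (by omega) (by simp), hk₅.1 _ (by omega) (by simp), hcnt]
      have hans₆ : s₆.reg Rans = s₅.reg Rans := hk₆.1 _ (by omega) (by simp)
      refine ⟨_, hrun₅.seq (hrun₆.seq (Runs.denote (P := .add Rcount Rcount Rone) trivial s₆)),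
        ?_, ?_, ?_, ?_, ?_, ?_⟩
      · exact ((hks.trans (hk₅.mono (by simp) (by simp))).trans
          (hk₆.mono (by simp) (by simp))).setReg _ (.inr (by simp))
      · simp [Prog.denote, hcnt₆, hs₆.one]
      · simpa [Prog.denote] using hZ₆
      · simpa [Prog.denote] using hval₆
      · simp only [Prog.denote, setReg_reg]
        rw [if_neg (by omega), hans₆, hans, h0]
        split_ifs with hle
        · exact fun _ => (maxSat_yes_iff_unsat F k).2 ⟨_, hle⟩
        · exact hso
      · intro Z hZ' hlt hle
        simp only [Prog.denote, setReg_reg]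
        rw [if_neg (by omega), hans₆, hans, h0]
        obtain hlt | heq : binVal (N + 1) Z < n ∨ binVal (N + 1) Z = n := by omega
        · rw [hco Z hZ' hlt hle]
          simp
        · have hag := binVal_inj hZ' hZ (heq.trans hval.symm)
          have : (F.1.countP fun C => !satClause (ofArray (s.arr 6)) C) =
              F.1.countP fun C => !satClause (ofArray Z) C := by
            refine List.countP_congr fun C hC => ?_
            have : satClause (ofArray (s.arr 6)) C = satClause (ofArray Z) C := by
              refine satClause_congr fun l hl => ?_
              have := hvars C hC l hl
              simp only [ofArray, hag l.1 (by omega)]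
            rw [this]
          rw [this, if_pos hle])
    (by
      rintro s ⟨hks, hcnt, -⟩
      rw [hcnt, hks.1 _ (by omega) (by simp), hb₃]
      exact lt_irrefl _)
    s₃ ⟨Keep.refl _ _ _, by simp [hs₃], by simp [h6₃], by simp [h6₃, binVal], by simp [ha₃],
      fun Z _ h => absurd h (by omega)⟩
  have hrun := hrun₁.seq (hrun₂.seq ((Runs.denote (P := .const Rcount 0) trivial s₂).seq
    (hrun₄.seq (Runs.denote (P := .add 0 Rans Rzero) trivial s₄))))
  have hz₄ : s₄.reg Rzero = 0 := (hready₃.keep hk₄ (by simp) (by simp)).zero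
  refine ⟨_, hrun.mono ?_, ?_⟩
  · simp only [seqs, Prog.cost]
    have hpow : 2 ^ N = 2 * 2 ^ (r * m) := by rw [hN, pow_succ, mul_comm]
    rw [hpow]
    have hE : 1 ≤ 2 ^ (r * m) := Nat.one_le_two_pow
    generalize 2 ^ (r * m) = E at hE ⊢
    generalize (doubles r Rbound).cost = D
    have h₁ : m + 1 ≤ E * (m + 1) := Nat.le_mul_of_pos_left _ hE
    have h₂ : E ≤ E * (m + 1) := Nat.le_mul_of_pos_right _ (by omega)
    have h₃ : D * m ≤ D * (E * (m + 1)) := Nat.mul_le_mul_left _ (by omega)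
    have h₄ : r * (E * m) ≤ r * (E * (m + 1)) := by gcongr; omega
    rw [hN]
    nlinarith
  · have : ((Prog.add 0 Rans Rzero).denote s₄).reg 0 = s₄.reg Rans := by simp [Prog.denote, hz₄]
    rw [this]
    refine ⟨hsound, fun hyes => ?_⟩
    obtain ⟨τ, hτ⟩ := (maxSat_yes_iff_unsat F k).1 hyes
    -- only the variables up to `r * m` matter, so that the others may be set to false
    set Z : ℕ → ℕ := fun v => if v < N then (τ v).toNat else 0 with hZdef
    have hZ : ∀ v, Z v < 2 := fun v => by
      simp only [hZdef]
      split_ifs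
      · cases τ v <;> simp
      · omega
    refine hcomplete Z hZ ?_ ?_
    · have : binVal (N + 1) Z = binVal N Z := by
        rw [binVal, Finset.sum_range_succ, hZdef]
        simp [binVal]
      rw [this]
      exact binVal_lt hZ N
    · have : (F.1.countP fun C => !satClause (ofArray Z) C) =
          F.1.countP fun C => !satClause τ C := by
        refine List.countP_congr fun C hC => ?_
        have : satClause (ofArray Z) C = satClause τ C := by
          refine satClause_congr fun l hl => ?_
          have hlt : l.1 < N := by
            have := hvars C hC l hl
            omega
          simp only [ofArray, hZdef, if_pos hlt]
          cases τ l.1 <;> simp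
        rw [this]
      rw [this]
      exact hτ


/-! ### Sizes of encodings and the resulting kernels -/

theorem length_le_bitLength (w : List ℕ) : w.length ≤ bitLength w := by
  induction w with
  | nil => simp
  | cons a w ih =>
    simp only [bitLength, List.map_cons, List.sum_cons, List.length_cons] at ih ⊢
    omega

theorem bitLength_le {w : List ℕ} {B : ℕ} (h : ∀ a ∈ w, a ≤ B) :
    bitLength w ≤ w.length * (B + 1) := by
  have := List.sum_le_card_nsmul (w.map fun a => Nat.size a + 1) (B + 1) (by
    intro x hx
    obtain ⟨a, ha, rfl⟩ := List.mem_map.1 hx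
    have : Nat.size a ≤ a := Nat.size_le.2 Nat.lt_two_pow_self
    have := h a ha
    omega)
  simpa [bitLength] using this

theorem polyBounded_of_le {g : ℕ → ℕ} (A d : ℕ) (h : ∀ n, g n ≤ A * (n ^ d + 1)) :
    PolyBounded g := by
  refine ⟨2 * A + d, fun n => (h n).trans ?_⟩
  obtain rfl | hn := Nat.eq_zero_or_pos n
  · have : 0 ^ d ≤ 1 := by
      rcases Nat.eq_zero_or_pos d with rfl | hd
      · simp
      · simp [hd.ne']
    have : A * 0 ^ d ≤ A * 1 := Nat.mul_le_mul_left _ this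
    rw [mul_add]
    omega
  · have h₁ : n ^ d ≤ n ^ (2 * A + d) := Nat.pow_le_pow_right hn (by omega)
    have h₂ : A * n ^ d ≤ (2 * A + d) * n ^ (2 * A + d) := Nat.mul_le_mul (by omega) h₁
    rw [mul_add, mul_one]
    omega

theorem length_encode {r : ℕ} (F : RCNF r) : F.encode.length = 1 + (2 * r + 1) * F.1.length := by
  rw [encode_eq, List.length_cons, length_fWords fun C hC => (F.2 C hC).1, add_comm]

theorem length_lt_size {r : ℕ} (F : RCNF r) : F.1.length + 1 ≤ (maxSat r).size F := by
  have h := length_le_bitLength F.encode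
  rw [length_encode] at h
  change _ ≤ bitLength F.encode
  nlinarith

theorem length_flatten {r : ℕ} (F : RCNF r) : F.1.flatten.length = r * F.1.length := by
  rw [List.length_flatten, List.map_congr_left (g := fun _ => r) fun C hC => (F.2 C hC).1]
  simp [mul_comm]

theorem numVars_le {r : ℕ} (F : RCNF r) : F.numVars ≤ r * F.1.length := by
  rw [← length_flatten, ← List.length_map (f := Prod.fst)]
  exact List.toFinset_card_le _

theorem size_le {r : ℕ} {F : RCNF r} (h : ∀ C ∈ F.1, ∀ l ∈ C, l.1 ≤ r * F.1.length) :
    (maxSat r).size F ≤ (1 + (2 * r + 1) * F.1.length) * ((r + 1) * (F.1.length + 1) + 1) := by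
  rw [← length_encode]
  refine bitLength_le (w := F.encode) fun a ha => ?_
  simp only [RCNF.encode, List.mem_cons, List.mem_flatMap, List.not_mem_nil, or_false] at ha
  obtain rfl | ⟨C, hC, rfl | ⟨l, hl, rfl | rfl⟩⟩ := ha
  · nlinarith
  · rw [(F.2 C hC).1]
    nlinarith
  · have := h C hC l hl
    nlinarith
  · have := Bool.toNat_le l.2
    nlinarith

theorem numVars_toLin_le {r : ℕ} (F : RCNF r) : (toLin F).numVars ≤ r * (2 ^ r * F.1.length) := by
  refine (List.toFinset_card_le _).trans ?_
  rw [List.length_flatMap]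
  refine (List.sum_le_card_nsmul _ r ?_).trans ?_
  · intro x hx
    obtain ⟨e, he, rfl⟩ := List.mem_map.1 hx
    exact ((toLin F).2 e he).2.1
  · rw [List.length_map, smul_eq_mul, mul_comm]
    refine Nat.mul_le_mul_left _ ?_
    simpa [toLin] using length_occs_le r F.1

theorem size_toLin_le {r : ℕ} {F : RCNF r} (h : ∀ C ∈ F.1, ∀ l ∈ C, l.1 ≤ r * F.1.length) :
    (maxLin r).size (toLin F) ≤ (1 + (r + 3) * (2 ^ r * F.1.length)) *
      ((2 ^ r + r + 1) * (F.1.length + 1) + 1) := by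
  have hlen : (toLin F).encode.length ≤ 1 + (r + 3) * (2 ^ r * F.1.length) := by
    rw [LinSystem.encode, List.length_cons, add_comm, List.length_flatMap]
    refine Nat.add_le_add_left ((List.sum_le_card_nsmul _ (r + 3) ?_).trans ?_) 1
    · intro x hx
      obtain ⟨e, he, rfl⟩ := List.mem_map.1 hx
      have := ((toLin F).2 e he).2.1
      simp
      omega
    · rw [List.length_map, smul_eq_mul, mul_comm]
      refine Nat.mul_le_mul_left _ ?_
      simpa [toLin] using length_occs_le r F.1
  refine (bitLength_le (w := (toLin F).encode) (B := (2 ^ r + r + 1) * (F.1.length + 1))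
    fun a ha => ?_).trans (Nat.mul_le_mul_right _ hlen)
  have h1 : 1 ≤ 2 ^ r := Nat.one_le_two_pow
  simp only [LinSystem.encode, List.mem_cons, List.mem_flatMap, List.not_mem_nil, or_false,
    List.mem_append] at ha
  obtain rfl | ⟨e, he, ha⟩ := ha
  · have : (toLin F).1.length ≤ 2 ^ r * F.1.length := by
      simpa [toLin] using length_occs_le r F.1
    nlinarith
  · have hr := ((toLin F).2 e he).2.1
    obtain ⟨o, ho, rfl⟩ := List.mem_map.1 he
    obtain rfl | hv | rfl | rfl := ha
    · nlinarith
    · obtain ⟨p, hp, rfl⟩ := List.mem_map.1 hv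
      have := h o.1 (mem_occs.1 ho).1 p.1 (List.of_mem_zip (List.mem_filter.1 hp).1).1
      nlinarith
    · have := ZMod.val_lt (linEq o).rhs
      nlinarith
    · change 1 ≤ _
      nlinarith

/-- The bound on the number of clauses of the kernel, divided by `k ^ 2`. -/
def kernelConst (r : ℕ) : ℕ := 2 ^ (r - 1) * (4 * 64 ^ r)

theorem IsKernel.length_le {r k k' : ℕ} {F G : RCNF r} (h : IsKernel F k G k') :
    G.1.length ≤ kernelConst r * k ^ 2 := by
  refine h.clauses.trans_eq ?_
  rw [kernelConst]
  ring

theorem mul_le_quartic {a b a' b' B k m : ℕ} (hm : m ≤ B * k ^ 2) :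
    (a + b * m) * (a' * (m + 1) + b') ≤
      2 * ((a + b * B) * (a' * (B + 1) + b')) * (k ^ 4 + 1) := by
  have h₁ : a + b * m ≤ (a + b * B) * (k ^ 2 + 1) := by
    have := Nat.mul_le_mul_left b hm
    nlinarith [Nat.zero_le (a * k ^ 2), Nat.zero_le (b * B)]
  have h₂ : a' * (m + 1) + b' ≤ (a' * (B + 1) + b') * (k ^ 2 + 1) := by
    have := Nat.mul_le_mul_left a' hm
    nlinarith [Nat.zero_le (a' * k ^ 2), Nat.zero_le (a' * B), Nat.zero_le (b' * k ^ 2)]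
  have h₃ : (k ^ 2 + 1) * (k ^ 2 + 1) ≤ 2 * (k ^ 4 + 1) := by
    zify
    nlinarith [sq_nonneg ((k : ℤ) ^ 2 - 1)]
  calc (a + b * m) * (a' * (m + 1) + b')
      ≤ ((a + b * B) * (k ^ 2 + 1)) * ((a' * (B + 1) + b') * (k ^ 2 + 1)) := Nat.mul_le_mul h₁ h₂
    _ = ((a + b * B) * (a' * (B + 1) + b')) * ((k ^ 2 + 1) * (k ^ 2 + 1)) := by ring
    _ ≤ ((a + b * B) * (a' * (B + 1) + b')) * (2 * (k ^ 4 + 1)) := Nat.mul_le_mul_left _ h₃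
    _ = _ := by ring

/-- The kernel is solved by exhaustive search. -/
theorem exists_decides (r : ℕ) : ∃ (P : Prog) (C : ℕ),
    Decides P (maxSat r) (fun (F : RCNF r) k => C * (F.numClauses + 2 ^ (C * k ^ 2))) := by
  obtain ⟨c₁, h₁⟩ := runs_kernelProg r (o := 5) (.inr rfl)
  obtain ⟨c₂, h₂⟩ := runs_bruteProg r
  refine ⟨.seq (kernelProg 5 r) (bruteProg r), c₁ + c₂ + (r + 1) * kernelConst r,
    fun (F : RCNF r) k => ?_⟩
  obtain ⟨s, G, hrun, hG, hz, hone, harr, hker⟩ := h₁ F k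
  obtain ⟨s', hrun', hans⟩ := h₂ G s hG hz hone
    (by rw [harr 6 (by simp)]; funext i; simp [initial]) hker.vars
  obtain ⟨t, ht, he⟩ := hrun.seq hrun'
  refine ⟨s', t, he, ht.trans ?_, hans.trans hker.yes_iff.symm⟩
  have hm := hker.length_le
  set C := c₁ + c₂ + (r + 1) * kernelConst r with hC
  change _ ≤ C * (F.1.length + 2 ^ (C * k ^ 2))
  have hpow : 2 ^ (r * G.1.length) * (G.1.length + 1) ≤ 2 ^ (C * k ^ 2) := by
    calc 2 ^ (r * G.1.length) * (G.1.length + 1)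
        ≤ 2 ^ (r * G.1.length) * 2 ^ G.1.length :=
          Nat.mul_le_mul_left _ (Nat.lt_two_pow_self (n := G.1.length))
      _ = 2 ^ ((r + 1) * G.1.length) := by rw [← pow_add]; ring_nf
      _ ≤ 2 ^ (C * k ^ 2) := by
          refine Nat.pow_le_pow_right (by norm_num) ?_
          calc (r + 1) * G.1.length ≤ (r + 1) * (kernelConst r * k ^ 2) :=
                Nat.mul_le_mul_left _ hm
            _ = (r + 1) * kernelConst r * k ^ 2 := by ring
            _ ≤ C * k ^ 2 := Nat.mul_le_mul_right _ (by omega)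
  have hone : 1 ≤ 2 ^ (C * k ^ 2) := Nat.one_le_two_pow
  generalize 2 ^ (C * k ^ 2) = E at *
  calc c₁ * (F.1.length + 1) + c₂ * (2 ^ (r * G.1.length) * (G.1.length + 1))
      ≤ c₁ * (F.1.length + E) + c₂ * (F.1.length + E) :=
        Nat.add_le_add (Nat.mul_le_mul_left _ (by omega)) (Nat.mul_le_mul_left _ (by omega))
    _ = (c₁ + c₂) * (F.1.length + E) := by ring
    _ ≤ C * (F.1.length + E) := Nat.mul_le_mul_right _ (by omega)

theorem isFPT_maxSat (r : ℕ) : IsFPT (maxSat r) := by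
  obtain ⟨P, C, hP⟩ := exists_decides r
  refine ⟨P, 1, fun k => C * (1 + 2 ^ (C * k ^ 2)), Primrec.to_comp ?_, fun F k => ?_⟩
  · have hpow : Primrec₂ fun a b : ℕ => a ^ b := Primrec₂.unpaired'.1 Nat.Primrec.pow
    have hk : Primrec fun k : ℕ => C * k ^ 2 :=
      Primrec.nat_mul.comp (Primrec.const C) (hpow.comp Primrec.id (Primrec.const 2))
    exact Primrec.nat_mul.comp (Primrec.const C) (Primrec.nat_add.comp (Primrec.const 1)
      (hpow.comp (Primrec.const 2) hk))
  · obtain ⟨s, t, he, ht, hans⟩ := hP F k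
    refine ⟨s, t, he, ht.trans ?_, hans⟩
    have h := length_lt_size F
    change C * (F.1.length + 2 ^ (C * k ^ 2)) ≤ _
    have hs : 1 ≤ (maxSat r).size F := by omega
    change _ ≤ (maxSat r).size F ^ 1 * (C * (1 + 2 ^ (C * k ^ 2)))
    generalize (maxSat r).size F = S at *
    calc C * (F.1.length + 2 ^ (C * k ^ 2)) ≤ C * (S * 1 + S * 2 ^ (C * k ^ 2)) := by
          refine Nat.mul_le_mul_left _ (Nat.add_le_add (by omega) ?_)
          exact Nat.le_mul_of_pos_left _ hs
      _ = S ^ 1 * (C * (1 + 2 ^ (C * k ^ 2))) := by ring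

/-- Programs whose output words lie in array `1` and whose time is linear in the number of clauses
are polynomial-time algorithms. -/
theorem exists_computes {r : ℕ} {L : ParamProblem} {P : Prog} {K : RCNF r → ℕ → L.Inst × ℕ}
    (c : ℕ) (h : ∀ F k, ∃ s, Runs P (initial F.encode k) s (c * (F.1.length + 1)) ∧
      Mem (s.arr 1) 0 (L.encode (K F k).1) ∧ s.reg 0 = (K F k).2) :
    ∃ (P : Prog) (p : ℕ → ℕ), PolyBounded p ∧
      Computes P (maxSat r) L K (fun F k => p ((maxSat r).size F + Nat.size k)) := by
  refine ⟨P, fun n => c * (n ^ 1 + 1), polyBounded_of_le c 1 fun _ => le_rfl,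
    fun (F : RCNF r) k => ?_⟩
  obtain ⟨s, ⟨t, ht, he⟩, hmem, h0⟩ := h F k
  refine ⟨s, t, he, ht.trans (Nat.mul_le_mul_left _ ?_), h0, fun i hi => ?_⟩
  · have := length_lt_size F
    rw [pow_one]
    omega
  · simpa using mem_iff.1 hmem i hi

theorem exists_kernelization (r : ℕ) :
    ∃ (K : RCNF r → ℕ → RCNF r × ℕ) (f g : ℕ → ℕ) (C : ℕ),
      IsKernelization (maxSat r) K f g ∧ PolyBounded g ∧
      ∀ (F : RCNF r) (k : ℕ),
        (K F k).1.numClauses ≤ C * k ^ 2 ∧ (K F k).1.numVars ≤ C * k ^ 2 := by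
  obtain ⟨c, h⟩ := runs_kernelProg r (o := 1) (.inl rfl)
  choose s G hrun hG _ _ _ hker using h
  set B := kernelConst r with hB
  refine ⟨fun F k => (G F k, (s F k).reg 0), fun k => 2 ^ r * k + 1,
    fun k => 2 * ((1 + (2 * r + 1) * B) * ((r + 1) * (B + 1) + 1)) * (k ^ 4 + 1), (r + 1) * B,
    ⟨exists_computes c fun F k => ⟨s F k, hrun F k, hG F k, rfl⟩, fun F k =>
      ⟨(hker F k).yes_iff, (hker F k).param,
        (size_le (hker F k).vars).trans (mul_le_quartic (hker F k).length_le)⟩⟩,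
    polyBounded_of_le _ 4 fun _ => le_rfl, fun F k => ⟨?_, (numVars_le _).trans ?_⟩⟩
  all_goals
    have := (hker F k).length_le
    rw [← hB] at this
  · change (G F k).1.length ≤ _
    nlinarith [Nat.zero_le (r * B * k ^ 2)]
  · have := Nat.mul_le_mul_left r this
    change r * (G F k).1.length ≤ _
    nlinarith [Nat.zero_le (B * k ^ 2)]

theorem exists_bikernelization (r : ℕ) :
    ∃ (K : RCNF r → ℕ → LinSystem r × ℕ) (f g : ℕ → ℕ) (C : ℕ),
      IsBikernelization (maxSat r) (maxLin r) K f g ∧ PolyBounded g ∧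
      ∀ (F : RCNF r) (k : ℕ),
        (K F k).1.totalWeight ≤ C * k ^ 2 ∧ (K F k).1.numVars ≤ C * k ^ 2 := by
  obtain ⟨c, h⟩ := runs_kernelProg r (o := 5) (.inr rfl)
  choose s G hrun hG hz hone _ hker using h
  obtain ⟨c', h'⟩ := runs_linProg r
  set B := kernelConst r with hB
  have hB' : ∀ F k, 2 ^ r * (G F k).1.length ≤ 2 ^ r * B * k ^ 2 := fun F k => by
    rw [mul_assoc]
    exact Nat.mul_le_mul_left _ (hker F k).length_le
  refine ⟨fun F k => (toLin (G F k), (s F k).reg 0), fun k => 2 ^ r * k + 1,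
    fun k => 2 * ((1 + (r + 3) * 2 ^ r * B) * ((2 ^ r + r + 1) * (B + 1) + 1)) * (k ^ 4 + 1),
    (r + 1) * (2 ^ r * B), ⟨exists_computes (P := .seq (kernelProg 5 r) (linProg r))
      (c + c' * (2 ^ (r - 1) * 2 ^ r + 1)) fun F k => ?_, fun F k =>
      ⟨(hker F k).yes_iff.trans (toLin_yes_iff _ _).symm, (hker F k).param, ?_⟩⟩,
    polyBounded_of_le _ 4 fun _ => le_rfl, fun F k => ⟨?_, (numVars_toLin_le _).trans ?_⟩⟩
  · obtain ⟨s', hrun', hmem, h0⟩ := h' (G F k) (s F k) (hG F k) (hz F k) (hone F k)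
    refine ⟨s', ((hrun F k).seq hrun').mono ?_, hmem, h0⟩
    have := (hker F k).growth
    rw [← mul_assoc] at this
    generalize 2 ^ (r - 1) * 2 ^ r = A at *
    have : c' * ((G F k).1.length + 1) ≤ c' * ((A + 1) * (F.1.length + 1)) :=
      Nat.mul_le_mul_left _ (by nlinarith)
    nlinarith
  · refine (size_toLin_le (hker F k).vars).trans ?_
    rw [← mul_assoc (r + 3)]
    exact mul_le_quartic (hker F k).length_le
  · change (toLin (G F k)).totalWeight ≤ _
    rw [totalWeight_toLin]
    have := (length_occs_le r (G F k).1).trans (hB' F k)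
    nlinarith [Nat.zero_le (r * (2 ^ r * B * k ^ 2))]
  · have := Nat.mul_le_mul_left r (hB' F k)
    change r * (2 ^ r * (G F k).1.length) ≤ _
    nlinarith [Nat.zero_le (2 ^ r * B * k ^ 2)]

end AboveTLB

open AboveTLB
theorem theorem4 (r : ℕ) :
    -- fixed-parameter tractability, and the running time `O(m) + 2^{O(k^2)}`
    IsFPT (maxSat r) ∧
    (∃ (P : Prog) (C : ℕ),
      Decides P (maxSat r) (fun (F : RCNF r) k => C * (F.numClauses + 2 ^ (C * k ^ 2)))) ∧
    -- a polynomial-size bikernel, with weight and number of variables `O(k^2)`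
    (∃ (K : RCNF r → ℕ → LinSystem r × ℕ) (f g : ℕ → ℕ) (C : ℕ),
      IsBikernelization (maxSat r) (maxLin r) K f g ∧ PolyBounded g ∧
      ∀ (F : RCNF r) (k : ℕ),
        (K F k).1.totalWeight ≤ C * k ^ 2 ∧ (K F k).1.numVars ≤ C * k ^ 2) ∧
    -- a polynomial-size kernel, with `O(k^2)` clauses and variables
    (∃ (K : RCNF r → ℕ → RCNF r × ℕ) (f g : ℕ → ℕ) (C : ℕ),
      IsKernelization (maxSat r) K f g ∧ PolyBounded g ∧
      ∀ (F : RCNF r) (k : ℕ),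
        (K F k).1.numClauses ≤ C * k ^ 2 ∧ (K F k).1.numVars ≤ C * k ^ 2) ∧
    -- if the simplified polynomial has more than `4 * 8^{2r} * k^2` terms, the answer is Yes
    (∀ (F : RCNF r) (k : ℕ),
      4 * 8 ^ (2 * r) * k ^ 2 < F.poly.support.card → (maxSat r).Yes F k) :=
  ⟨isFPT_maxSat r, exists_decides r, exists_bikernelization r, exists_kernelization r,
    maxSat_yes_of_card_support⟩
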